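/- Let $p\in(0,1]$, $q=1-p$, and consider the asymmetric simple exclusion process with $N\ge 1$ particles on $\mathbb Z$: each particle, independently, attempts at rate $p$ to jump one step to the right and at rate $q$ one step to the left, a jump being suppressed when the target site is occupied. Let $y_1<\dots<y_N$ be the initial positions and $x_1(t)<\dots<x_N(t)$ the positions at time $t\ge 0$. Write $\varepsilon(\xi)=p\,\xi^{-1}+q\,\xi-1$ and, for $j\ge 1$ and $z_1,\dots,z_j\in\mathbb Z$, $$\psi_j(\xi_1,\dots,\xi_j;z_1,\dots,z_j)=p^{j(j+1)/2}\,\prod_{i=1}^{j}\xi_i^{z_i}\prod_{1\le i<k\le j}\frac{\xi_k-\xi_i}{p+q\xi_i\xi_k-\xi_i}\;\prod_{i=1}^{j}\frac{(\xi_1\cdots\xi_j)^{-1}-\xi_i}{p+q\xi_i(\xi_1\cdots\xi_j)^{-1}-\xi_i}\cdot\frac{1}{1-\xi_1\cdots\xi_j}\cdot\frac{1}{\prod_{i=1}^{j}(1-\xi_i)}\;e^{\left[\sum_{i}\varepsilon(\xi_i)+\varepsilon\left((\xi_1\cdots\xi_j)^{-1}\right)\right]t}.$$ Let $\mathcal C_r$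 be the circle $|\xi|=r$, positively oriented, and let every differential $d\xi$ incorporate the factor $(2\pi i)^{-1}$. Say that the poles of $\psi_j$ lie outside $\mathcal C_r$ if none of the denominators $p+q\xi_i\xi_k-\xi_i$ $(i<k)$, $p+q\xi_i(\xi_1\cdots\xi_j)^{-1}-\xi_i$, $1-\xi_1\cdots\xi_j$, $1-\xi_i$ vanishes when $0<|\xi_1|,\dots,|\xi_j|\le r$. Then: (i) There is $r_0>0$, depending only on $p$, such that for all $0<r<r_0$ and all $j\ge1$ the poles of $\psi_j$ lie outside $\mathcal C_r$. (ii) For every $t\ge0$, $x_1(t)$ is integrable, and for every $r>0$ such that the poles of $\psi_1,\dots,\psi_{N-1}$ lie outside $\mathcal C_r$, $$\mathbb E(x_1(t))=(p-q)\,t+y_1-\sum_{j=1}^{N-1}\int_{\mathcal C_r}\cdots\int_{\mathcal C_r}\psi_j(\xi_1,\dots,\xi_j;\,y_{j+1}-y_1,\dots,y_{j+1}-y_j)\,d\xi_1\cdots d\xi_j .$$ (iii) For every integer $z\ge1$, every $t\ge0$, and every $r>0$ such that the poles of $\psi_1$ lie outside $\mathcal C_r$, $$\int_{\mathcal C_r}\psi_1(\xi;z)\,d\xi=2pt\,e^{-2t}\,[I_{z-1}(2t)+I_z(2t)]+(2z-1)\,p\,\Big\{\tfrac12e^{-2t}I_0(2t)-\tfrac12+e^{-2t}\sum_{k=1}^{z-1}I_k(2t)\Big\},$$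 where $I_n(x)=\sum_{k\ge0}\frac{(x/2)^{2k+n}}{k!\,(k+n)!}$ is the modified Bessel function of the first kind. -/

import Mathlib

open MeasureTheory ProbabilityTheory
open scoped NNReal BoundedContinuousFunction

noncomputable section

namespace ASEP

/-- Configurations of `N` labelled particles on `ℤ`, listed from left to right:
`x 0 < x 1 < ⋯ < x (N - 1)`. (The topology and the σ-algebra inherited from `Fin N → ℤ` are
discrete.) -/
abbrev Config (N : ℕ) : Type := {x : Fin N → ℤ // StrictMono x}

/-- The configuration after particle `i` attempts to jump by `d`. For `d = 1` and `d = -1` the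
displaced positions are strictly increasing exactly when the target site is vacant; otherwise the
jump is suppressed. -/
def attempt {N : ℕ} (x : Config N) (i : Fin N) (d : ℤ) : Config N :=
  open Classical in
  if h : StrictMono (Function.update x.1 i (x.1 i + d)) then ⟨_, h⟩ else x

/-- The action of the generator of the `N`-particle ASEP on a function: each particle attempts to
jump to the right at rate `p` and to the left at rate `q`. -/
def genFun {N : ℕ} (p q : ℝ) (f : Config N → ℝ) (x : Config N) : ℝ :=
  ∑ i : Fin N, (p * (f (attempt x i 1) - f x) + q * (f (attempt x i (-1)) - f x))

theorem abs_genFun_le {N : ℕ} (p q : ℝ) (f : Config N →ᵇ ℝ) (x : Config N) :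
    ‖genFun p q f x‖ ≤ (N * ((|p| + |q|) * 2)) * ‖f‖ := by
  have hd : ∀ a b : Config N, |f a - f b| ≤ 2 * ‖f‖ := fun a b => by
    have := f.dist_le_two_norm a b
    rwa [Real.dist_eq] at this
  have hi : ∀ i ∈ (Finset.univ : Finset (Fin N)),
      ‖p * (f (attempt x i 1) - f x) + q * (f (attempt x i (-1)) - f x)‖
        ≤ (|p| + |q|) * 2 * ‖f‖ := fun i _ => by
    rw [Real.norm_eq_abs]
    calc _ ≤ |p * (f (attempt x i 1) - f x)| + |q * (f (attempt x i (-1)) - f x)| :=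
            abs_add_le _ _
      _ = |p| * |f (attempt x i 1) - f x| + |q| * |f (attempt x i (-1)) - f x| := by
            rw [abs_mul, abs_mul]
      _ ≤ |p| * (2 * ‖f‖) + |q| * (2 * ‖f‖) := by gcongr <;> exact hd _ _
      _ = _ := by ring
  refine (norm_sum_le_of_le _ hi).trans (le_of_eq ?_)
  simp
  ring

/-- The generator of the `N`-particle ASEP, a bounded operator on the Banach space of bounded
functions of the configuration. -/
def generator (N : ℕ) (p q : ℝ) : (Config N →ᵇ ℝ) →L[ℝ] (Config N →ᵇ ℝ) :=
  LinearMap.mkContinuous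
    { toFun := fun f => BoundedContinuousFunction.ofNormedAddCommGroupDiscrete
        (genFun p q f) ((N * ((|p| + |q|) * 2)) * ‖f‖) (abs_genFun_le p q f)
      map_add' := fun f g => by
        ext x
        simp only [BoundedContinuousFunction.coe_ofNormedAddCommGroupDiscrete,
          BoundedContinuousFunction.coe_add, Pi.add_apply, genFun]
        rw [← Finset.sum_add_distrib]
        exact Finset.sum_congr rfl fun i _ => by ring
      map_smul' := fun c f => by
        ext x
        simp only [BoundedContinuousFunction.coe_ofNormedAddCommGroupDiscrete,
          BoundedContinuousFunction.coe_smul, smul_eq_mul, RingHom.id_apply, genFun]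
        rw [Finset.mul_sum]
        exact Finset.sum_congr rfl fun i _ => by ring }
    (N * ((|p| + |q|) * 2))
    (fun f => BoundedContinuousFunction.norm_ofNormedAddCommGroup_le _ (by positivity)
      (abs_genFun_le p q f))

theorem generator_apply (N : ℕ) (p q : ℝ) (f : Config N →ᵇ ℝ) (x : Config N) :
    generator N p q f x
      = ∑ i : Fin N, (p * (f (attempt x i 1) - f x) + q * (f (attempt x i (-1)) - f x)) :=
  rfl

/-- The uniformly continuous semigroup `exp (t A)` generated by a bounded operator `A`. -/
def expSemigroup {E : Type*} [NormedAddCommGroup E] [NormedSpace ℝ E] (A : E →L[ℝ] E) (t : ℝ≥0) :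
    E →L[ℝ] E :=
  NormedSpace.exp ((t : ℝ) • A)

/-- The transition semigroup `exp (t L)` of the `N`-particle ASEP. -/
def semigroup (N : ℕ) (p q : ℝ) (t : ℝ≥0) : (Config N →ᵇ ℝ) →L[ℝ] (Config N →ᵇ ℝ) :=
  expSemigroup (generator N p q) t

/-- `X` is an `N`-particle ASEP with hopping rates `p` to the right and `q` to the left and initial
configuration `Y`: it starts at `Y` and it is a Markov process, with respect to the filtration `ℱ`,
whose transition semigroup is the one generated by the ASEP generator. -/
structure IsASEP {N : ℕ} (p q : ℝ) (Y : Config N) {Ω : Type*} {m : MeasurableSpace Ω}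
    (μ : Measure Ω) (ℱ : Filtration ℝ≥0 m) (X : ℝ≥0 → Ω → Config N) : Prop where
  adapted : ∀ t, Measurable[ℱ t] (X t)
  initial : ∀ᵐ ω ∂μ, X 0 ω = Y
  markov : ∀ (s t : ℝ≥0) (f : Config N →ᵇ ℝ),
    μ[fun ω => f (X (s + t) ω) | ℱ s] =ᵐ[μ] fun ω => semigroup N p q t f (X s ω)

/-- `ε(ξ) = p ξ⁻¹ + q ξ - 1`. -/
def eps (p q : ℝ) (ξ : ℂ) : ℂ := p * ξ⁻¹ + q * ξ - 1

/-- The integrand `ψ_j(ξ_1, …, ξ_j; z_1, …, z_j)` at time `t`. -/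
def psi (p q t : ℝ) {j : ℕ} (ξ : Fin j → ℂ) (z : Fin j → ℤ) : ℂ :=
  (p : ℂ) ^ (j * (j + 1) / 2) * (∏ i, ξ i ^ z i)
    * (∏ i, ∏ k ∈ Finset.Ioi i, (ξ k - ξ i) / (p + q * ξ i * ξ k - ξ i))
    * (∏ i, ((∏ l, ξ l)⁻¹ - ξ i) / (p + q * ξ i * (∏ l, ξ l)⁻¹ - ξ i))
    * (1 / (1 - ∏ l, ξ l)) * (1 / ∏ i, (1 - ξ i))
    * Complex.exp (((∑ i, eps p q (ξ i)) + eps p q (∏ l, ξ l)⁻¹) * t)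

/-- All the poles of `ψ_j`, other than those at `ξ_i = 0`, lie outside the circle with center `0`
and radius `r`: no denominator of `ψ_j` vanishes for `0 < |ξ_i| ≤ r`. -/
def PolesOutside (p q : ℝ) (j : ℕ) (r : ℝ) : Prop :=
  ∀ ξ : Fin j → ℂ, (∀ i, ξ i ≠ 0 ∧ ‖ξ i‖ ≤ r) →
    (∀ i k, i < k → (p : ℂ) + q * ξ i * ξ k - ξ i ≠ 0) ∧
    (∀ i, (p : ℂ) + q * ξ i * (∏ l, ξ l)⁻¹ - ξ i ≠ 0) ∧
    (1 - ∏ l, ξ l ≠ 0) ∧ (∀ i, 1 - ξ i ≠ 0)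

/-- `∫_{C_r} ⋯ ∫_{C_r} f(ξ) dξ_1 ⋯ dξ_j` over the circle with center `0` and radius `r`, where every
`dξ_i` incorporates the factor `(2πi)⁻¹`. -/
def circlesIntegral {j : ℕ} (r : ℝ) (f : (Fin j → ℂ) → ℂ) : ℂ :=
  (2 * Real.pi * Complex.I)⁻¹ ^ j * torusIntegral f 0 (fun _ => r)

/-- The modified Bessel function `I_n` of the first kind. -/
def besselI (n : ℕ) (x : ℝ) : ℝ :=
  ∑' k : ℕ, (x / 2) ^ (2 * k + n) / ((k.factorial : ℝ) * ((k + n).factorial : ℝ))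

end ASEP

end

/-! The left-most particle drifts with speed `p - q`, except that its right jumps, attempted at rate
`p`, are suppressed while its neighbour is adjacent. Hence E x₁(t) = (p - q) t + y₁ - u(t, Y), where
u(t, ·) = ∫₀ᵗ e^{sL} b ds is `blockedTime` and b = `blockedRate` equals `p` if the second particle
is adjacent to the first and 0 otherwise (`IsASEP.integral_left`: Dynkin's formula for truncations
of x₁, then a limit). What remains is to identify u with the sum of contour integrals
(`sum_term_eq`).

The function u satisfies u' = L u + b and u(0) = 0, and such a solution is unique among those
bounded uniformly in the configuration on bounded time intervals (`eq_zero_of_backward`). The sum of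
integrals solves the same problem, by a Bethe ansatz. With particles numbered from 0, in the `j`-th
term the particles 0, …, j - 1 carry the variables ξᵢ, the particle j carries (∏ ξᵢ)⁻¹ and all later
ones carry 1; shifting a particle multiplies the integrand by a power of its variable, so every term
solves the free evolution equation (`PolesOutside.hasDerivAt_term`). Free evolution and L differ by
one boundary operator for each adjacent pair (`sum_free_eq`). The terms vanish at time 0
(`PolesOutside.term_zero`) and are uniformly bounded (`PolesOutside.exists_norm_term_le`).

The boundary operator at the pair (k, k + 1) must give `p` for k = 0 and 0 otherwise
(`boundary_sum`). It kills the terms j < k, where both variables are 1, and the terms j > k + 1,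
whose integrand becomes antisymmetric in two variables. The terms k and k + 1 have to cancel each
other, and for k = 0 the missing term j = 0 leaves the source `p`.

This cancellation is the core (`integral_boundaryTwo`). One takes a kernel in ξ, ζ, w with a free
integer exponent `m` and moves the contour of w from a small circle to a large one. The residues at
the poles of the pair factors integrate to zero (`Admissible.integral_resPair`). The residue at w =
(∏ ξᵢ ζ)⁻¹ yields one side of the identity for ζ = 1 and the other side after integration over ζ,
independently of `m`. The residue at w = 1 is the kernel with ζ in place of w, and the small circles
contribute nothing by antisymmetry in ζ and w. On the large circle the dependence on `m` is a
monomial of modulus larger than 1, so letting `m` tend to -∞ proves the identity.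

Small circles are admissible by elementary estimates (`exists_polesOutside`). The closed form of the
first term follows from an integration by parts, the recurrence `besselTail_succ` and the symmetry w
↦ w⁻¹ (`integral_firstTerm`, `besselTail_eq`). -/

noncomputable section

namespace ASEP

open Set Filter Topology

/-! ### Normalized Lebesgue measure on circles and tori -/

/-- The normalized arc length measure on the circle `|z| = r`. -/
def circ (r : ℝ) : Measure ℂ :=
  ((volume.restrict (Ioc 0 (2 * Real.pi))) (univ : Set ℝ))⁻¹ •
    (volume.restrict (Ioc 0 (2 * Real.pi))).map (circleMap 0 r)

theorem restrict_univ_eq :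
    (volume.restrict (Ioc 0 (2 * Real.pi))) (univ : Set ℝ) = ENNReal.ofReal (2 * Real.pi) := by
  simp

instance isProbabilityMeasure_circ (r : ℝ) : IsProbabilityMeasure (circ r) := by
  constructor
  rw [circ, Measure.smul_apply, Measure.map_apply (by fun_prop) MeasurableSet.univ,
    preimage_univ, restrict_univ_eq, smul_eq_mul, ENNReal.inv_mul_cancel]
  · simp [Real.pi_pos]
  · exact ENNReal.ofReal_ne_top

theorem ae_circ {r : ℝ} (hr : 0 ≤ r) : ∀ᵐ z ∂circ r, ‖z‖ = r := by
  refine Measure.ae_smul_measure ?_ _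
  rw [ae_map_iff (by fun_prop) (measurableSet_eq_fun (by fun_prop) (by fun_prop))]
  exact Eventually.of_forall fun θ => by simp [abs_of_nonneg hr]

/-- The normalized measure on the torus `|ξ i| = r i`. -/
def tor {n : ℕ} (r : Fin n → ℝ) : Measure (Fin n → ℂ) := Measure.pi fun i => circ (r i)

instance isProbabilityMeasure_tor {n : ℕ} (r : Fin n → ℝ) : IsProbabilityMeasure (tor r) := by
  unfold tor; infer_instance

/-- The support of `tor r`. -/
def torSet {n : ℕ} (r : Fin n → ℝ) : Set (Fin n → ℂ) := univ.pi fun i => Metric.sphere 0 (r i)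

theorem mem_torSet {n : ℕ} {r : Fin n → ℝ} {ξ : Fin n → ℂ} :
    ξ ∈ torSet r ↔ ∀ i, ‖ξ i‖ = r i := by
  simp [torSet]

theorem isCompact_torSet {n : ℕ} (r : Fin n → ℝ) : IsCompact (torSet r) :=
  isCompact_univ_pi fun _ => isCompact_sphere _ _

theorem ae_tor {n : ℕ} {r : Fin n → ℝ} (hr : ∀ i, 0 ≤ r i) : ∀ᵐ ξ ∂tor r, ξ ∈ torSet r := by
  have : ∀ i, ∀ᵐ ξ ∂tor r, ‖ξ i‖ = r i := fun i =>
    (Measure.quasiMeasurePreserving_eval (fun i => circ (r i)) i).ae (ae_circ (hr i))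
  filter_upwards [ae_all_iff.2 this] with ξ hξ using mem_torSet.2 hξ

theorem integrable_of_compact {X : Type*} [TopologicalSpace X] [T2Space X] [MeasurableSpace X]
    [BorelSpace X] {μ : Measure X} [IsFiniteMeasure μ] {K : Set X} (hK : IsCompact K)
    (hμ : ∀ᵐ x ∂μ, x ∈ K) {f : X → ℂ} (hf : ContinuousOn f K) : Integrable f μ := by
  have h := hf.integrableOn_compact hK (μ := μ)
  rwa [IntegrableOn, Measure.restrict_eq_self_of_ae_mem hμ] at h

theorem integrable_tor {n : ℕ} {r : Fin n → ℝ} (hr : ∀ i, 0 ≤ r i) {f : (Fin n → ℂ) → ℂ}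
    (hf : ContinuousOn f (torSet r)) : Integrable f (tor r) :=
  integrable_of_compact (isCompact_torSet r) (ae_tor hr) hf

theorem integrable_circ {r : ℝ} (hr : 0 ≤ r) {f : ℂ → ℂ}
    (hf : ContinuousOn f (Metric.sphere 0 r)) : Integrable f (circ r) :=
  integrable_of_compact (isCompact_sphere 0 r)
    (by filter_upwards [ae_circ hr] with z hz using by simpa using hz) hf

theorem ae_tor_prod_circ {n : ℕ} {r : Fin n → ℝ} (hr : ∀ i, 0 ≤ r i) {ρ : ℝ} (hρ : 0 ≤ ρ) :
    ∀ᵐ x ∂(tor r).prod (circ ρ), x ∈ torSet r ×ˢ Metric.sphere (0 : ℂ) ρ := by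
  have h1 := (Measure.quasiMeasurePreserving_fst (μ := tor r) (ν := circ ρ)).ae (ae_tor hr)
  have h2 := (Measure.quasiMeasurePreserving_snd (μ := tor r) (ν := circ ρ)).ae (ae_circ hρ)
  filter_upwards [h1, h2] with x hx1 hx2 using ⟨hx1, by simpa using hx2⟩

theorem integrable_tor_prod_circ {n : ℕ} {r : Fin n → ℝ} (hr : ∀ i, 0 ≤ r i) {ρ : ℝ}
    (hρ : 0 ≤ ρ) {f : (Fin n → ℂ) × ℂ → ℂ}
    (hf : ContinuousOn f (torSet r ×ˢ Metric.sphere (0 : ℂ) ρ)) :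
    Integrable f ((tor r).prod (circ ρ)) :=
  integrable_of_compact ((isCompact_torSet r).prod (isCompact_sphere 0 ρ))
    (ae_tor_prod_circ hr hρ) hf

/-- On the circle dz = i z dθ, which is where the extra factor `z` of the integrand comes from. -/
theorem integral_circ (r : ℝ) {f : ℂ → ℂ} (hf : ContinuousOn f (Metric.sphere 0 |r|)) :
    ∫ z, z * f z ∂circ r = (2 * Real.pi * Complex.I)⁻¹ * ∮ z in C(0, r), f z := by
  have hm : AEStronglyMeasurable (fun z : ℂ => z * f z)
      ((volume.restrict (Ioc 0 (2 * Real.pi))).map (circleMap 0 r)) := by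
    have hc : ContinuousOn (fun z : ℂ => z * f z) (Metric.sphere 0 |r|) := continuousOn_id.mul hf
    have hae : ∀ᵐ z ∂((volume.restrict (Ioc 0 (2 * Real.pi))).map (circleMap 0 r)),
        z ∈ Metric.sphere (0 : ℂ) |r| := by
      exact (ae_map_iff (p := (· ∈ Metric.sphere (0 : ℂ) |r|)) (by fun_prop)
        Metric.isClosed_sphere.measurableSet).2
        (Eventually.of_forall fun θ => circleMap_mem_sphere' 0 r θ)
    have := hc.aestronglyMeasurable (μ := (volume.restrict (Ioc 0 (2 * Real.pi))).map
      (circleMap 0 r)) Metric.isClosed_sphere.measurableSet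
    rwa [Measure.restrict_eq_self_of_ae_mem hae] at this
  rw [circ, integral_smul_measure, integral_map (by fun_prop) hm, restrict_univ_eq,
    circleIntegral, intervalIntegral.integral_of_le Real.two_pi_pos.le,
    ENNReal.toReal_inv, ENNReal.toReal_ofReal Real.two_pi_pos.le, Complex.real_smul]
  simp only [deriv_circleMap, smul_eq_mul]
  have : ∀ θ, circleMap 0 r θ * Complex.I * f (circleMap 0 r θ)
      = Complex.I * (circleMap 0 r θ * f (circleMap 0 r θ)) := fun θ => by ring
  simp only [this]
  rw [integral_const_mul]
  push_cast
  have hpi : (Real.pi : ℂ) ≠ 0 := by simp [Real.pi_ne_zero]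
  field_simp

/-- `torusIntegral` runs over a closed box and `circ` over a half-open interval; the difference is a
null set. -/
theorem tor_eq_map {n : ℕ} (r : Fin n → ℝ) :
    tor r = ((ENNReal.ofReal (2 * Real.pi))⁻¹) ^ n •
      (volume.restrict (Icc (0 : Fin n → ℝ) fun _ => 2 * Real.pi)).map (torusMap 0 r) := by
  have hm : torusMap (0 : Fin n → ℂ) r = fun θ i => circleMap 0 (r i) (θ i) := by
    ext θ i; simp [torusMap, circleMap]
  have hres : (volume.restrict (Icc (0 : Fin n → ℝ) fun _ => 2 * Real.pi))
      = Measure.pi fun _ => volume.restrict (Ioc 0 (2 * Real.pi)) := by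
    rw [← Measure.restrict_pi_pi (fun _ : Fin n => (volume : Measure ℝ))]
    exact (Measure.restrict_congr_set Measure.univ_pi_Ioc_ae_eq_Icc).symm
  rw [hres, hm, Measure.pi_map_pi (fun i => (by fun_prop)), tor]
  refine Measure.pi_eq fun s hs => ?_
  rw [Measure.smul_apply, Measure.pi_pi, smul_eq_mul]
  simp only [circ, Measure.smul_apply, smul_eq_mul, restrict_univ_eq]
  rw [Finset.prod_mul_distrib]
  simp

theorem circlesIntegral_eq {j : ℕ} {r : ℝ} {f : (Fin j → ℂ) → ℂ} (hr : 0 ≤ r)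
    (hf : ContinuousOn f (torSet fun _ => r)) :
    circlesIntegral r f = ∫ ξ, (∏ i, ξ i) * f ξ ∂tor fun _ => r := by
  have hm : AEStronglyMeasurable (fun ξ : Fin j → ℂ => (∏ i, ξ i) * f ξ)
      ((volume.restrict (Icc (0 : Fin j → ℝ) fun _ => 2 * Real.pi)).map
        (torusMap 0 fun _ => r)) := by
    have hc : ContinuousOn (fun ξ : Fin j → ℂ => (∏ i, ξ i) * f ξ) (torSet fun _ => r) :=
      ContinuousOn.mul (by fun_prop) hf
    have hmeas : Measurable (torusMap (0 : Fin j → ℂ) fun _ => r) := by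
      unfold torusMap; fun_prop
    have hK := (isCompact_torSet fun _ : Fin j => r).isClosed.measurableSet
    have hae : ∀ᵐ z ∂((volume.restrict (Icc (0 : Fin j → ℝ) fun _ => 2 * Real.pi)).map
        (torusMap 0 fun _ => r)), z ∈ torSet fun _ => r := by
      exact (ae_map_iff (p := (· ∈ torSet fun _ : Fin j => r)) hmeas.aemeasurable hK).2
        (Eventually.of_forall fun θ => mem_torSet.2 fun i => by
          simp [torusMap, Complex.norm_exp, abs_of_nonneg hr])
    have := hc.aestronglyMeasurable (μ := ((volume.restrict (Icc (0 : Fin j → ℝ)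
      fun _ => 2 * Real.pi)).map (torusMap 0 fun _ => r))) hK
    rwa [Measure.restrict_eq_self_of_ae_mem hae] at this
  have hmeas : Measurable (torusMap (0 : Fin j → ℂ) fun _ => r) := by
    unfold torusMap; fun_prop
  rw [tor_eq_map, integral_smul_measure, integral_map hmeas.aemeasurable hm, circlesIntegral,
    torusIntegral]
  simp only [ENNReal.toReal_pow, ENNReal.toReal_inv, ENNReal.toReal_ofReal Real.two_pi_pos.le,
    smul_eq_mul, torusMap, Pi.zero_apply, zero_add, Complex.real_smul]
  simp only [Finset.prod_mul_distrib (g := fun _ => Complex.I), Finset.prod_const, Finset.card_univ,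
    Fintype.card_fin]
  have : ∀ a b : ℂ, a * Complex.I ^ j * b = Complex.I ^ j * (a * b) := fun a b => by ring
  simp only [this]
  rw [integral_const_mul, ← mul_assoc]
  congr 1
  push_cast
  rw [← mul_pow]
  congr 1
  have hpi : (Real.pi : ℂ) ≠ 0 := by simp [Real.pi_ne_zero]
  field_simp

theorem integral_tor_insertNth {n : ℕ} (r : Fin (n + 1) → ℝ) (hr : ∀ i, 0 ≤ r i)
    (i : Fin (n + 1)) {f : (Fin (n + 1) → ℂ) → ℂ} (hf : ContinuousOn f (torSet r)) :
    ∫ ξ, f ξ ∂tor r = ∫ η, ∫ z, f (i.insertNth z η) ∂circ (r i)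
      ∂tor fun l => r (i.succAbove l) := by
  have hp := (measurePreserving_piFinSuccAbove (fun i => circ (r i)) i).symm
  have h1 := hp.integral_comp' (g := f)
  have hint : Integrable (fun x => f ((MeasurableEquiv.piFinSuccAbove (fun _ => ℂ) i).symm x))
      ((circ (r i)).prod (Measure.pi fun l => circ (r (i.succAbove l)))) :=
    hp.integrable_comp_emb (MeasurableEquiv.measurableEmbedding _) |>.2 (integrable_tor hr hf)
  rw [tor, ← h1, integral_prod_symm _ hint]
  rfl

theorem integral_tor_comp_perm {n : ℕ} (r : ℝ) (σ : Equiv.Perm (Fin n))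
    (f : (Fin n → ℂ) → ℂ) :
    ∫ ξ, f (fun i => ξ (σ i)) ∂tor (fun _ => r) = ∫ ξ, f ξ ∂tor fun _ => r := by
  have h := (measurePreserving_piCongrLeft (fun _ : Fin n => circ r) σ.symm).integral_comp' (g := f)
  rw [tor, ← h]
  refine integral_congr_ae (Eventually.of_forall fun ξ => ?_)
  refine congrArg f (funext fun i => ?_)
  obtain ⟨k, rfl⟩ := σ.symm.surjective i
  rw [MeasurableEquiv.coe_piCongrLeft, Equiv.piCongrLeft_apply_apply]
  simp

theorem integral_tor_zero (r : Fin 0 → ℝ) (f : (Fin 0 → ℂ) → ℂ) (ξ : Fin 0 → ℂ) :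
    ∫ ξ, f ξ ∂tor r = f ξ := by
  have : f = fun _ => f ξ := by ext x; congr 1; exact Subsingleton.elim _ _
  rw [this]; simp

/-! ### Contour deformation -/

/-- Induction on the set of poles: subtract the principal part `c b / (w - b)` at one pole, remove
the singularity, and use that the integral of `(w - b)⁻¹` is 2πi over the large circle and 0 over
the small one. -/
theorem circleIntegral_sub_circleIntegral {r R : ℝ} (hr : 0 < r) (hrR : r ≤ R) (S : Finset ℂ)
    (c : ℂ → ℂ) (f : ℂ → ℂ)
    (hf : ∀ w, r ≤ ‖w‖ → ‖w‖ ≤ R → w ∉ S → DifferentiableAt ℂ f w)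
    (hS : ∀ b ∈ S, r < ‖b‖ ∧ ‖b‖ < R)
    (hc : ∀ b ∈ S, Tendsto (fun w => (w - b) * f w) (𝓝[≠] b) (𝓝 (c b))) :
    (∮ w in C(0, R), f w) - (∮ w in C(0, r), f w)
      = 2 * Real.pi * Complex.I * ∑ b ∈ S, c b := by
  induction S using Finset.induction_on generalizing f with
  | empty =>
    rw [Finset.sum_empty, mul_zero, sub_eq_zero]
    have hd : ∀ z ∈ Metric.closedBall (0 : ℂ) R \ Metric.ball 0 r, DifferentiableAt ℂ f z := by
      intro z hz
      simp only [Set.mem_sdiff, mem_closedBall_zero_iff, mem_ball_zero_iff, not_lt] at hz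
      exact hf z hz.2 hz.1 (by simp)
    refine Complex.circleIntegral_eq_of_differentiable_on_annulus_off_countable hr hrR
      countable_empty (fun z hz => (hd z hz).continuousAt.continuousWithinAt) fun z hz => hd z ?_
    simp only [Set.mem_sdiff, mem_closedBall_zero_iff, mem_ball_zero_iff, not_lt, not_le] at hz ⊢
    exact ⟨hz.1.1.le, hz.1.2.le⟩
  | insert b S hb ih =>
    obtain ⟨hrb, hbR⟩ := hS b (Finset.mem_insert_self _ _)
    set g : ℂ → ℂ := fun w => f w - c b * (w - b)⁻¹ with hg
    -- The value of `g` at `b` is meaningless (division by zero); the limit there makes the function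
    -- holomorphic.
    set f' : ℂ → ℂ := Function.update g b (limUnder (𝓝[≠] b) g) with hf'
    have hinv : ∀ w, w ≠ b → DifferentiableAt ℂ (fun w => c b * (w - b)⁻¹) w := fun w hw =>
      (differentiableAt_const _).mul ((differentiableAt_id.sub_const b).inv (sub_ne_zero.2 hw))
    have hgd : ∀ w, r ≤ ‖w‖ → ‖w‖ ≤ R → w ≠ b → w ∉ S → DifferentiableAt ℂ g w :=
      fun w h1 h2 h3 h4 => (hf w h1 h2 (by simp [h3, h4])).sub (hinv w h3)
    have hne : ∀ w, w ≠ b → f' =ᶠ[𝓝 w] g := fun w hw => by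
      filter_upwards [isOpen_ne.mem_nhds hw] with x hx using Function.update_of_ne hx _ _
    have hnhds : {w : ℂ | r ≤ ‖w‖ ∧ ‖w‖ ≤ R ∧ w ∉ S} ∈ 𝓝 b := by
      have h1 : ∀ᶠ w : ℂ in 𝓝 b, r < ‖w‖ := continuous_norm.continuousAt.eventually_const_lt hrb
      have h2 : ∀ᶠ w : ℂ in 𝓝 b, ‖w‖ < R := continuous_norm.continuousAt.eventually_lt_const hbR
      have h3 : ∀ᶠ w : ℂ in 𝓝 b, w ∉ S := S.finite_toSet.isClosed.isOpen_compl.mem_nhds hb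
      filter_upwards [h1, h2, h3] with w a1 a2 a3 using ⟨a1.le, a2.le, a3⟩
    have hsub : Tendsto (fun w : ℂ => w - b) (𝓝[≠] b) (𝓝 0) := by
      have : Tendsto (fun w : ℂ => w - b) (𝓝 b) (𝓝 (b - b)) :=
        (continuous_id.sub continuous_const).tendsto b
      rw [sub_self] at this
      exact this.mono_left nhdsWithin_le_nhds
    have hres : Tendsto (fun w => (w - b) * (g w - g b)) (𝓝[≠] b) (𝓝 0) := by
      have h := ((hc b (Finset.mem_insert_self _ _)).sub_const (c b)).sub (hsub.mul_const (g b))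
      rw [sub_self, zero_mul, sub_zero] at h
      refine h.congr' ?_
      filter_upwards [self_mem_nhdsWithin] with w hw
      have : w - b ≠ 0 := sub_ne_zero.2 hw
      simp only [hg]
      field_simp
    have hf'd : DifferentiableOn ℂ f' {w : ℂ | r ≤ ‖w‖ ∧ ‖w‖ ≤ R ∧ w ∉ S} := by
      refine Complex.differentiableOn_update_limUnder_of_isLittleO hnhds
        (fun w hw => (hgd w hw.1.1 hw.1.2.1 hw.2 hw.1.2.2).differentiableWithinAt) ?_
      rw [Asymptotics.isLittleO_iff_tendsto']
      · refine hres.congr fun w => ?_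
        rw [div_inv_eq_mul, mul_comm]
      · filter_upwards [self_mem_nhdsWithin] with w hw h0
        exact absurd h0 (inv_ne_zero (sub_ne_zero.2 hw))
    have key := ih f' (fun w h1 h2 h3 => by
        by_cases hwb : w = b
        · subst hwb
          exact hf'd.differentiableAt hnhds
        · exact ((hne w hwb).differentiableAt_iff).2 (hgd w h1 h2 hwb h3))
      (fun b' hb' => hS b' (Finset.mem_insert_of_mem hb')) (fun b' hb' => by
        have hbb : b' ≠ b := fun h => hb (h ▸ hb')
        have h1 := hc b' (Finset.mem_insert_of_mem hb')
        have h2 : Tendsto (fun w => (w - b') * (c b * (w - b)⁻¹)) (𝓝[≠] b') (𝓝 0) := by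
          have h3 : ContinuousAt (fun w => (w - b') * (c b * (w - b)⁻¹)) b' :=
            (continuousAt_id.sub continuousAt_const).mul (hinv b' hbb).continuousAt
          have h4 := h3.tendsto
          simp only [sub_self, zero_mul] at h4
          exact h4.mono_left nhdsWithin_le_nhds
        have h5 := h1.sub h2
        rw [sub_zero] at h5
        refine h5.congr' ?_
        filter_upwards [nhdsWithin_le_nhds (hne b' hbb)] with w hw
        rw [hw]; simp only [hg]; ring)
    have hcirc : ∀ ρ, r ≤ ρ → ρ ≤ R → ‖b‖ ≠ ρ → (∀ b' ∈ S, ‖b'‖ ≠ ρ) →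
        (∮ w in C(0, ρ), f' w)
          = (∮ w in C(0, ρ), f w) - c b * ∮ w in C(0, ρ), (w - b)⁻¹ := by
      intro ρ h1 h2 h3 h4
      have hρ : 0 ≤ ρ := hr.le.trans h1
      have hwb : ∀ w ∈ Metric.sphere (0 : ℂ) ρ, w ≠ b := fun w hw h => by
        subst h; exact h3 (by simpa using hw)
      have hwS : ∀ w ∈ Metric.sphere (0 : ℂ) ρ, w ∉ S := fun w hw h =>
        h4 w h (by simpa using hw)
      rw [← smul_eq_mul (c b), ← circleIntegral.integral_smul, ← circleIntegral.integral_sub]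
      · refine circleIntegral.integral_congr hρ fun w hw => ?_
        rw [(hne w (hwb w hw)).eq_of_nhds]
        simp [hg]
      · refine ContinuousOn.circleIntegrable hρ fun w hw => ?_
        have hw' : ‖w‖ = ρ := by simpa using hw
        exact (hf w (hw' ▸ h1) (hw' ▸ h2)
          (by simp [hwb w hw, hwS w hw])).continuousAt.continuousWithinAt
      · refine ContinuousOn.circleIntegrable hρ fun w hw => ?_
        exact (hinv w (hwb w hw)).continuousAt.continuousWithinAt
    have hR : (∮ w in C(0, R), (w - b)⁻¹) = 2 * Real.pi * Complex.I :=
      circleIntegral.integral_sub_inv_of_mem_ball (by simpa using hbR)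
    have hr0 : (∮ w in C(0, r), (w - b)⁻¹) = 0 := by
      have hd : ∀ z ∈ Metric.closedBall (0 : ℂ) r, DifferentiableAt ℂ (fun w => (w - b)⁻¹) z := by
        intro z hz
        refine (differentiableAt_id.sub_const b).inv (sub_ne_zero.2 ?_)
        rintro rfl
        rw [mem_closedBall_zero_iff] at hz
        exact absurd hz (not_le.2 hrb)
      exact Complex.circleIntegral_eq_zero_of_differentiable_on_off_countable hr.le
        countable_empty (fun z hz => (hd z hz).continuousAt.continuousWithinAt)
        fun z hz => hd z (Metric.ball_subset_closedBall hz.1)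
    rw [hcirc R hrR le_rfl hbR.ne fun b' hb' => (hS b' (Finset.mem_insert_of_mem hb')).2.ne,
      hcirc r le_rfl hrR hrb.ne' fun b' hb' => (hS b' (Finset.mem_insert_of_mem hb')).1.ne',
      hR, hr0] at key
    rw [Finset.sum_insert hb, mul_add, ← key]
    ring

/-- Residue theorem for the annulus, for the average over a circle. -/
theorem integral_circ_sub {r R : ℝ} (hr : 0 < r) (hrR : r ≤ R) {ι : Type*}
    (s : Finset ι) (b : ι → ℂ) (hb : InjOn b s) (c : ι → ℂ) (f : ℂ → ℂ)
    (hf : ∀ w, r ≤ ‖w‖ → ‖w‖ ≤ R → (∀ i ∈ s, w ≠ b i) → DifferentiableAt ℂ f w)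
    (hS : ∀ i ∈ s, r < ‖b i‖ ∧ ‖b i‖ < R)
    (hc : ∀ i ∈ s, Tendsto (fun w => (w - b i) * f w) (𝓝[≠] b i) (𝓝 (b i * c i))) :
    (∫ w, f w ∂circ R) - ∫ w, f w ∂circ r = ∑ i ∈ s, c i := by
  classical
  have hfc : ∀ ρ, r ≤ ρ → ρ ≤ R → (∀ i ∈ s, ‖b i‖ ≠ ρ) → ∫ w, f w ∂circ ρ
      = (2 * Real.pi * Complex.I)⁻¹ * ∮ w in C(0, ρ), w⁻¹ * f w := by
    intro ρ h1 h2 h3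
    have hρ : 0 < ρ := hr.trans_le h1
    rw [← integral_circ ρ]
    · refine integral_congr_ae ?_
      filter_upwards [ae_circ hρ.le] with w hw
      have : w ≠ 0 := norm_pos_iff.1 (hw ▸ hρ)
      field_simp
    · rw [abs_of_pos hρ]
      intro w hw
      have hw' : ‖w‖ = ρ := by simpa using hw
      have h0 : w ≠ 0 := norm_pos_iff.1 (hw' ▸ hρ)
      exact (continuousAt_inv₀ h0).continuousWithinAt.mul (hf w (hw' ▸ h1) (hw' ▸ h2)
        fun i hi h => h3 i hi (h ▸ hw')).continuousAt.continuousWithinAt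
  rw [hfc R hrR le_rfl fun i hi => (hS i hi).2.ne,
    hfc r le_rfl hrR fun i hi => (hS i hi).1.ne', ← mul_sub]
  -- Residues labelled by indices become a function of the pole; injectivity of `b` leaves one
  -- nonzero summand at each pole.
  have h := circleIntegral_sub_circleIntegral hr hrR (s.image b)
    (fun z => ∑ i ∈ s, if b i = z then c i else 0) (fun w => w⁻¹ * f w)
    (fun w h1 h2 h3 => (differentiableAt_inv (norm_pos_iff.1 (hr.trans_le h1))).mul
      (hf w h1 h2 fun i hi h => h3 (Finset.mem_image.2 ⟨i, hi, h.symm⟩)))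
    (fun z hz => by
      obtain ⟨i, hi, rfl⟩ := Finset.mem_image.1 hz
      exact hS i hi)
    (fun z hz => by
      obtain ⟨i, hi, rfl⟩ := Finset.mem_image.1 hz
      have hb0 : b i ≠ 0 := norm_pos_iff.1 (hr.trans (hS i hi).1)
      rw [Finset.sum_eq_single_of_mem i hi fun k hk hki =>
        if_neg fun h => hki (hb hk hi h), if_pos rfl]
      have h1 := ((continuousAt_inv₀ hb0).tendsto.mono_left
        (nhdsWithin_le_nhds (s := {b i}ᶜ))).mul (hc i hi)
      rw [inv_mul_cancel_left₀ hb0] at h1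
      exact h1.congr fun w => by ring)
  rw [h, ← mul_assoc, inv_mul_cancel₀ (by simp [Real.pi_ne_zero]), one_mul,
    Finset.sum_image hb]
  refine Finset.sum_congr rfl fun i hi => ?_
  rw [Finset.sum_eq_single_of_mem i hi fun k hk hki =>
    if_neg fun h => hki (hb hk hi h), if_pos rfl]

theorem integral_circ_eq_of_differentiable {r R : ℝ} (hr : 0 < r) (hrR : r ≤ R) {f : ℂ → ℂ}
    (hf : ∀ w, r ≤ ‖w‖ → ‖w‖ ≤ R → DifferentiableAt ℂ f w) :
    ∫ w, f w ∂circ R = ∫ w, f w ∂circ r := by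
  have := integral_circ_sub hr hrR (∅ : Finset ℂ) id (by simp) id f
    (fun w h1 h2 _ => hf w h1 h2) (by simp) (by simp)
  simpa [sub_eq_zero] using this

/-- Cauchy's theorem. Averages are later shown to vanish by extracting one factor `w` with a
holomorphic cofactor. -/
theorem integral_circ_mul_eq_zero {r : ℝ} (hr : 0 ≤ r) {f : ℂ → ℂ}
    (hf : ∀ w, ‖w‖ ≤ r → DifferentiableAt ℂ f w) : ∫ w, w * f w ∂circ r = 0 := by
  have hd : ∀ z ∈ Metric.closedBall (0 : ℂ) r, DifferentiableAt ℂ f z := fun z hz =>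
    hf z (by simpa using hz)
  rw [integral_circ, Complex.circleIntegral_eq_zero_of_differentiable_on_off_countable hr
    countable_empty (fun z hz => (hd z hz).continuousAt.continuousWithinAt)
    fun z hz => hd z (Metric.ball_subset_closedBall hz.1), mul_zero]
  rw [abs_of_nonneg hr]
  exact fun z hz => (hd z (Metric.sphere_subset_closedBall hz)).continuousAt.continuousWithinAt

theorem continuousOn_torSet {n : ℕ} {r : ℝ} {f : (Fin n → ℂ) → ℂ}
    (hf : ∀ ξ : Fin n → ℂ, (∀ i, ξ i ≠ 0 ∧ ‖ξ i‖ ≤ r) → DifferentiableAt ℂ f ξ)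
    {ρ : Fin n → ℝ} (hρ : ∀ i, 0 < ρ i ∧ ρ i ≤ r) : ContinuousOn f (torSet ρ) := by
  intro ξ hξ
  rw [mem_torSet] at hξ
  exact (hf ξ fun i => ⟨norm_pos_iff.1 (hξ i ▸ (hρ i).1),
    hξ i ▸ (hρ i).2⟩).continuousAt.continuousWithinAt

theorem differentiable_insertNth {n : ℕ} (i : Fin (n + 1)) (η : Fin n → ℂ) :
    Differentiable ℂ fun z : ℂ => (i.insertNth (α := fun _ => ℂ) z η) := by
  rw [differentiable_pi]
  intro l
  rcases Fin.eq_self_or_eq_succAbove i l with rfl | ⟨l, rfl⟩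
  · simp
  · simp

/-- The average over a torus of a function that is holomorphic on a punctured polydisc does not
depend on the radii. -/
theorem integral_tor_eq_of_differentiable {n : ℕ} {r : ℝ} {f : (Fin n → ℂ) → ℂ}
    (hf : ∀ ξ : Fin n → ℂ, (∀ i, ξ i ≠ 0 ∧ ‖ξ i‖ ≤ r) → DifferentiableAt ℂ f ξ)
    (ρ ρ' : Fin n → ℝ) (hρ : ∀ i, 0 < ρ i ∧ ρ i ≤ r) (hρ' : ∀ i, 0 < ρ' i ∧ ρ' i ≤ r) :
    ∫ ξ, f ξ ∂tor ρ = ∫ ξ, f ξ ∂tor ρ' := by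
  -- One radius is changed at a time: with the other variables frozen on their circles, this is
  -- Cauchy's theorem on an annulus.
  have step : ∀ (ρ : Fin n → ℝ) (i : Fin n) (a : ℝ), (∀ i, 0 < ρ i ∧ ρ i ≤ r) → 0 < a → a ≤ r →
      ∫ ξ, f ξ ∂tor (Function.update ρ i a) = ∫ ξ, f ξ ∂tor ρ := by
    intro ρ i a hρ ha har
    cases n with
    | zero => exact i.elim0
    | succ n =>
      have hρ2 : ∀ l, 0 < Function.update ρ i a l ∧ Function.update ρ i a l ≤ r := by
        intro l
        by_cases hl : l = i
        · subst hl; simpa using ⟨ha, har⟩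
        · simpa [hl] using hρ l
      rw [integral_tor_insertNth _ (fun l => (hρ2 l).1.le) i (continuousOn_torSet hf hρ2),
        integral_tor_insertNth _ (fun l => (hρ l).1.le) i (continuousOn_torSet hf hρ)]
      simp only [Function.update_self, ne_eq, Fin.succAbove_ne, not_false_eq_true,
        Function.update_of_ne]
      refine integral_congr_ae ?_
      filter_upwards [ae_tor (r := fun l => ρ (i.succAbove l)) fun l => (hρ _).1.le] with η hη
      rw [mem_torSet] at hη
      have hd : ∀ z : ℂ, z ≠ 0 → ‖z‖ ≤ r →
          DifferentiableAt ℂ (fun z => f (i.insertNth z η)) z := fun z h0 h1 => by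
        refine (hf _ fun l => ?_).comp z (differentiable_insertNth i η z)
        rcases Fin.eq_self_or_eq_succAbove i l with rfl | ⟨l, rfl⟩
        · simpa using ⟨h0, h1⟩
        · simp only [Fin.insertNth_apply_succAbove]
          exact ⟨norm_pos_iff.1 (hη l ▸ (hρ _).1), hη l ▸ (hρ _).2⟩
      have hgen : ∀ a b : ℝ, 0 < a → a ≤ b → b ≤ r →
          ∫ z, f (i.insertNth z η) ∂circ b = ∫ z, f (i.insertNth z η) ∂circ a :=
        fun a b h1 h2 h3 => integral_circ_eq_of_differentiable h1 h2 fun w h4 h5 =>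
          hd w (norm_pos_iff.1 (h1.trans_le h4)) (h5.trans h3)
      rcases le_total a (ρ i) with h | h
      · exact (hgen _ _ ha h (hρ i).2).symm
      · exact hgen _ _ (hρ i).1 h har
  have main : ∀ s : Finset (Fin n), ∫ ξ, f ξ ∂tor (fun i => if i ∈ s then ρ' i else ρ i)
      = ∫ ξ, f ξ ∂tor ρ := by
    intro s
    induction s using Finset.induction_on with
    | empty => simp
    | insert i s hi ih =>
      rw [← ih, ← step (fun l => if l ∈ s then ρ' l else ρ l) i (ρ' i) (fun l => by
        split_ifs; exacts [hρ' l, hρ l]) (hρ' i).1 (hρ' i).2]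
      congr 2
      ext l
      by_cases hl : l = i
      · subst hl; simp
      · simp [hl]
  rw [← main Finset.univ]
  simp

/-! ### The factors of the Bethe ansatz -/

/-- The factor `(b - a) / (p + q a b - a)`. -/
def pairFactor (p q : ℝ) (a b : ℂ) : ℂ := (b - a) / (p + q * a * b - a)

/-- The product of `pairFactor` over all pairs `i < k`. -/
def pairProd (p q : ℝ) {n : ℕ} (ξ : Fin n → ℂ) : ℂ :=
  ∏ i, ∏ k, if i < k then pairFactor p q (ξ i) (ξ k) else 1

/-- The product of the factors pairing all `ξ i` with one further variable. -/
def extProd (p q : ℝ) {n : ℕ} (ξ : Fin n → ℂ) (x : ℂ) : ℂ := ∏ i, pairFactor p q (ξ i) x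

/-- The one-variable factors. -/
def oneFactor (p q t : ℝ) (k : ℤ) (x : ℂ) : ℂ :=
  x ^ k / (1 - x) * Complex.exp (t * eps p q x)

/-- A zero would give p = a (1 - q b) with |1 - q b| ≤ 2, hence |a| ≥ p / 2; this is the origin of
the bound `p / 2` on the radii. -/
theorem den_ne {p q : ℝ} (hp : 0 < p) (hq : 0 ≤ q) (hpq : p + q = 1) {a b : ℂ}
    (ha : ‖a‖ < p / 2) (hb : ‖b‖ ≤ 1) : (p : ℂ) + q * a * b - a ≠ 0 := by
  intro h
  have h1 : (p : ℂ) = a * (1 - q * b) := by linear_combination h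
  have h2 : p = ‖a‖ * ‖1 - q * b‖ := by
    rw [← norm_mul, ← h1, Complex.norm_real, Real.norm_of_nonneg hp.le]
  have h3 : ‖(1 : ℂ) - q * b‖ ≤ 2 := by
    refine (norm_sub_le _ _).trans ?_
    rw [norm_one, norm_mul, Complex.norm_real, Real.norm_of_nonneg hq]
    nlinarith [norm_nonneg b]
  nlinarith [norm_nonneg a]

theorem one_sub_ne {x : ℂ} (hx : ‖x‖ < 1) : 1 - x ≠ 0 := by
  intro h
  rw [← sub_eq_zero.1 h, norm_one] at hx
  exact lt_irrefl _ hx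

section Differentiability

variable {p q t : ℝ} {E : Type*} [NormedAddCommGroup E] [NormedSpace ℂ E] {x : E}

theorem differentiableAt_prod {ι : Type*} {s : Finset ι} {f : ι → E → ℂ}
    (h : ∀ i ∈ s, DifferentiableAt ℂ (f i) x) :
    DifferentiableAt ℂ (fun x => ∏ i ∈ s, f i x) x := by
  classical
  induction s using Finset.induction_on with
  | empty => simp
  | insert i s hi ih =>
    simp only [Finset.prod_insert hi]
    have h1 := h i (Finset.mem_insert_self _ _)
    have h2 := ih fun k hk => h k (Finset.mem_insert_of_mem hk)
    fun_prop

theorem differentiableAt_eps {a : E → ℂ} (ha : DifferentiableAt ℂ a x) (h : a x ≠ 0) :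
    DifferentiableAt ℂ (fun x => eps p q (a x)) x := by
  unfold eps
  fun_prop (disch := assumption)

theorem differentiableAt_pairFactor {a b : E → ℂ} (ha : DifferentiableAt ℂ a x)
    (hb : DifferentiableAt ℂ b x) (h : (p : ℂ) + q * a x * b x - a x ≠ 0) :
    DifferentiableAt ℂ (fun x => pairFactor p q (a x) (b x)) x := by
  unfold pairFactor
  fun_prop (disch := assumption)

theorem differentiableAt_pairProd {n : ℕ} {ξ : E → Fin n → ℂ} (hξ : DifferentiableAt ℂ ξ x)
    (h : ∀ i k, i < k → (p : ℂ) + q * ξ x i * ξ x k - ξ x i ≠ 0) :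
    DifferentiableAt ℂ (fun x => pairProd p q (ξ x)) x := by
  rw [differentiableAt_pi] at hξ
  unfold pairProd
  refine differentiableAt_prod fun i _ => differentiableAt_prod fun k _ => ?_
  split_ifs with hik
  · exact differentiableAt_pairFactor (hξ i) (hξ k) (h i k hik)
  · exact differentiableAt_const _

theorem differentiableAt_extProd {n : ℕ} {ξ : E → Fin n → ℂ} {b : E → ℂ}
    (hξ : DifferentiableAt ℂ ξ x) (hb : DifferentiableAt ℂ b x)
    (h : ∀ i, (p : ℂ) + q * ξ x i * b x - ξ x i ≠ 0) :
    DifferentiableAt ℂ (fun x => extProd p q (ξ x) (b x)) x := by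
  rw [differentiableAt_pi] at hξ
  unfold extProd
  exact differentiableAt_prod fun i _ => differentiableAt_pairFactor (hξ i) hb (h i)

theorem differentiableAt_oneFactor {k : ℤ} {a : E → ℂ} (ha : DifferentiableAt ℂ a x)
    (h : a x ≠ 0) (h1 : 1 - a x ≠ 0) :
    DifferentiableAt ℂ (fun x => oneFactor p q t k (a x)) x := by
  unfold oneFactor
  have h2 : DifferentiableAt ℂ (fun x => 1 - a x) x := (differentiableAt_const _).sub ha
  have h3 : DifferentiableAt ℂ (fun x => Complex.exp (t * eps p q (a x))) x :=
    ((differentiableAt_eps ha h).const_mul (t : ℂ)).cexp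
  have h4 : DifferentiableAt ℂ (fun x => a x ^ k) x := ha.zpow (Or.inl h)
  simp only [div_eq_mul_inv]
  have h5 := h2.fun_inv h1
  fun_prop

theorem differentiableAt_prod_oneFactor {n : ℕ} {k : Fin n → ℤ} {ξ : E → Fin n → ℂ}
    (hξ : DifferentiableAt ℂ ξ x) (h : ∀ i, ξ x i ≠ 0) (h1 : ∀ i, 1 - ξ x i ≠ 0) :
    DifferentiableAt ℂ (fun x => ∏ i, oneFactor p q t (k i) (ξ x i)) x := by
  rw [differentiableAt_pi] at hξ
  exact differentiableAt_prod fun i _ =>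
    differentiableAt_oneFactor (a := fun x => ξ x i) (hξ i) (h i) (h1 i)

end Differentiability

/-- Since p + q = 1, each denominator is p (1 - ξᵢ). The power of `p` obtained here is the ratio
that the prefactors of consecutive terms have to match. -/
theorem extProd_one {p q : ℝ} (hp : 0 < p) (hpq : p + q = 1) {n : ℕ} {ξ : Fin n → ℂ}
    (h1 : ∀ i, 1 - ξ i ≠ 0) : extProd p q ξ 1 = ((p : ℂ) ^ n)⁻¹ := by
  have hq : (q : ℂ) = 1 - p := by rw [eq_sub_iff_add_eq']; exact_mod_cast hpq
  have hp0 : (p : ℂ) ≠ 0 := by exact_mod_cast hp.ne'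
  have : ∀ i, pairFactor p q (ξ i) 1 = (p : ℂ)⁻¹ := fun i => by
    have h : (p : ℂ) + q * ξ i * 1 - ξ i = p * (1 - ξ i) := by rw [hq]; ring
    rw [pairFactor, h]
    field_simp [h1 i]
  simp [extProd, this]

theorem extProd_insertNth (p q : ℝ) {n : ℕ} (i : Fin (n + 1)) (z : ℂ) (η : Fin n → ℂ) (x : ℂ) :
    extProd p q (i.insertNth (α := fun _ => ℂ) z η) x
      = pairFactor p q z x * extProd p q η x := by
  rw [extProd, Fin.prod_univ_succAbove _ i]
  simp [extProd]

theorem pairProd_insertNth (p q : ℝ) {n : ℕ} (i : Fin (n + 1)) (z : ℂ) (η : Fin n → ℂ) :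
    pairProd p q (i.insertNth (α := fun _ => ℂ) z η)
      = pairProd p q η * ∏ l, if i < i.succAbove l then pairFactor p q z (η l)
          else pairFactor p q (η l) z := by
  rw [pairProd, Fin.prod_univ_succAbove _ i, Fin.prod_univ_succAbove _ i]
  simp only [lt_self_iff_false, if_false, one_mul, Fin.insertNth_apply_same,
    Fin.insertNth_apply_succAbove]
  have : ∀ l, (∏ k, if i.succAbove l < k then
        pairFactor p q (η l) (i.insertNth (α := fun _ => ℂ) z η k) else 1)
      = (if i.succAbove l < i then pairFactor p q (η l) z else 1)
        * ∏ k, if l < k then pairFactor p q (η l) (η k) else 1 := fun l => by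
    rw [Fin.prod_univ_succAbove _ i]
    simp [Fin.succAbove_lt_succAbove_iff]
  simp only [this]
  rw [Finset.prod_mul_distrib, ← mul_assoc, ← Finset.prod_mul_distrib, mul_comm, pairProd]
  congr 1
  refine Finset.prod_congr rfl fun l _ => ?_
  rcases lt_or_gt_of_ne (Fin.succAbove_ne i l) with h | h
  · simp [h, h.not_gt]
  · simp [h, h.not_gt]

theorem pairProd_insertNth_last (p q : ℝ) {n : ℕ} (z : ℂ) (η : Fin n → ℂ) :
    pairProd p q ((Fin.last n).insertNth (α := fun _ => ℂ) z η)
      = pairProd p q η * extProd p q η z := by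
  rw [pairProd_insertNth, extProd]
  congr 1
  refine Finset.prod_congr rfl fun l _ => if_neg (not_lt.2 (Fin.le_last _))

theorem prod_erase_insertNth {n : ℕ} (i : Fin (n + 1)) (f : Fin (n + 1) → ℂ) :
    ∏ l ∈ Finset.univ.erase i, f l = ∏ l, f (i.succAbove l) := by
  rw [Fin.univ_succAbove n i, Finset.erase_cons, Finset.prod_map]
  rfl

/-- The product of the factors over pairs is antisymmetric in two neighbouring variables, up to
their own denominator. -/
theorem pairProd_swap (p q : ℝ) {n : ℕ} (ξ : Fin n → ℂ) (a b : Fin n)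
    (hab : (a : ℕ) + 1 = b) (h1 : (p : ℂ) + q * ξ a * ξ b - ξ a ≠ 0)
    (h2 : (p : ℂ) + q * ξ b * ξ a - ξ b ≠ 0) :
    (p + q * ξ b * ξ a - ξ b) * pairProd p q (fun i => ξ (Equiv.swap a b i))
      = -((p + q * ξ a * ξ b - ξ a) * pairProd p q ξ) := by
  classical
  have hne : a ≠ b := fun h => by rw [h] at hab; omega
  have hVs : ∀ σ : Equiv.Perm (Fin n), pairProd p q (fun i => ξ (σ i))
      = ∏ x ∈ Finset.univ.filter (fun x : Fin n × Fin n => σ.symm x.1 < σ.symm x.2),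
          pairFactor p q (ξ x.1) (ξ x.2) := fun σ => by
    rw [pairProd, ← Finset.univ_product_univ, Finset.prod_filter, Finset.prod_product]
    refine Fintype.prod_equiv σ _ _ fun i => Fintype.prod_equiv σ _ _ fun k => ?_
    simp
  -- As `a` and `b` are neighbours, the swap reverses the order of this single pair: both products
  -- run over `E` and one more pair, `(a, b)` or `(b, a)`.
  set E := Finset.univ.filter (fun x : Fin n × Fin n => x.1 < x.2 ∧ x ≠ (a, b)) with hE
  have hV : pairProd p q ξ
      = pairFactor p q (ξ a) (ξ b) * ∏ x ∈ E, pairFactor p q (ξ x.1) (ξ x.2) := by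
    have := hVs 1
    simp only [Equiv.Perm.coe_one, id] at this
    rw [this, ← Finset.prod_insert (a := (a, b))
      (f := fun x : Fin n × Fin n => pairFactor p q (ξ x.1) (ξ x.2)) (by simp [hE])]
    refine Finset.prod_congr ?_ fun _ _ => rfl
    ext ⟨i, k⟩
    have hab' : a < b := Fin.lt_def.2 (by omega)
    by_cases h : i = a ∧ k = b
    · obtain ⟨rfl, rfl⟩ := h
      simp only [Finset.mem_filter, Finset.mem_univ, true_and, Finset.mem_insert, true_or, iff_true]
      exact hab'
    · simp only [hE, Finset.mem_filter, Finset.mem_univ, true_and, Finset.mem_insert, ne_eq,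
        Prod.mk.injEq, h, false_or, not_false_eq_true, and_true]
      exact Iff.rfl
  have hW : pairProd p q (fun i => ξ (Equiv.swap a b i))
      = pairFactor p q (ξ b) (ξ a) * ∏ x ∈ E, pairFactor p q (ξ x.1) (ξ x.2) := by
    rw [hVs, ← Finset.prod_insert (a := (b, a))
      (f := fun x : Fin n × Fin n => pairFactor p q (ξ x.1) (ξ x.2)) (by
        have hab' : a < b := Fin.lt_def.2 (by omega)
        simp [hE, hab'.not_gt])]
    refine Finset.prod_congr ?_ fun _ _ => rfl
    ext ⟨i, k⟩
    have hiff : (Equiv.swap a b).symm i < (Equiv.swap a b).symm k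
        ↔ (i = b ∧ k = a) ∨ (i < k ∧ ¬(i = a ∧ k = b)) := by
      simp only [Equiv.symm_swap, Equiv.swap_apply_def, Fin.lt_def, Fin.ext_iff]
      split_ifs <;> omega
    simp only [hE, Finset.mem_filter, Finset.mem_univ, true_and, Finset.mem_insert, ne_eq,
      Prod.mk.injEq]
    exact hiff
  have e1 : (p + q * ξ b * ξ a - ξ b) * pairFactor p q (ξ b) (ξ a) = ξ a - ξ b :=
    mul_div_cancel₀ _ h2
  have e2 : (p + q * ξ a * ξ b - ξ a) * pairFactor p q (ξ a) (ξ b) = ξ b - ξ a :=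
    mul_div_cancel₀ _ h1
  rw [hV, hW, ← mul_assoc, ← mul_assoc, e1, e2]
  ring

/-! ### The residues of the kernel in its last variable -/

/-- The factors of `kernel` that do not involve the last variable. -/
def kernelBase (p q t : ℝ) {n : ℕ} (e : Fin n → ℤ) (m : ℤ) (ζ : ℂ) (ξ : Fin n → ℂ) : ℂ :=
  pairProd p q ξ * (∏ i, oneFactor p q t (m + e i + 1) (ξ i)) * extProd p q ξ ζ

/-- The integrand whose contour in `w` is moved to infinity. -/
def kernel (p q t : ℝ) {n : ℕ} (e : Fin n → ℤ) (m : ℤ) (ζ : ℂ) (ξ : Fin n → ℂ) (w : ℂ) : ℂ :=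
  kernelBase p q t e m ζ ξ *
    (extProd p q ξ w * ((w - ζ) * oneFactor p q t m w) / (1 - (∏ i, ξ i) * ζ * w))

/-- The zero `x` of `p + q z x - z`. -/
def pairPole (p q : ℝ) (z : ℂ) : ℂ := (z - p) / (q * z)

/-- The residue of `kernel` at `pairPole p q (ξ i)`. -/
def resPair (p q t : ℝ) {n : ℕ} (e : Fin n → ℤ) (m : ℤ) (ζ : ℂ) (i : Fin n) (ξ : Fin n → ℂ) : ℂ :=
  kernelBase p q t e m ζ ξ *
    ((∏ l ∈ Finset.univ.erase i, pairFactor p q (ξ l) (pairPole p q (ξ i)))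
      * ((pairPole p q (ξ i) - ξ i) / (q * ξ i))
      * ((pairPole p q (ξ i) - ζ) * oneFactor p q t m (pairPole p q (ξ i)))
      / (1 - (∏ i, ξ i) * ζ * pairPole p q (ξ i))) / pairPole p q (ξ i)

/-- The residue of `kernel` at `1`. -/
def resOne (p q t : ℝ) {n : ℕ} (e : Fin n → ℤ) (m : ℤ) (ζ : ℂ) (ξ : Fin n → ℂ) : ℂ :=
  -(kernelBase p q t e m ζ ξ * (extProd p q ξ 1 * (1 - ζ) / (1 - (∏ i, ξ i) * ζ)))

/-- The residue of `kernel` at the inverse of the product of the other variables. -/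
def resProd (p q t : ℝ) {n : ℕ} (e : Fin n → ℤ) (m : ℤ) (ζ : ℂ) (ξ : Fin n → ℂ) : ℂ :=
  -(kernelBase p q t e m ζ ξ * (extProd p q ξ ((∏ i, ξ i) * ζ)⁻¹
    * ((((∏ i, ξ i) * ζ)⁻¹ - ζ) * oneFactor p q t m ((∏ i, ξ i) * ζ)⁻¹)))

/-- The radii of the contours are small enough for the residue calculus. -/
structure Admissible (p q : ℝ) {n : ℕ} (δ : Fin n → ℝ) (ζ : ℂ) : Prop where
  pos : ∀ i, 0 < δ i
  lt : ∀ i, δ i < p / 2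
  inj : Function.Injective δ
  ne_zero : ζ ≠ 0
  norm_le : ‖ζ‖ ≤ 1
  den : q ≠ 0 → ∀ ξ : Fin n → ℂ, (∀ i, ‖ξ i‖ ≤ δ i) → ∀ i,
    (q : ℂ) - (∏ l ∈ Finset.univ.erase i, ξ l) * ζ * (ξ i - p) ≠ 0
  prod_le : (∏ i, δ i) * ‖ζ‖ ≤ 1

/-! ### Location of the poles and the residue formula on an admissible torus. -/

section

variable {p q t : ℝ} {n : ℕ} {δ : Fin n → ℝ} {ζ : ℂ}

theorem den_eq_mul_sub_pairPole (hq : q ≠ 0) {z : ℂ} (hz : z ≠ 0) (w : ℂ) :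
    (p : ℂ) + q * z * w - z = q * z * (w - pairPole p q z) := by
  have hq' : (q : ℂ) ≠ 0 := by exact_mod_cast hq
  rw [pairPole]
  field_simp
  ring

theorem Admissible.ne_zero_of_mem (h : Admissible p q δ ζ) {ξ : Fin n → ℂ}
    (hξ : ξ ∈ torSet δ) (i : Fin n) : ξ i ≠ 0 :=
  norm_pos_iff.1 (mem_torSet.1 hξ i ▸ h.pos i)

theorem Admissible.norm_lt (h : Admissible p q δ ζ) (hp1 : p ≤ 1) {ξ : Fin n → ℂ}
    (hξ : ξ ∈ torSet δ) (i : Fin n) : ‖ξ i‖ < 1 := by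
  rw [mem_torSet.1 hξ i]; linarith [h.lt i]

theorem Admissible.prod_ne_zero (h : Admissible p q δ ζ) {ξ : Fin n → ℂ}
    (hξ : ξ ∈ torSet δ) : (∏ i, ξ i) * ζ ≠ 0 :=
  mul_ne_zero (Finset.prod_ne_zero_iff.2 fun i _ => h.ne_zero_of_mem hξ i) h.ne_zero

theorem norm_prod_of_mem {ξ : Fin n → ℂ} (hξ : ξ ∈ torSet δ) : ‖∏ i, ξ i‖ = ∏ i, δ i := by
  rw [norm_prod]
  exact Finset.prod_congr rfl fun i _ => mem_torSet.1 hξ i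

theorem norm_prod_mul_lt (hlt : (∏ i, δ i) * ‖ζ‖ < 1) {ξ : Fin n → ℂ}
    (hξ : ξ ∈ torSet δ) : ‖(∏ i, ξ i) * ζ‖ < 1 := by
  rw [norm_mul, norm_prod_of_mem hξ]
  exact hlt

theorem Admissible.den_ne (h : Admissible p q δ ζ) (hp : 0 < p) (hq : 0 ≤ q) (hpq : p + q = 1)
    {ξ : Fin n → ℂ} (hξ : ξ ∈ torSet δ) (i : Fin n) {b : ℂ} (hb : ‖b‖ ≤ 1) :
    (p : ℂ) + q * ξ i * b - ξ i ≠ 0 :=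
  ASEP.den_ne hp hq hpq (mem_torSet.1 hξ i ▸ h.lt i) hb

/-- The lower bound comes from δᵢ < p / 2, which gives p - δᵢ > δᵢ ≥ q δᵢ. It places these poles
strictly outside the unit circle. -/
theorem Admissible.norm_pairPole (h : Admissible p q δ ζ) (hq : 0 ≤ q) (hpq : p + q = 1)
    (hq0 : q ≠ 0) {ξ : Fin n → ℂ} (hξ : ξ ∈ torSet δ) (i : Fin n) :
    1 < ‖pairPole p q (ξ i)‖ ∧ ‖pairPole p q (ξ i)‖ ≤ (δ i + p) / (q * δ i) := by
  have h0 := h.pos i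
  have h1 := h.lt i
  have hq' := lt_of_le_of_ne hq hq0.symm
  have hp : 0 < p := by linarith
  have hn : ‖(p : ℂ)‖ = p := by rw [Complex.norm_real, Real.norm_of_nonneg hp.le]
  rw [pairPole, norm_div, norm_mul, Complex.norm_real, Real.norm_of_nonneg hq, mem_torSet.1 hξ i]
  have hu : ‖ξ i - p‖ ≤ δ i + p := by
    refine (norm_sub_le _ _).trans_eq ?_
    rw [mem_torSet.1 hξ i, hn]
  have hl : p - δ i ≤ ‖ξ i - p‖ := by
    have := norm_sub_norm_le (p : ℂ) (ξ i)
    rwa [norm_sub_rev, hn, mem_torSet.1 hξ i] at this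
  refine ⟨?_, by gcongr⟩
  rw [lt_div_iff₀ (by positivity)]
  nlinarith

/-- The factor ξᵢ cancels against the denominator of `pairPole`; after multiplication by `q` this is
`Admissible.den`, a condition that still makes sense at ξᵢ = 0. -/
theorem Admissible.one_sub_pairPole (h : Admissible p q δ ζ) (hq0 : q ≠ 0) {ξ : Fin n → ℂ} (hξ : ξ ∈ torSet δ) (i : Fin n) :
    1 - (∏ i, ξ i) * ζ * pairPole p q (ξ i) ≠ 0 := by
  have h1 := h.den hq0 ξ (fun i => (mem_torSet.1 hξ i).le) i
  have hz := h.ne_zero_of_mem hξ i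
  have hq' : (q : ℂ) ≠ 0 := by exact_mod_cast hq0
  intro h2
  apply h1
  rw [← Finset.mul_prod_erase _ _ (Finset.mem_univ i), pairPole] at h2
  field_simp at h2
  linear_combination h2

/-- `pairPole` is an injective Möbius map of its argument, and the coordinates have distinct moduli.
-/
theorem Admissible.pairPole_injective (h : Admissible p q δ ζ) (hp : 0 < p) (hq0 : q ≠ 0)
    {ξ : Fin n → ℂ} (hξ : ξ ∈ torSet δ) {i l : Fin n}
    (hil : pairPole p q (ξ i) = pairPole p q (ξ l)) : i = l := by
  apply h.inj
  rw [← mem_torSet.1 hξ i, ← mem_torSet.1 hξ l]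
  have hi := h.ne_zero_of_mem hξ i
  have hl := h.ne_zero_of_mem hξ l
  have hq' : (q : ℂ) ≠ 0 := by exact_mod_cast hq0
  have hp' : (p : ℂ) ≠ 0 := by exact_mod_cast hp.ne'
  rw [pairPole, pairPole] at hil
  field_simp at hil
  have h1 : (p : ℂ) * (ξ i - ξ l) = 0 := by linear_combination hil
  rw [sub_eq_zero.1 ((mul_eq_zero.1 h1).resolve_left hp')]

theorem Admissible.extProd_den_ne (h : Admissible p q δ ζ) (hp : 0 < p)
    {ξ : Fin n → ℂ} (hξ : ξ ∈ torSet δ) {w : ℂ} (hw : q ≠ 0 → ∀ i, w ≠ pairPole p q (ξ i))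
    (i : Fin n) : (p : ℂ) + q * ξ i * w - ξ i ≠ 0 := by
  by_cases hq0 : q = 0
  · intro h1
    have h2 : ξ i = p := by
      rw [hq0] at h1
      push_cast at h1
      linear_combination -h1
    have h3 := mem_torSet.1 hξ i
    rw [h2, Complex.norm_real, Real.norm_of_nonneg hp.le] at h3
    linarith [h.lt i]
  · rw [den_eq_mul_sub_pairPole hq0 (h.ne_zero_of_mem hξ i)]
    have hq' : (q : ℂ) ≠ 0 := by exact_mod_cast hq0
    exact mul_ne_zero (mul_ne_zero hq' (h.ne_zero_of_mem hξ i)) (sub_ne_zero.2 (hw hq0 i))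

theorem tendsto_of_eq_mul {f k : ℂ → ℂ} {b c : ℂ} (hk : ContinuousAt k b) (hc : k b = c)
    (h : ∀ w, w ≠ b → (w - b) * f w = k w) :
    Tendsto (fun w => (w - b) * f w) (𝓝[≠] b) (𝓝 c) := by
  rw [← hc]
  refine (hk.tendsto.mono_left nhdsWithin_le_nhds).congr' ?_
  filter_upwards [self_mem_nhdsWithin] with w hw using (h w hw).symm

/-- The poles between the two circles are simple and distinct: those of the pair factors and (∏ ξᵢ
ζ)⁻¹ have modulus larger than 1 and differ by `Admissible.one_sub_pairPole`, and the last one is 1.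
The singularity at 0 stays inside the small circle. -/
theorem Admissible.integral_kernel_sub (h : Admissible p q δ ζ) (hp : 0 < p) (hq : 0 ≤ q)
    (hpq : p + q = 1) (hlt : (∏ i, δ i) * ‖ζ‖ < 1) (e : Fin n → ℤ) (m : ℤ) {ξ : Fin n → ℂ}
    (hξ : ξ ∈ torSet δ) {r R : ℝ} (hr : 0 < r) (hr1 : r < 1) (hR1 : 1 < R) (hRP : ((∏ i, δ i) * ‖ζ‖)⁻¹ < R)
    (hRA : ∀ i, (δ i + p) / (q * δ i) < R) :
    (∫ w, kernel p q t e m ζ ξ w ∂circ R) - ∫ w, kernel p q t e m ζ ξ w ∂circ r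
      = (∑ i ∈ if q = 0 then ∅ else Finset.univ, resPair p q t e m ζ i ξ)
        + (resOne p q t e m ζ ξ + resProd p q t e m ζ ξ) := by
  have hp1 : p ≤ 1 := by linarith
  set P := (∏ i, ξ i) * ζ with hP
  have hP0 : P ≠ 0 := h.prod_ne_zero hξ
  have hPn : ‖P‖ < 1 := norm_prod_mul_lt hlt hξ
  have hPn' : ‖P‖ = (∏ i, δ i) * ‖ζ‖ := by rw [hP, norm_mul, norm_prod_of_mem hξ]
  have hw01 : 1 < ‖P⁻¹‖ := by
    rw [norm_inv]; exact (one_lt_inv₀ (norm_pos_iff.2 hP0)).2 hPn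
  have hPA : q ≠ 0 → ∀ i, P⁻¹ ≠ pairPole p q (ξ i) := fun hq0 i h1 => by
    apply h.one_sub_pairPole hq0 hξ i
    rw [← h1, mul_inv_cancel₀ hP0, sub_self]
  have hA1 : q ≠ 0 → ∀ i, (1 : ℂ) ≠ pairPole p q (ξ i) := fun hq0 i h1 => by
    have := (h.norm_pairPole hq hpq hq0 hξ i).1
    rw [← h1, norm_one] at this
    exact lt_irrefl _ this
  have hP1 : P⁻¹ ≠ 1 := fun h1 => by
    rw [h1, norm_one] at hw01; exact lt_irrefl _ hw01
  have hExt : ∀ w, (q ≠ 0 → ∀ i, w ≠ pairPole p q (ξ i)) →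
      DifferentiableAt ℂ (fun w => extProd p q ξ w) w := fun w hw =>
    differentiableAt_extProd (differentiableAt_const _) differentiableAt_id
      (h.extProd_den_ne hp hξ hw)
  have hden : ∀ w, w ≠ P⁻¹ → 1 - P * w ≠ 0 := fun w hw h1 => by
    apply hw
    refine mul_left_cancel₀ hP0 ?_
    rw [mul_inv_cancel₀ hP0]
    linear_combination -h1
  -- For `q = 0` the pair factors have no pole in `w`, and `pairPole` is a division by zero.
  let s : Finset (Fin n ⊕ Bool) := (if q = 0 then ∅ else Finset.univ : Finset (Fin n)).disjSum
    Finset.univ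
  let b : Fin n ⊕ Bool → ℂ :=
    Sum.elim (fun i => pairPole p q (ξ i)) (fun x => if x then 1 else P⁻¹)
  let c : Fin n ⊕ Bool → ℂ := Sum.elim (fun i => resPair p q t e m ζ i ξ)
    (fun x => if x then resOne p q t e m ζ ξ else resProd p q t e m ζ ξ)
  have hs : ∀ i, Sum.inl i ∈ s → q ≠ 0 := fun i hi h0 => by
    simp [s, h0] at hi
  have hb : InjOn b s := by
    rintro (i | x) hi (l | y) hl hil
    · rw [h.pairPole_injective hp (hs i hi) hξ hil]
    · exfalso
      cases y
      · exact hPA (hs i hi) i hil.symm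
      · exact hA1 (hs i hi) i hil.symm
    · exfalso
      cases x
      · exact hPA (hs l hl) l hil
      · exact hA1 (hs l hl) l hil
    · cases x <;> cases y <;> simp_all [b]
  have key := integral_circ_sub hr (hr1.trans hR1).le s b hb c (kernel p q t e m ζ ξ) ?_ ?_ ?_
  · rw [key, Finset.sum_disjSum]
    simp [c]
  · intro w h1 h2 h3
    have hw0 : w ≠ 0 := norm_pos_iff.1 (hr.trans_le h1)
    have hwA : q ≠ 0 → ∀ i, w ≠ pairPole p q (ξ i) := fun hq0 i =>
      h3 (Sum.inl i) (by simp [s, hq0])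
    have hw1 : 1 - w ≠ 0 := sub_ne_zero.2 (h3 (Sum.inr true) (by simp [s])).symm
    have hwP : 1 - P * w ≠ 0 := hden w (h3 (Sum.inr false) (by simp [s]))
    unfold kernel
    have d1 := hExt w hwA
    have d2 : DifferentiableAt ℂ (fun w => oneFactor p q t m w) w :=
      differentiableAt_oneFactor differentiableAt_id hw0 hw1
    fun_prop (disch := assumption)
  · rintro (i | x) hi
    · have := h.norm_pairPole hq hpq (hs i hi) hξ i
      exact ⟨hr1.trans this.1, this.2.trans_lt (hRA i)⟩
    · cases x
      · refine ⟨hr1.trans hw01, ?_⟩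
        simp only [b, Sum.elim_inr, Bool.false_eq_true, if_false]
        rw [norm_inv, hPn']
        exact hRP
      · simpa [b] using ⟨hr1, hR1⟩
  · rintro (i | x) hi
    · have hq0 := hs i hi
      have hq' : (q : ℂ) ≠ 0 := by exact_mod_cast hq0
      have hz := h.ne_zero_of_mem hξ i
      set A := pairPole p q (ξ i) with hA
      have hA0 : A ≠ 0 := norm_pos_iff.1 (one_pos.trans (h.norm_pairPole hq hpq hq0 hξ i).1)
      refine tendsto_of_eq_mul (k := fun w => kernelBase p q t e m ζ ξ *
        ((∏ l ∈ Finset.univ.erase i, pairFactor p q (ξ l) w)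
          * ((w - ξ i) / (q * ξ i)) * ((w - ζ) * oneFactor p q t m w) / (1 - P * w))) ?_ ?_ ?_
      · have d1 : DifferentiableAt ℂ (fun w => ∏ l ∈ Finset.univ.erase i,
            pairFactor p q (ξ l) w) A :=
          differentiableAt_prod fun l hl => differentiableAt_pairFactor (differentiableAt_const _)
            differentiableAt_id (by
              rw [den_eq_mul_sub_pairPole hq0 (h.ne_zero_of_mem hξ l)]
              refine mul_ne_zero (mul_ne_zero hq' (h.ne_zero_of_mem hξ l)) (sub_ne_zero.2 fun h1 => ?_)
              exact (Finset.mem_erase.1 hl).1 (h.pairPole_injective hp hq0 hξ h1).symm)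
        have d2 : DifferentiableAt ℂ (fun w => oneFactor p q t m w) A :=
          differentiableAt_oneFactor differentiableAt_id hA0 (sub_ne_zero.2 (hA1 hq0 i))
        have d3 := hden A (hPA hq0 i).symm
        have d4 : (q : ℂ) * ξ i ≠ 0 := mul_ne_zero hq' hz
        refine DifferentiableAt.continuousAt (𝕜 := ℂ) ?_
        fun_prop (disch := assumption)
      · simp only [b, c, Sum.elim_inl, resPair, ← hA]
        rw [mul_div_cancel₀ _ hA0]
      · intro w hw
        have hw' : w - A ≠ 0 := sub_ne_zero.2 hw
        simp only [b, Sum.elim_inl, kernel, extProd, ← hA, ← hP]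
        rw [← Finset.mul_prod_erase _ _ (Finset.mem_univ i), pairFactor,
          den_eq_mul_sub_pairPole hq0 hz, ← hA]
        field_simp
    · cases x
      · simp only [b, c, Sum.elim_inr, Bool.false_eq_true, if_false]
        have hPi0 : P⁻¹ ≠ 0 := inv_ne_zero hP0
        refine tendsto_of_eq_mul (k := fun w => kernelBase p q t e m ζ ξ *
          (extProd p q ξ w * ((w - ζ) * oneFactor p q t m w)) * (-P⁻¹)) ?_ ?_ ?_
        · have d1 := hExt P⁻¹ hPA
          have d2 : DifferentiableAt ℂ (fun w => oneFactor p q t m w) P⁻¹ :=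
            differentiableAt_oneFactor differentiableAt_id hPi0 (sub_ne_zero.2 hP1.symm)
          refine DifferentiableAt.continuousAt (𝕜 := ℂ) ?_
          fun_prop
        · simp only [resProd, ← hP]
          ring
        · intro w hw
          have h1 : 1 - P * w ≠ 0 := hden w hw
          have h2 : (w - P⁻¹) / (1 - P * w) = -P⁻¹ := by
            rw [div_eq_iff h1]
            field_simp
            ring
          rw [← h2]
          simp only [kernel, ← hP]
          ring
      · simp only [b, c, Sum.elim_inr, if_true]
        refine tendsto_of_eq_mul (k := fun w => -(kernelBase p q t e m ζ ξ *
          (extProd p q ξ w * ((w - ζ) * (w ^ m * Complex.exp (t * eps p q w))) / (1 - P * w))))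
          ?_ ?_ ?_
        · have d1 := hExt 1 hA1
          have d2 : DifferentiableAt ℂ (fun w : ℂ => w ^ m) 1 :=
            differentiableAt_id.zpow (Or.inl one_ne_zero)
          have d3 : DifferentiableAt ℂ (fun w => eps p q w) 1 :=
            differentiableAt_eps differentiableAt_id one_ne_zero
          have d4 := hden 1 hP1.symm
          refine DifferentiableAt.continuousAt (𝕜 := ℂ) ?_
          fun_prop (disch := assumption)
        · have he : eps p q 1 = 0 := by
            simp only [eps, inv_one, mul_one]
            rw [sub_eq_zero]; exact_mod_cast hpq
          simp [resOne, he, ← hP]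
        · intro w hw
          have h1 : 1 - w ≠ 0 := sub_ne_zero.2 hw.symm
          simp only [kernel, ← hP, oneFactor]
          have h2 : (w - 1) / (1 - w) = -1 := by rw [div_eq_iff h1]; ring
          calc _ = kernelBase p q t e m ζ ξ * (extProd p q ξ w * ((w - ζ) * (w ^ m *
                Complex.exp (t * eps p q w))) / (1 - P * w)) * ((w - 1) / (1 - w)) := by ring
            _ = _ := by rw [h2]; ring

end

/-! ### The residues at the poles of the pair factors integrate to zero -/

/-- The numerator of the second factor is a multiple of the denominator of the first, and
conversely, so the product has no singularity left in `z`. -/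
theorem pairFactor_mul_pairFactor_pairPole {p q : ℝ} (hp : p ≠ 0) (hq : q ≠ 0) {z η : ℂ}
    (hz : z ≠ 0) (hne : z ≠ η) (h1 : (p : ℂ) + q * z * η - z ≠ 0) :
    pairFactor p q z η * pairFactor p q η (pairPole p q z) = (p * q : ℂ)⁻¹ := by
  have hp' : (p : ℂ) ≠ 0 := by exact_mod_cast hp
  have hq' : (q : ℂ) ≠ 0 := by exact_mod_cast hq
  have h2 : (p : ℂ) + q * η * pairPole p q z - η = p * (z - η) / z := by
    rw [pairPole]; field_simp; ring
  have h3 : pairPole p q z - η = -(p + q * z * η - z) / (q * z) := by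
    rw [pairPole]; field_simp; ring
  have h4 : z - η ≠ 0 := sub_ne_zero.2 hne
  rw [pairFactor, pairFactor, h2, h3, ← neg_sub z η]
  generalize (p : ℂ) + q * z * η - z = D at h1 ⊢
  field_simp

/-- In this order only z - η cancels; the surviving denominator is harmless by `den_ne`. -/
theorem pairFactor_mul_pairFactor_pairPole' {p q : ℝ} (hp : p ≠ 0) (hq : q ≠ 0) {z η : ℂ}
    (hz : z ≠ 0) (hne : z ≠ η) :
    pairFactor p q η z * pairFactor p q η (pairPole p q z)
      = (z - p - q * z * η) / (p * q * (p + q * η * z - η)) := by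
  have hp' : (p : ℂ) ≠ 0 := by exact_mod_cast hp
  have hq' : (q : ℂ) ≠ 0 := by exact_mod_cast hq
  have h2 : (p : ℂ) + q * η * pairPole p q z - η = p * (z - η) / z := by
    rw [pairPole]; field_simp; ring
  have h3 : pairPole p q z - η = (z - p - q * z * η) / (q * z) := by
    rw [pairPole]; field_simp
  have h4 : z - η ≠ 0 := sub_ne_zero.2 hne
  rw [pairFactor, pairFactor, h2, h3]
  field_simp

/-- In ε(z) + ε(`pairPole p q z`) the terms p / z and -p / z cancel, so the essential singularity at
z = 0 disappears. The powers z^m cancel likewise, leaving z · z^(e - 1). -/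
theorem oneFactor_mul_oneFactor_pairPole {p q t : ℝ} (hp : p ≠ 0) (hq : q ≠ 0) (hpq : p + q = 1)
    {z ζ P : ℂ} (hz : z ≠ 0) (h1 : 1 - z ≠ 0) (hzp : z - p ≠ 0) (e m : ℤ) :
    oneFactor p q t (m + e + 1) z * (((pairPole p q z - z) / (q * z))
        * ((pairPole p q z - ζ) * oneFactor p q t m (pairPole p q z))
        / (1 - z * P * ζ * pairPole p q z) / pairPole p q z)
      = z * (1 / (1 - z) * Complex.exp (t * (q * z + p * q * z / (z - p) - 1))
        * ((z - p - q * z * ζ) / (p * (1 - z))) * ((z - p - q * z ^ 2) / q ^ 2)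
        * ((z - p) / q) ^ (m - 1) * z ^ (e - 1) / (1 - P * ζ * ((z - p) / q))) := by
  have hp' : (p : ℂ) ≠ 0 := by exact_mod_cast hp
  have hq' : (q : ℂ) ≠ 0 := by exact_mod_cast hq
  have hpq' : (p : ℂ) = 1 - q := by rw [eq_sub_iff_add_eq]; exact_mod_cast hpq
  have hA0 : pairPole p q z ≠ 0 := div_ne_zero hzp (mul_ne_zero hq' hz)
  have hexp : Complex.exp (t * (q * z + p * q * z / (z - p) - 1))
      = Complex.exp (t * eps p q z) * Complex.exp (t * eps p q (pairPole p q z)) := by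
    rw [← Complex.exp_add, ← mul_add]
    congr 2
    rw [eps, eps, pairPole]
    field_simp
    ring
  have e1 : (pairPole p q z - ζ) / (1 - pairPole p q z)
      = (z - p - q * z * ζ) / (p * (1 - z)) := by
    have h2 : 1 - pairPole p q z = p * (1 - z) / (q * z) := by
      rw [pairPole, hpq']; field_simp; ring
    have h3 : pairPole p q z - ζ = (z - p - q * z * ζ) / (q * z) := by
      rw [pairPole]; field_simp
    rw [h2, h3]
    field_simp
  have e2 : (pairPole p q z - z) / (q * z) = (z - p - q * z ^ 2) / q ^ 2 / z ^ 2 := by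
    rw [pairPole]; field_simp
  have e3 : pairPole p q z ^ m / pairPole p q z = ((z - p) / q) ^ (m - 1) / z ^ (m - 1) := by
    rw [div_eq_mul_inv, ← zpow_sub_one₀ hA0, ← div_zpow, pairPole, div_div]
  have e4 : z * P * ζ * pairPole p q z = P * ζ * ((z - p) / q) := by
    rw [pairPole]; field_simp
  have e5 : z ^ (m + e + 1) = z * z ^ (e - 1) * z ^ 2 * z ^ (m - 1) := by
    rw [← zpow_one_add₀ hz, ← zpow_natCast z 2, ← zpow_add₀ hz, ← zpow_add₀ hz]
    congr 1
    push_cast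
    ring
  have hzm : z ^ (m - 1) ≠ 0 := zpow_ne_zero _ hz
  calc _ = z ^ (m + e + 1) / (1 - z) * (Complex.exp (t * eps p q z)
          * Complex.exp (t * eps p q (pairPole p q z))) * ((pairPole p q z - z) / (q * z))
        * ((pairPole p q z - ζ) / (1 - pairPole p q z)) * (pairPole p q z ^ m / pairPole p q z)
        / (1 - z * P * ζ * pairPole p q z) := by
        rw [oneFactor, oneFactor]; ring
    _ = z * z ^ (e - 1) * (z ^ 2 * (z ^ 2)⁻¹) * (z ^ (m - 1) * (z ^ (m - 1))⁻¹) / (1 - z)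
          * Complex.exp (t * (q * z + p * q * z / (z - p) - 1))
        * ((z - p - q * z ^ 2) / q ^ 2) * ((z - p - q * z * ζ) / (p * (1 - z)))
        * ((z - p) / q) ^ (m - 1) / (1 - P * ζ * ((z - p) / q)) := by
        rw [e1, e2, e3, e4, e5, hexp]; ring
    _ = _ := by
        rw [mul_inv_cancel₀ hzm, mul_inv_cancel₀ (pow_ne_zero 2 hz)]; ring

section

variable {p q t : ℝ} {n : ℕ} {δ : Fin n → ℝ} {ζ : ℂ}

theorem differentiableAt_kernelBase {E : Type*} [NormedAddCommGroup E] [NormedSpace ℂ E] {x : E}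
    (hp : 0 < p) (hq : 0 ≤ q) (hpq : p + q = 1) {e : Fin n → ℤ} {m : ℤ}
    {ξ : E → Fin n → ℂ} {ζ : E → ℂ} (hξ : DifferentiableAt ℂ ξ x) (hζ : DifferentiableAt ℂ ζ x)
    (h0 : ∀ i, ξ x i ≠ 0) (h1 : ∀ i, ‖ξ x i‖ < p / 2) (h2 : ‖ζ x‖ ≤ 1) :
    DifferentiableAt ℂ (fun x => kernelBase p q t e m (ζ x) (ξ x)) x := by
  have h3 : ∀ i, ‖ξ x i‖ < 1 := fun i => by linarith [h1 i]
  unfold kernelBase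
  have d1 := differentiableAt_pairProd (p := p) (q := q) hξ
    fun i k _ => den_ne hp hq hpq (h1 i) (h3 k).le
  have d2 := differentiableAt_prod_oneFactor (p := p) (q := q) (t := t)
    (k := fun i => m + e i + 1) hξ h0 fun i => one_sub_ne (h3 i)
  have d3 := differentiableAt_extProd (p := p) (q := q) hξ hζ
    fun i => den_ne hp hq hpq (h1 i) h2
  fun_prop

theorem Admissible.differentiableAt_kernelBase (h : Admissible p q δ ζ) (hp : 0 < p) (hq : 0 ≤ q)
    (hpq : p + q = 1) {e : Fin n → ℤ} {m : ℤ} {ξ : Fin n → ℂ} (hξ : ξ ∈ torSet δ) :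
    DifferentiableAt ℂ (fun ξ => kernelBase p q t e m ζ ξ) ξ :=
  ASEP.differentiableAt_kernelBase (ζ := fun _ => ζ) hp hq hpq differentiableAt_id
    (differentiableAt_const _) (h.ne_zero_of_mem hξ)
    (fun i => mem_torSet.1 hξ i ▸ h.lt i) h.norm_le

theorem differentiableAt_coord (i : Fin n) (ξ : Fin n → ℂ) :
    DifferentiableAt ℂ (fun ξ : Fin n → ℂ => ξ i) ξ := by fun_prop

theorem Admissible.continuousOn_resPair (h : Admissible p q δ ζ) (hp : 0 < p) (hq : 0 ≤ q)
    (hpq : p + q = 1) (hq0 : q ≠ 0) (e : Fin n → ℤ) (m : ℤ) (i : Fin n) :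
    ContinuousOn (resPair p q t e m ζ i) (torSet δ) := by
  intro ξ hξ
  refine (DifferentiableAt.continuousAt (𝕜 := ℂ) ?_).continuousWithinAt
  have hq' : (q : ℂ) ≠ 0 := by exact_mod_cast hq0
  have hz := h.ne_zero_of_mem hξ
  have hA1 := (h.norm_pairPole hq hpq hq0 hξ i).1
  have hA0 : pairPole p q (ξ i) ≠ 0 := norm_pos_iff.1 (one_pos.trans hA1)
  have dA : DifferentiableAt ℂ (fun ξ : Fin n → ℂ => pairPole p q (ξ i)) ξ := by
    have d1 := differentiableAt_coord i ξ
    have d2 : (q : ℂ) * ξ i ≠ 0 := mul_ne_zero hq' (hz i)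
    unfold pairPole
    fun_prop (disch := assumption)
  have d1 := h.differentiableAt_kernelBase (t := t) hp hq hpq (e := e) (m := m) hξ
  have d2 : DifferentiableAt ℂ (fun ξ : Fin n → ℂ => ∏ l ∈ Finset.univ.erase i,
      pairFactor p q (ξ l) (pairPole p q (ξ i))) ξ :=
    differentiableAt_prod fun l hl => differentiableAt_pairFactor (differentiableAt_coord l ξ) dA (by
      rw [den_eq_mul_sub_pairPole hq0 (hz l)]
      refine mul_ne_zero (mul_ne_zero hq' (hz l)) (sub_ne_zero.2 fun h1 => ?_)
      exact (Finset.mem_erase.1 hl).1 (h.pairPole_injective hp hq0 hξ h1).symm)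
  have d3 : DifferentiableAt ℂ (fun ξ : Fin n → ℂ =>
      oneFactor p q t m (pairPole p q (ξ i))) ξ :=
    differentiableAt_oneFactor dA hA0 (sub_ne_zero.2 fun h1 => by
      rw [← h1, norm_one] at hA1; exact lt_irrefl _ hA1)
  have d4 := h.one_sub_pairPole hq0 hξ i
  have d5 : (q : ℂ) * ξ i ≠ 0 := mul_ne_zero hq' (hz i)
  have d6 : DifferentiableAt ℂ (fun ξ : Fin n → ℂ => ∏ i, ξ i) ξ :=
    differentiableAt_prod fun l _ => differentiableAt_coord l ξ
  have d7 := differentiableAt_coord i ξ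
  unfold resPair
  fun_prop (disch := assumption)

/-- With the other variables fixed, the integrand is ξᵢ times a function holomorphic on the disc
|ξᵢ| ≤ δᵢ, so the integral over ξᵢ already vanishes. The condition `1 ≤ e i`, which will express the
strict order of the particles, makes ξᵢ^(eᵢ - 1) regular at 0. -/
theorem Admissible.integral_resPair (h : Admissible p q δ ζ) (hp : 0 < p) (hq : 0 ≤ q)
    (hpq : p + q = 1) (hq0 : q ≠ 0) (e : Fin n → ℤ) (he : ∀ i, 1 ≤ e i) (m : ℤ) (i : Fin n) :
    ∫ ξ, resPair p q t e m ζ i ξ ∂tor δ = 0 := by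
  cases n with
  | zero => exact i.elim0
  | succ n =>
    have hq' : (q : ℂ) ≠ 0 := by exact_mod_cast hq0
    have hp' : (p : ℂ) ≠ 0 := by exact_mod_cast hp.ne'
    rw [integral_tor_insertNth δ (fun l => (h.pos l).le) i (h.continuousOn_resPair hp hq hpq hq0 e m i)]
    refine integral_eq_zero_of_ae ?_
    filter_upwards [ae_tor (r := fun l => δ (i.succAbove l)) fun l => (h.pos _).le] with η hη
    have hη' := fun l => mem_torSet.1 hη l
    have hη2 : ∀ l, ‖η l‖ < p / 2 := fun l => by rw [hη' l]; exact h.lt _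
    have hdi := h.lt i
    -- The factor pairing `z` and `η l`, times the factor of `η l` at the pole, simplified according
    -- to the order of the two indices.
    let D : Fin n → ℂ → ℂ := fun l z => if i < i.succAbove l then (p * q : ℂ)⁻¹ else
      (z - p - q * z * η l) / (p * q * (p + q * η l * z - η l))
    let d : ℂ → ℂ := fun z => pairProd p q η * (∏ l, D l z)
      * (∏ l, oneFactor p q t (m + e (i.succAbove l) + 1) (η l))
      * (pairFactor p q z ζ * extProd p q η ζ)
      * (1 / (1 - z) * Complex.exp (t * (q * z + p * q * z / (z - p) - 1))
        * ((z - p - q * z * ζ) / (p * (1 - z))) * ((z - p - q * z ^ 2) / q ^ 2)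
        * ((z - p) / q) ^ (m - 1) * z ^ (e i - 1) / (1 - (∏ l, η l) * ζ * ((z - p) / q)))
    have hzp : ∀ z : ℂ, ‖z‖ ≤ δ i → z - p ≠ 0 := fun z hz h1 => by
      rw [sub_eq_zero.1 h1, Complex.norm_real, Real.norm_of_nonneg hp.le] at hz
      linarith
    have hz1 : ∀ z : ℂ, ‖z‖ ≤ δ i → ‖z‖ < 1 := fun z hz => by linarith
    have heq : ∀ z : ℂ, ‖z‖ = δ i →
        resPair p q t e m ζ i (i.insertNth (α := fun _ => ℂ) z η) = z * d z := by
      intro z hz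
      have hz0 : z ≠ 0 := norm_pos_iff.1 (hz ▸ h.pos i)
      have hzη : ∀ l, z ≠ η l := fun l h1 => by
        have h2 := hη' l
        rw [← h1, hz] at h2
        exact (Fin.succAbove_ne i l) (h.inj h2).symm
      have hprod : ∏ l, D l z = (∏ l, if i < i.succAbove l then pairFactor p q z (η l)
          else pairFactor p q (η l) z) * ∏ l, pairFactor p q (η l) (pairPole p q z) := by
        rw [← Finset.prod_mul_distrib]
        refine Finset.prod_congr rfl fun l _ => ?_
        simp only [D]
        split_ifs
        · rw [pairFactor_mul_pairFactor_pairPole hp.ne' hq0 hz0 (hzη l)]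
          exact ASEP.den_ne hp hq hpq (hz ▸ h.lt i) (by linarith [hη2 l])
        · rw [pairFactor_mul_pairFactor_pairPole' hp.ne' hq0 hz0 (hzη l)]
      have hone := oneFactor_mul_oneFactor_pairPole (t := t) hp.ne' hq0 hpq (ζ := ζ)
        (P := ∏ l, η l) hz0
        (one_sub_ne (hz1 z hz.le)) (hzp z hz.le) (e i) m
      simp only [resPair, kernelBase, pairProd_insertNth, extProd_insertNth,
        Fin.insertNth_apply_same, prod_erase_insertNth, Fin.insertNth_apply_succAbove,
        Fin.prod_univ_succAbove _ i, d, hprod]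
      linear_combination (pairProd p q η * ((∏ l, if i < i.succAbove l then pairFactor p q z (η l)
          else pairFactor p q (η l) z) * ∏ l, pairFactor p q (η l) (pairPole p q z))
          * (∏ l, oneFactor p q t (m + e (i.succAbove l) + 1) (η l))
          * (pairFactor p q z ζ * extProd p q η ζ)) * hone
    have hcongr : ∫ z, resPair p q t e m ζ i (i.insertNth (α := fun _ => ℂ) z η) ∂circ (δ i)
        = ∫ z, z * d z ∂circ (δ i) :=
      integral_congr_ae (by
        filter_upwards [ae_circ (h.pos i).le] with z hz using heq z hz)
    change ∫ z, resPair p q t e m ζ i (i.insertNth (α := fun _ => ℂ) z η) ∂circ (δ i) = 0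
    rw [hcongr]
    refine integral_circ_mul_eq_zero (h.pos i).le fun z hz => ?_
    have d1 : DifferentiableAt ℂ (fun z => ∏ l, D l z) z := differentiableAt_prod fun l _ => by
      simp only [D]
      split_ifs
      · exact differentiableAt_const _
      · have h1 := ASEP.den_ne hp hq hpq (hη2 l) (hz1 z hz).le
        have h2 : (p : ℂ) * q * (p + q * η l * z - η l) ≠ 0 := mul_ne_zero (mul_ne_zero hp' hq') h1
        fun_prop (disch := assumption)
    have d2 : DifferentiableAt ℂ (fun z => pairFactor p q z ζ) z :=
      differentiableAt_pairFactor differentiableAt_id (differentiableAt_const _)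
        (ASEP.den_ne hp hq hpq (hz.trans_lt hdi) h.norm_le)
    have d3 : 1 - z ≠ 0 := one_sub_ne (hz1 z hz)
    have d4 : (p : ℂ) * (1 - z) ≠ 0 := mul_ne_zero hp' d3
    have d5 := hzp z hz
    have d6 : DifferentiableAt ℂ (fun z : ℂ => z ^ (e i - 1)) z :=
      differentiableAt_id.zpow (Or.inr (by linarith [he i]))
    have d7 : DifferentiableAt ℂ (fun z : ℂ => ((z - p) / q) ^ (m - 1)) z :=
      DifferentiableAt.zpow (by fun_prop (disch := assumption)) (Or.inl (div_ne_zero d5 hq'))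
    have d8 : 1 - (∏ l, η l) * ζ * ((z - p) / q) ≠ 0 := by
      have h1 := h.den hq0 (i.insertNth (α := fun _ => ℂ) z η) (fun l => by
        rcases Fin.eq_self_or_eq_succAbove i l with rfl | ⟨l, rfl⟩
        · simpa using hz
        · simpa using (hη' l).le) i
      simp only [prod_erase_insertNth, Fin.insertNth_apply_same,
        Fin.insertNth_apply_succAbove] at h1
      intro h2
      apply h1
      field_simp at h2
      linear_combination h2
    have d9 : (q : ℂ) ^ 2 ≠ 0 := pow_ne_zero _ hq'
    fun_prop (disch := assumption)

end

/-! ### Moving the last contour to infinity -/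

theorem ae_prod_mem {X Y : Type*} [MeasurableSpace X] [MeasurableSpace Y] {μ : Measure X}
    {ν : Measure Y} [SFinite ν] [SFinite μ] {s : Set X} {u : Set Y} (hs : ∀ᵐ x ∂μ, x ∈ s)
    (hu : ∀ᵐ y ∂ν, y ∈ u) : ∀ᵐ z ∂μ.prod ν, z ∈ s ×ˢ u := by
  filter_upwards [Measure.quasiMeasurePreserving_fst.ae hs,
    Measure.quasiMeasurePreserving_snd.ae hu] with z h1 h2 using ⟨h1, h2⟩

theorem ae_circ_mem {r : ℝ} (hr : 0 ≤ r) : ∀ᵐ z ∂circ r, z ∈ Metric.sphere (0 : ℂ) r := by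
  filter_upwards [ae_circ hr] with z hz using by simpa using hz

section

variable {p q t : ℝ} {n : ℕ} {δ : Fin n → ℝ} {ζ : ℂ}

theorem differentiableAt_kernel {E : Type*} [NormedAddCommGroup E] [NormedSpace ℂ E] {x : E}
    (hp : 0 < p) (hq : 0 ≤ q) (hpq : p + q = 1) {e : Fin n → ℤ} {m : ℤ}
    {ξ : E → Fin n → ℂ} {ζ w : E → ℂ} (hξ : DifferentiableAt ℂ ξ x) (hζ : DifferentiableAt ℂ ζ x)
    (hw : DifferentiableAt ℂ w x)
    (h0 : ∀ i, ξ x i ≠ 0) (h1 : ∀ i, ‖ξ x i‖ < p / 2) (h2 : ‖ζ x‖ ≤ 1)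
    (hw0 : w x ≠ 0) (hw1 : 1 - w x ≠ 0) (hwd : ∀ i, (p : ℂ) + q * ξ x i * w x - ξ x i ≠ 0)
    (hP : 1 - (∏ i, ξ x i) * ζ x * w x ≠ 0) :
    DifferentiableAt ℂ (fun x => kernel p q t e m (ζ x) (ξ x) (w x)) x := by
  unfold kernel
  have d1 := differentiableAt_kernelBase (t := t) (e := e) (m := m) hp hq hpq hξ hζ h0 h1 h2
  have d2 := differentiableAt_extProd (p := p) (q := q) hξ hw hwd
  have d3 := differentiableAt_oneFactor (p := p) (q := q) (t := t) (k := m) hw hw0 hw1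
  have d4 : DifferentiableAt ℂ (fun x => ∏ i, ξ x i) x :=
    differentiableAt_prod fun i _ => (differentiableAt_pi.1 hξ) i
  fun_prop (disch := assumption)

/-- A circle of radius `R` on which the kernel has no singularities. -/
structure GoodRadius (p q : ℝ) {n : ℕ} (δ : Fin n → ℝ) (z R : ℝ) : Prop where
  pos : 0 < R
  ne_one : R ≠ 1
  den : ∀ ξ ∈ torSet δ, ∀ w : ℂ, ‖w‖ = R → ∀ i, (p : ℂ) + q * ξ i * w - ξ i ≠ 0
  prod_ne : ∀ ξ ∈ torSet δ, ∀ ζ w : ℂ, ‖ζ‖ = z → ‖w‖ = R → 1 - (∏ i, ξ i) * ζ * w ≠ 0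

theorem Admissible.goodRadius_small (h : Admissible p q δ ζ) (hp : 0 < p) (hq : 0 ≤ q)
    (hpq : p + q = 1) {r : ℝ} (hr : 0 < r) (hr1 : r < 1) : GoodRadius p q δ ‖ζ‖ r where
  pos := hr
  ne_one := hr1.ne
  den ξ hξ w hw i := h.den_ne hp hq hpq hξ i (hw ▸ hr1.le)
  prod_ne ξ hξ ζ' w hζ' hw := by
    apply one_sub_ne
    rw [norm_mul, norm_mul, norm_prod_of_mem hξ, hζ', hw]
    have := h.prod_le
    have h0 : 0 ≤ (∏ i, δ i) * ‖ζ‖ :=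
      mul_nonneg (Finset.prod_nonneg fun i _ => (h.pos i).le) (norm_nonneg _)
    nlinarith

theorem Admissible.goodRadius_big (h : Admissible p q δ ζ) (hp : 0 < p) (hq : 0 ≤ q)
    (hpq : p + q = 1) {R : ℝ} (hR1 : 1 < R) (hRP : ((∏ i, δ i) * ‖ζ‖)⁻¹ < R)
    (hRA : ∀ i, (δ i + p) / (q * δ i) < R) : GoodRadius p q δ ‖ζ‖ R where
  pos := one_pos.trans hR1
  ne_one := hR1.ne'
  den ξ hξ w hw i := h.extProd_den_ne hp hξ (fun hq0 i h1 => by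
    have h2 := (h.norm_pairPole hq hpq hq0 hξ i).2
    rw [← h1, hw] at h2
    exact absurd (hRA i) (not_lt.2 h2)) i
  prod_ne ξ hξ ζ' w hζ' hw := by
    intro h1
    have h2 : ‖(∏ i, ξ i) * ζ' * w‖ = 1 := by
      rw [← sub_eq_zero.1 h1, norm_one]
    rw [norm_mul, norm_mul, norm_prod_of_mem hξ, hζ', hw] at h2
    have h0 : 0 < (∏ i, δ i) * ‖ζ‖ :=
      mul_pos (Finset.prod_pos fun i _ => h.pos i) (norm_pos_iff.2 h.ne_zero)
    rw [inv_lt_iff_one_lt_mul₀ h0] at hRP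
    linarith

theorem GoodRadius.differentiableAt_kernel (h : Admissible p q δ ζ) (hp : 0 < p) (hq : 0 ≤ q)
    (hpq : p + q = 1) {R : ℝ} (hR : GoodRadius p q δ ‖ζ‖ R) {e : Fin n → ℤ} {m : ℤ}
    {E : Type*} [NormedAddCommGroup E] [NormedSpace ℂ E] {x : E}
    {ξ : E → Fin n → ℂ} {ζ' w : E → ℂ} (hξ : DifferentiableAt ℂ ξ x)
    (hζ : DifferentiableAt ℂ ζ' x) (hw : DifferentiableAt ℂ w x) (hξx : ξ x ∈ torSet δ)
    (hζx : ‖ζ' x‖ = ‖ζ‖) (hwx : ‖w x‖ = R) :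
    DifferentiableAt ℂ (fun x => kernel p q t e m (ζ' x) (ξ x) (w x)) x :=
  ASEP.differentiableAt_kernel hp hq hpq hξ hζ hw (h.ne_zero_of_mem hξx)
    (fun i => mem_torSet.1 hξx i ▸ h.lt i) (hζx.le.trans h.norm_le)
    (norm_pos_iff.1 (hwx ▸ hR.pos))
    (fun h1 => hR.ne_one (by rw [← hwx, ← sub_eq_zero.1 h1, norm_one]))
    (fun i => hR.den _ hξx _ hwx i) (hR.prod_ne _ hξx _ _ hζx hwx)

theorem GoodRadius.integrable_kernel (h : Admissible p q δ ζ) (hp : 0 < p) (hq : 0 ≤ q)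
    (hpq : p + q = 1) {R : ℝ} (hR : GoodRadius p q δ ‖ζ‖ R) (e : Fin n → ℤ) (m : ℤ) :
    Integrable (fun x : (Fin n → ℂ) × ℂ => kernel p q t e m ζ x.1 x.2)
      ((tor δ).prod (circ R)) := by
  refine integrable_tor_prod_circ (fun i => (h.pos i).le) hR.pos.le fun x hx => ?_
  refine (DifferentiableAt.continuousAt (𝕜 := ℂ) ?_).continuousWithinAt
  exact hR.differentiableAt_kernel h hp hq hpq differentiableAt_fst
    (differentiableAt_const _) differentiableAt_snd hx.1 rfl (by simpa using hx.2)

theorem Admissible.differentiableAt_resProd {E : Type*} [NormedAddCommGroup E]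
    [NormedSpace ℂ E] {x : E} (h : Admissible p q δ ζ) (hp : 0 < p) (hq : 0 ≤ q)
    (hpq : p + q = 1) (hlt : (∏ i, δ i) * ‖ζ‖ < 1) {e : Fin n → ℤ} {m : ℤ}
    {ξ : E → Fin n → ℂ} {ζ' : E → ℂ} (hξ : DifferentiableAt ℂ ξ x)
    (hζ : DifferentiableAt ℂ ζ' x) (hξx : ξ x ∈ torSet δ) (hζx : ζ' x = ζ) :
    DifferentiableAt ℂ (fun x => resProd p q t e m (ζ' x) (ξ x)) x := by
  have hP0 := h.prod_ne_zero hξx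
  have hPn := norm_prod_mul_lt hlt hξx
  have hw01 : 1 < ‖((∏ i, ξ x i) * ζ)⁻¹‖ := by
    rw [norm_inv]; exact (one_lt_inv₀ (norm_pos_iff.2 hP0)).2 hPn
  have d1 := ASEP.differentiableAt_kernelBase (t := t) (e := e) (m := m) hp hq hpq hξ hζ
    (h.ne_zero_of_mem hξx) (fun i => mem_torSet.1 hξx i ▸ h.lt i) (hζx ▸ h.norm_le)
  have d4 : DifferentiableAt ℂ (fun x => ∏ i, ξ x i) x :=
    differentiableAt_prod fun i _ => (differentiableAt_pi.1 hξ) i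
  have hP0' : (∏ i, ξ x i) * ζ' x ≠ 0 := hζx ▸ hP0
  have dw : DifferentiableAt ℂ (fun x => ((∏ i, ξ x i) * ζ' x)⁻¹) x := by
    fun_prop (disch := assumption)
  have d2 := differentiableAt_extProd (p := p) (q := q) hξ dw (fun i => by
    rw [hζx]
    exact h.extProd_den_ne hp hξx (fun hq0 i h1 => by
      apply h.one_sub_pairPole hq0 hξx i
      rw [← h1, mul_inv_cancel₀ hP0, sub_self]) i)
  have d3 := differentiableAt_oneFactor (p := p) (q := q) (t := t) (k := m) dw
    (inv_ne_zero hP0') (fun h1 => by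
      rw [hζx] at h1
      rw [← sub_eq_zero.1 h1, norm_one] at hw01
      exact lt_irrefl _ hw01)
  unfold resProd
  fun_prop

theorem Admissible.integrable_resProd (h : Admissible p q δ ζ) (hp : 0 < p) (hq : 0 ≤ q)
    (hpq : p + q = 1) (hlt : (∏ i, δ i) * ‖ζ‖ < 1) (e : Fin n → ℤ) (m : ℤ) :
    Integrable (resProd p q t e m ζ) (tor δ) :=
  integrable_tor (fun i => (h.pos i).le) fun _ hξ =>
    (h.differentiableAt_resProd (ζ' := fun _ => ζ) hp hq hpq hlt differentiableAt_id
      (differentiableAt_const _) hξ rfl).continuousAt.continuousWithinAt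

theorem Admissible.integrable_resOne (h : Admissible p q δ ζ) (hp : 0 < p) (hq : 0 ≤ q)
    (hpq : p + q = 1) (hlt : (∏ i, δ i) * ‖ζ‖ < 1) (e : Fin n → ℤ) (m : ℤ) :
    Integrable (resOne p q t e m ζ) (tor δ) := by
  refine integrable_tor (fun i => (h.pos i).le) fun ξ hξ =>
    (DifferentiableAt.continuousAt (𝕜 := ℂ) ?_).continuousWithinAt
  have d1 := h.differentiableAt_kernelBase (t := t) hp hq hpq (e := e) (m := m) hξ
  have d2 : DifferentiableAt ℂ (fun ξ : Fin n → ℂ => extProd p q ξ 1) ξ :=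
    differentiableAt_extProd differentiableAt_id (differentiableAt_const _)
      fun i => h.den_ne hp hq hpq hξ i norm_one.le
  have d6 : DifferentiableAt ℂ (fun ξ : Fin n → ℂ => ∏ i, ξ i) ξ :=
    differentiableAt_prod fun l _ => differentiableAt_coord l ξ
  have d7 := one_sub_ne (norm_prod_mul_lt hlt hξ)
  unfold resOne
  fun_prop (disch := assumption)

/-- After integration over ξ the residues at the poles of the pair factors drop out. -/
theorem Admissible.integral_integral_kernel_sub (h : Admissible p q δ ζ) (hp : 0 < p) (hq : 0 ≤ q)
    (hpq : p + q = 1) (hlt : (∏ i, δ i) * ‖ζ‖ < 1) (e : Fin n → ℤ) (he : ∀ i, 1 ≤ e i) (m : ℤ)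
    {r R : ℝ} (hr : 0 < r) (hr1 : r < 1) (hR1 : 1 < R) (hRP : ((∏ i, δ i) * ‖ζ‖)⁻¹ < R)
    (hRA : ∀ i, (δ i + p) / (q * δ i) < R) :
    (∫ ξ, ∫ w, kernel p q t e m ζ ξ w ∂circ R ∂tor δ)
      - ∫ ξ, ∫ w, kernel p q t e m ζ ξ w ∂circ r ∂tor δ
      = (∫ ξ, resOne p q t e m ζ ξ ∂tor δ) + ∫ ξ, resProd p q t e m ζ ξ ∂tor δ := by
  have hδ : ∀ i, 0 ≤ δ i := fun i => (h.pos i).le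
  have hA : ∀ i ∈ (if q = 0 then ∅ else Finset.univ : Finset (Fin n)), q ≠ 0 := fun i hi h0 => by
    simp [h0] at hi
  rw [← integral_sub
    ((h.goodRadius_big hp hq hpq hR1 hRP hRA).integrable_kernel h hp hq hpq e m).integral_prod_left
    ((h.goodRadius_small hp hq hpq hr hr1).integrable_kernel h hp hq hpq e m).integral_prod_left]
  have h1 : ∫ ξ, ((∫ w, kernel p q t e m ζ ξ w ∂circ R) - ∫ w, kernel p q t e m ζ ξ w ∂circ r) ∂tor δ
      = ∫ ξ, ((∑ i ∈ if q = 0 then ∅ else Finset.univ, resPair p q t e m ζ i ξ)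
        + (resOne p q t e m ζ ξ + resProd p q t e m ζ ξ)) ∂tor δ :=
    integral_congr_ae (by
      filter_upwards [ae_tor hδ] with ξ hξ using
        h.integral_kernel_sub hp hq hpq hlt e m hξ hr hr1 hR1 hRP hRA)
  have h2 : ∀ i ∈ (if q = 0 then ∅ else Finset.univ : Finset (Fin n)),
      Integrable (resPair p q t e m ζ i) (tor δ) := fun i hi =>
    integrable_tor hδ (h.continuousOn_resPair hp hq hpq (hA i hi) e m i)
  have i1 := h.integrable_resOne (t := t) hp hq hpq hlt e m
  have i2 := h.integrable_resProd (t := t) hp hq hpq hlt e m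
  have i3 : Integrable (fun ξ => resOne p q t e m ζ ξ + resProd p q t e m ζ ξ) (tor δ) := i1.add i2
  rw [h1, integral_add (integrable_finsetSum _ h2) i3, integral_finsetSum _ h2,
    Finset.sum_eq_zero fun i hi => h.integral_resPair hp hq hpq (hA i hi) e he m i, zero_add,
    integral_add i1 i2]

end

/-! ### The boundary identity -/

/-- The part of the residue at `(ξ₁ ⋯ ξₙ)⁻¹` that does not depend on the exponent `m`, for `ζ = 1`. -/
def boundaryOne (p q t : ℝ) {n : ℕ} (e : Fin n → ℤ) (ξ : Fin n → ℂ) : ℂ :=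
  pairProd p q ξ * (∏ i, oneFactor p q t (e i + 1) (ξ i)) * extProd p q ξ (∏ i, ξ i)⁻¹
    * Complex.exp (t * eps p q (∏ i, ξ i)⁻¹)

/-- The residue at `(ξ₁ ⋯ ξₙ ζ)⁻¹`, times the factor of `ζ`. -/
def boundaryTwo (p q t : ℝ) {n : ℕ} (e : Fin n → ℤ) (ζ : ℂ) (ξ : Fin n → ℂ) : ℂ :=
  -(pairProd p q ξ * (∏ i, oneFactor p q t (e i + 1) (ξ i)) * extProd p q ξ ζ
    * extProd p q ξ ((∏ i, ξ i) * ζ)⁻¹ * (((∏ i, ξ i) * ζ)⁻¹ - ζ)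
    * (oneFactor p q t 0 ζ * oneFactor p q t 0 ((∏ i, ξ i) * ζ)⁻¹))

section

variable {p q t : ℝ} {n : ℕ} {δ : Fin n → ℝ} {ζ : ℂ}

theorem oneFactor_add (m k : ℤ) {x : ℂ} (hx : x ≠ 0) :
    oneFactor p q t (m + k) x = x ^ m * oneFactor p q t k x := by
  rw [oneFactor, oneFactor, zpow_add₀ hx]; ring

theorem kernelBase_eq (e : Fin n → ℤ) (m : ℤ) (ζ : ℂ) {ξ : Fin n → ℂ} (hξ : ∀ i, ξ i ≠ 0) :
    kernelBase p q t e m ζ ξ = (∏ i, ξ i) ^ m * kernelBase p q t e 0 ζ ξ := by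
  have : ∏ i, oneFactor p q t (m + e i + 1) (ξ i)
      = (∏ i, ξ i) ^ m * ∏ i, oneFactor p q t (0 + e i + 1) (ξ i) := by
    rw [← Finset.prod_zpow, ← Finset.prod_mul_distrib]
    refine Finset.prod_congr rfl fun i _ => ?_
    rw [add_assoc, oneFactor_add m _ (hξ i), zero_add]
  rw [kernelBase, kernelBase, this]
  ring

/-- The exponent `m` enters only through a monomial, hence the decay as `m` tends to -∞ where |∏ ξᵢ
w| > 1. -/
theorem kernel_eq (e : Fin n → ℤ) (m : ℤ) (ζ : ℂ) {ξ : Fin n → ℂ} (hξ : ∀ i, ξ i ≠ 0) {w : ℂ}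
    (hw : w ≠ 0) :
    kernel p q t e m ζ ξ w = ((∏ i, ξ i) * w) ^ m * kernel p q t e 0 ζ ξ w := by
  rw [kernel, kernel, kernelBase_eq e m ζ hξ, ← add_zero m, oneFactor_add m 0 hw, add_zero,
    mul_zpow]
  ring

/-- At w = (∏ ξᵢ)⁻¹ the monomial carrying `m` equals 1, the factor w - 1 cancels the pole of
`oneFactor` at 1, and `extProd_one` supplies the power of `p`. -/
theorem resProd_one (h : Admissible p q δ 1) (hlt : (∏ i, δ i) * ‖(1 : ℂ)‖ < 1) (hp : 0 < p)
    (hq : 0 ≤ q) (hpq : p + q = 1) (e : Fin n → ℤ) (m : ℤ) {ξ : Fin n → ℂ} (hξ : ξ ∈ torSet δ) :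
    resProd p q t e m 1 ξ = ((p : ℂ) ^ n)⁻¹ * boundaryOne p q t e ξ := by
  have hξ0 := h.ne_zero_of_mem hξ
  have hP0 := h.prod_ne_zero hξ
  have hPn := norm_prod_mul_lt hlt hξ
  rw [mul_one] at hP0 hPn
  have hw01 : 1 < ‖(∏ i, ξ i)⁻¹‖ := by
    rw [norm_inv]; exact (one_lt_inv₀ (norm_pos_iff.2 hP0)).2 hPn
  have h1 : 1 - (∏ i, ξ i)⁻¹ ≠ 0 := fun h1 => by
    rw [← sub_eq_zero.1 h1, norm_one] at hw01; exact lt_irrefl _ hw01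
  have h2 : ((∏ i, ξ i)⁻¹ - 1) * oneFactor p q t m (∏ i, ξ i)⁻¹
      = -((∏ i, ξ i) ^ m)⁻¹ * Complex.exp (t * eps p q (∏ i, ξ i)⁻¹) := by
    have h3 : ((∏ i, ξ i)⁻¹ - 1) / (1 - (∏ i, ξ i)⁻¹) = -1 := by
      rw [div_eq_iff h1]; ring
    rw [oneFactor, inv_zpow]
    linear_combination ((∏ i, ξ i) ^ m)⁻¹ * Complex.exp (t * eps p q (∏ i, ξ i)⁻¹) * h3
  have hPm : (∏ i, ξ i) ^ m ≠ 0 := zpow_ne_zero _ hP0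
  rw [resProd, mul_one, h2, kernelBase_eq e m 1 hξ0, kernelBase, extProd_one hp hpq
    fun i => one_sub_ne (h.norm_lt (by linarith) hξ i), boundaryOne]
  simp only [zero_add]
  field_simp

/-- Again `m` disappears: all its powers combine to (∏ ξᵢ · ζ · w)^m with w = (∏ ξᵢ ζ)⁻¹. -/
theorem oneFactor_mul_resProd (h : Admissible p q δ ζ) (e : Fin n → ℤ) (m : ℤ) {ξ : Fin n → ℂ}
    (hξ : ξ ∈ torSet δ) :
    oneFactor p q t m ζ * resProd p q t e m ζ ξ = boundaryTwo p q t e ζ ξ := by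
  have hξ0 := h.ne_zero_of_mem hξ
  have hP0 := h.prod_ne_zero hξ
  have hζ := h.ne_zero
  have hP : (∏ i, ξ i) ≠ 0 := left_ne_zero_of_mul hP0
  have h1 : ζ ^ m * (∏ i, ξ i) ^ m * (((∏ i, ξ i) * ζ)⁻¹) ^ m = 1 := by
    rw [← mul_zpow, ← mul_zpow, mul_comm ζ, mul_inv_cancel₀ hP0, one_zpow]
  rw [resProd, kernelBase_eq e m ζ hξ0, kernelBase, boundaryTwo,
    ← add_zero m, oneFactor_add m 0 hζ, oneFactor_add m 0 (inv_ne_zero hP0), add_zero]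
  simp only [zero_add]
  linear_combination (-(pairProd p q ξ * (∏ i, oneFactor p q t (e i + 1) (ξ i)) * extProd p q ξ ζ
    * extProd p q ξ ((∏ i, ξ i) * ζ)⁻¹ * (((∏ i, ξ i) * ζ)⁻¹ - ζ)
    * (oneFactor p q t 0 ζ * oneFactor p q t 0 ((∏ i, ξ i) * ζ)⁻¹))) * h1

/-- At w = 1 the two last variables exchange roles: 1 takes the place of ζ, and ζ that of w. After
integration over ζ this is the small-circle integral of the case ζ = 1. -/
theorem oneFactor_mul_resOne (e : Fin n → ℤ) (m : ℤ) (ξ : Fin n → ℂ) :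
    oneFactor p q t m ζ * resOne p q t e m ζ ξ = kernel p q t e m 1 ξ ζ := by
  have h3 : (ζ - 1) * oneFactor p q t m ζ = -(oneFactor p q t m ζ * (1 - ζ)) := by ring
  rw [resOne, kernel, kernelBase, kernelBase, h3, mul_one]
  ring

/-- The kernel is antisymmetric in its last two variables. -/
theorem oneFactor_mul_kernel_swap (e : Fin n → ℤ) (m : ℤ) (ζ w : ℂ) (ξ : Fin n → ℂ) :
    oneFactor p q t m w * kernel p q t e m w ξ ζ
      = -(oneFactor p q t m ζ * kernel p q t e m ζ ξ w) := by
  have : (∏ i, ξ i) * w * ζ = (∏ i, ξ i) * ζ * w := by ring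
  rw [kernel, kernel, kernelBase, kernelBase, this]
  ring

/-- Here ζ and w run over the same circle and the integrand is antisymmetric in them
(`oneFactor_mul_kernel_swap`); by Fubini the integral equals its own negative. -/
theorem integral_kernel_small {r : ℝ} (hr : 0 < r) (hr1 : r < 1) (hp : 0 < p) (hq : 0 ≤ q)
    (hpq : p + q = 1) (h : ∀ ζ : ℂ, ‖ζ‖ = r → Admissible p q δ ζ) (e : Fin n → ℤ) (m : ℤ) :
    ∫ ζ, oneFactor p q t m ζ * ∫ ξ, ∫ w, kernel p q t e m ζ ξ w ∂circ r ∂tor δ ∂circ r = 0 := by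
  have hr' : ‖(r : ℂ)‖ = r := by rw [Complex.norm_real, Real.norm_of_nonneg hr.le]
  have h0 := h r hr'
  have hδ : ∀ i, 0 ≤ δ i := fun i => (h0.pos i).le
  have hg := h0.goodRadius_small hp hq hpq hr hr1
  have h1 : ∀ ζ : ℂ, ‖ζ‖ = r → oneFactor p q t m ζ * ∫ ξ, ∫ w, kernel p q t e m ζ ξ w ∂circ r ∂tor δ
      = ∫ w, ∫ ξ, oneFactor p q t m ζ * kernel p q t e m ζ ξ w ∂tor δ ∂circ r := fun ζ hζ => by
    have hg' : GoodRadius p q δ ‖ζ‖ r := by rw [hζ]; rwa [hr'] at hg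
    rw [integral_integral_swap (hg'.integrable_kernel (h ζ hζ) hp hq hpq e m),
      ← integral_const_mul]
    simp_rw [integral_const_mul]
  have h2 : Integrable (fun x : (ℂ × ℂ) × (Fin n → ℂ) =>
      oneFactor p q t m x.1.1 * kernel p q t e m x.1.1 x.2 x.1.2)
      (((circ r).prod (circ r)).prod (tor δ)) := by
    refine integrable_of_compact (((isCompact_sphere (0 : ℂ) r).prod
      (isCompact_sphere (0 : ℂ) r)).prod (isCompact_torSet δ))
      (ae_prod_mem (ae_prod_mem (ae_circ_mem hr.le) (ae_circ_mem hr.le)) (ae_tor hδ))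
      fun x hx => (DifferentiableAt.continuousAt (𝕜 := ℂ) ?_).continuousWithinAt
    have hx1 : ‖x.1.1‖ = r := by simpa using hx.1.1
    have hx2 : ‖x.1.2‖ = r := by simpa using hx.1.2
    have d1 : DifferentiableAt ℂ (fun x : (ℂ × ℂ) × (Fin n → ℂ) => oneFactor p q t m x.1.1) x :=
      differentiableAt_oneFactor (by fun_prop) (norm_pos_iff.1 (hx1 ▸ hr))
        (one_sub_ne (hx1 ▸ hr1))
    have d2 := hg.differentiableAt_kernel (t := t) h0 hp hq hpq (e := e) (m := m)
      (ξ := fun x : (ℂ × ℂ) × (Fin n → ℂ) => x.2) (ζ' := fun x => x.1.1) (w := fun x => x.1.2)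
      (x := x) (by fun_prop) (by fun_prop) (by fun_prop) hx.2 (hx1.trans hr'.symm) hx2
    fun_prop
  have h3 : ∫ ζ, oneFactor p q t m ζ * ∫ ξ, ∫ w, kernel p q t e m ζ ξ w ∂circ r ∂tor δ ∂circ r
      = ∫ ζ, ∫ w, ∫ ξ, oneFactor p q t m ζ * kernel p q t e m ζ ξ w ∂tor δ ∂circ r ∂circ r :=
    integral_congr_ae (by filter_upwards [ae_circ hr.le] with ζ hζ using h1 ζ hζ)
  rw [h3]
  have h4 := integral_integral_swap (μ := circ r) (ν := circ r) (f := fun ζ w =>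
    ∫ ξ, oneFactor p q t m ζ * kernel p q t e m ζ ξ w ∂tor δ) h2.integral_prod_left
  have h5 : ∀ ζ w : ℂ, ∫ ξ, oneFactor p q t m ζ * kernel p q t e m ζ ξ w ∂tor δ
      = -∫ ξ, oneFactor p q t m w * kernel p q t e m w ξ ζ ∂tor δ := fun ζ w => by
    rw [← integral_neg]
    simp_rw [oneFactor_mul_kernel_swap e m ζ w, neg_neg]
  have h6 : ∫ w, ∫ ζ, ∫ ξ, oneFactor p q t m ζ * kernel p q t e m ζ ξ w ∂tor δ ∂circ r ∂circ r
      = -∫ w, ∫ ζ, ∫ ξ, oneFactor p q t m w * kernel p q t e m w ξ ζ ∂tor δ ∂circ r ∂circ r := by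
    rw [← integral_neg]
    refine integral_congr_ae (Eventually.of_forall fun w => ?_)
    simp only
    rw [← integral_neg]
    exact integral_congr_ae (Eventually.of_forall fun ζ => h5 ζ w)
  rw [h6] at h4
  exact self_eq_neg.1 h4

end

/-! ### The contour identity, by letting the exponent `m` tend to -∞. -/

section

variable {p q t : ℝ} {n : ℕ} {δ : Fin n → ℝ} {ζ : ℂ}

/-- For n = 0 and ζ = 1 the poles at 1 and at (∏ ξᵢ ζ)⁻¹ coincide, so the general residue formula
does not apply; the numerator w - 1 cancels one of the two factors and the remaining pole is simple.
-/
theorem integral_kernel_one_of_isEmpty (hpq : p + q = 1) {δ : Fin 0 → ℝ} (e : Fin 0 → ℤ) (m : ℤ)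
    {r R : ℝ} (hr : 0 < r) (hr1 : r < 1) (hR1 : 1 < R) :
    (∫ ξ, ∫ w, kernel p q t e m 1 ξ w ∂circ R ∂tor δ)
      - ∫ ξ, ∫ w, kernel p q t e m 1 ξ w ∂circ r ∂tor δ = 1 := by
  let ξ₀ : Fin 0 → ℂ := fun i => i.elim0
  rw [integral_tor_zero δ _ ξ₀, integral_tor_zero δ _ ξ₀]
  have hk : ∀ w : ℂ, w ≠ 1 → kernel p q t e m 1 ξ₀ w = -oneFactor p q t m w := fun w hw => by
    have h1 : 1 - w ≠ 0 := sub_ne_zero.2 hw.symm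
    simp only [kernel, kernelBase, pairProd, extProd, Finset.univ_eq_empty, Finset.prod_empty,
      one_mul]
    rw [div_eq_iff h1]
    ring
  have hne : ∀ ρ : ℝ, 0 < ρ → ρ ≠ 1 → ∫ w, kernel p q t e m 1 ξ₀ w ∂circ ρ
      = ∫ w, -oneFactor p q t m w ∂circ ρ := fun ρ h1 h2 => integral_congr_ae (by
    filter_upwards [ae_circ h1.le] with w hw using hk w fun h3 => h2 (by rw [← hw, h3, norm_one]))
  rw [hne R (one_pos.trans hR1) hR1.ne', hne r hr hr1.ne]
  have he : eps p q 1 = 0 := by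
    simp only [eps, inv_one, mul_one]
    rw [sub_eq_zero]; exact_mod_cast hpq
  have key := integral_circ_sub hr (hr1.trans hR1).le {()} (fun _ => (1 : ℂ)) (by simp)
    (fun _ => 1) (fun w => -oneFactor p q t m w) (fun w h1 h2 h3 =>
      (differentiableAt_oneFactor differentiableAt_id (norm_pos_iff.1 (hr.trans_le h1))
        (sub_ne_zero.2 (h3 () (by simp)).symm)).neg) (by simpa using ⟨hr1, hR1⟩) (fun i _ => by
      refine tendsto_of_eq_mul (k := fun w => w ^ m * Complex.exp (t * eps p q w)) ?_
        (by simp [he]) ?_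
      · have d2 : DifferentiableAt ℂ (fun w : ℂ => w ^ m) 1 :=
          differentiableAt_id.zpow (Or.inl one_ne_zero)
        have d3 : DifferentiableAt ℂ (fun w => eps p q w) 1 :=
          differentiableAt_eps differentiableAt_id one_ne_zero
        refine DifferentiableAt.continuousAt (𝕜 := ℂ) ?_
        fun_prop
      · intro w hw
        have h1 : 1 - w ≠ 0 := sub_ne_zero.2 hw.symm
        have h2 : (w - 1) / (1 - w) = -1 := by rw [div_eq_iff h1]; ring
        rw [oneFactor]
        linear_combination (-(w ^ m * Complex.exp (t * eps p q w))) * h2)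
  rw [key]
  simp

/-- The residue at w = 1 contains the factor 1 - ζ = 0, so only the residue at (∏ ξᵢ)⁻¹ survives. -/
theorem integral_kernel_one (hp : 0 < p) (hq : 0 ≤ q) (hpq : p + q = 1)
    (h : Admissible p q δ 1) (e : Fin n → ℤ) (he : ∀ i, 1 ≤ e i) (m : ℤ) {r R : ℝ} (hr : 0 < r)
    (hr1 : r < 1) (hR1 : 1 < R) (hRP : (∏ i, δ i)⁻¹ < R) (hRA : ∀ i, (δ i + p) / (q * δ i) < R) :
    (∫ ξ, ∫ w, kernel p q t e m 1 ξ w ∂circ R ∂tor δ)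
      - ∫ ξ, ∫ w, kernel p q t e m 1 ξ w ∂circ r ∂tor δ
      = ((p : ℂ) ^ n)⁻¹ * ∫ ξ, boundaryOne p q t e ξ ∂tor δ := by
  cases n with
  | zero =>
    rw [integral_kernel_one_of_isEmpty hpq e m hr hr1 hR1,
      integral_tor_zero δ _ fun i => i.elim0]
    have he : eps p q 1 = 0 := by
      simp only [eps, inv_one, mul_one]
      rw [sub_eq_zero]; exact_mod_cast hpq
    simp [boundaryOne, pairProd, extProd, he]
  | succ n =>
    have hlt : (∏ i, δ i) * ‖(1 : ℂ)‖ < 1 := by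
      rw [norm_one, mul_one, Fin.prod_univ_succ]
      refine mul_lt_one_of_nonneg_of_lt_one_left (h.pos 0).le (by linarith [h.lt 0]) ?_
      exact Finset.prod_le_one (fun i _ => (h.pos _).le) fun i _ => by linarith [h.lt i.succ]
    rw [h.integral_integral_kernel_sub hp hq hpq hlt e he m hr hr1 hR1 (by simpa using hRP) hRA]
    have h1 : ∀ ξ, resOne p q t e m 1 ξ = 0 := fun ξ => by simp [resOne]
    simp_rw [h1]
    rw [integral_zero, zero_add, ← integral_const_mul]
    refine integral_congr_ae ?_
    filter_upwards [ae_tor fun i => (h.pos i).le] with ξ hξ using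
      resProd_one h hlt hp hq hpq e m hξ

theorem integrable_oneFactor_mul_kernel {r R : ℝ} (hr : 0 < r) (hr1 : r < 1) (hp : 0 < p)
    (hq : 0 ≤ q) (hpq : p + q = 1) (h : Admissible p q δ r) (hg : GoodRadius p q δ ‖(r : ℂ)‖ R)
    (e : Fin n → ℤ) (m : ℤ) :
    ContinuousOn (fun x : (ℂ × (Fin n → ℂ)) × ℂ =>
      oneFactor p q t m x.1.1 * kernel p q t e m x.1.1 x.1.2 x.2)
      ((Metric.sphere (0 : ℂ) r ×ˢ torSet δ) ×ˢ Metric.sphere (0 : ℂ) R) := by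
  have hr' : ‖(r : ℂ)‖ = r := by rw [Complex.norm_real, Real.norm_of_nonneg hr.le]
  intro x hx
  refine (DifferentiableAt.continuousAt (𝕜 := ℂ) ?_).continuousWithinAt
  have hx1 : ‖x.1.1‖ = r := by simpa using hx.1.1
  have hx2 : ‖x.2‖ = R := by simpa using hx.2
  have d1 : DifferentiableAt ℂ (fun x : (ℂ × (Fin n → ℂ)) × ℂ => oneFactor p q t m x.1.1) x :=
    differentiableAt_oneFactor (by fun_prop) (norm_pos_iff.1 (hx1 ▸ hr))
      (one_sub_ne (hx1 ▸ hr1))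
  have d2 := hg.differentiableAt_kernel (t := t) h hp hq hpq (e := e) (m := m)
    (ξ := fun x : (ℂ × (Fin n → ℂ)) × ℂ => x.1.2) (ζ' := fun x => x.1.1) (w := fun x => x.2)
    (x := x) (by fun_prop) (by fun_prop) (by fun_prop) hx.1.2 (hx1.trans hr'.symm) hx2
  fun_prop

theorem norm_integral_le_const {X : Type*} [MeasurableSpace X] {μ : Measure X}
    [IsProbabilityMeasure μ] {f : X → ℂ} {C : ℝ} (h : ∀ᵐ x ∂μ, ‖f x‖ ≤ C) : ‖∫ x, f x ∂μ‖ ≤ C := by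
  simpa using norm_integral_le_of_norm_le_const h

theorem tendsto_zpow_neg_natCast {a : ℝ} (ha : 1 < a) :
    Tendsto (fun k : ℕ => a ^ (-(k : ℤ))) atTop (𝓝 0) := by
  have := tendsto_pow_atTop_nhds_zero_of_lt_one (inv_nonneg.2 (one_pos.trans ha).le)
    (inv_lt_one_of_one_lt₀ ha)
  refine this.congr fun k => ?_
  rw [zpow_neg, zpow_natCast, inv_pow]

/-- The constant bounds the kernel for `m = 0` on a compact set; `kernel_eq` gives all other
exponents. -/
theorem exists_norm_integral_kernel_one_le (hp : 0 < p) (hq : 0 ≤ q) (hpq : p + q = 1)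
    (h : Admissible p q δ 1) {R : ℝ} (hg : GoodRadius p q δ ‖(1 : ℂ)‖ R) (e : Fin n → ℤ) :
    ∃ C, ∀ m : ℤ, ‖∫ ξ, ∫ w, kernel p q t e m 1 ξ w ∂circ R ∂tor δ‖
      ≤ ((∏ i, δ i) * R) ^ m * C := by
  have hc : ContinuousOn (fun x : (Fin n → ℂ) × ℂ => kernel p q t e 0 1 x.1 x.2)
      (torSet δ ×ˢ Metric.sphere (0 : ℂ) R) := fun x hx =>
    (hg.differentiableAt_kernel h hp hq hpq differentiableAt_fst
      (differentiableAt_const _) differentiableAt_snd hx.1 rfl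
      (by simpa using hx.2)).continuousAt.continuousWithinAt
  obtain ⟨C, hC⟩ := ((isCompact_torSet δ).prod (isCompact_sphere 0 R)).exists_bound_of_continuousOn hc
  refine ⟨C, fun m => norm_integral_le_const ?_⟩
  filter_upwards [ae_tor fun i => (h.pos i).le] with ξ hξ
  refine norm_integral_le_const ?_
  filter_upwards [ae_circ hg.pos.le] with w hw
  rw [kernel_eq e m 1 (h.ne_zero_of_mem hξ) (norm_pos_iff.1 (hw ▸ hg.pos)), norm_mul, norm_zpow,
    norm_mul, norm_prod_of_mem hξ, hw]
  have h1 := hC (ξ, w) ⟨hξ, by simpa using hw⟩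
  have h2 : 0 ≤ ∏ i, δ i := Finset.prod_nonneg fun i _ => (h.pos i).le
  have h3 := hg.pos.le
  gcongr

theorem exists_norm_integral_kernel_le {r R : ℝ} (hr : 0 < r) (hr1 : r < 1) (hp : 0 < p)
    (hq : 0 ≤ q) (hpq : p + q = 1) (h : Admissible p q δ r) (hg : GoodRadius p q δ ‖(r : ℂ)‖ R)
    (e : Fin n → ℤ) :
    ∃ C, ∀ m : ℤ, ‖∫ ζ, oneFactor p q t m ζ * ∫ ξ, ∫ w, kernel p q t e m ζ ξ w ∂circ R ∂tor δ
      ∂circ r‖ ≤ ((∏ i, δ i) * r * R) ^ m * C := by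
  obtain ⟨C, hC⟩ := (((isCompact_sphere (0 : ℂ) r).prod (isCompact_torSet δ)).prod
    (isCompact_sphere (0 : ℂ) R)).exists_bound_of_continuousOn
    (integrable_oneFactor_mul_kernel (t := t) hr hr1 hp hq hpq h hg e 0)
  refine ⟨C, fun m => norm_integral_le_const ?_⟩
  filter_upwards [ae_circ hr.le] with ζ hζ
  rw [← integral_const_mul]
  refine norm_integral_le_const ?_
  filter_upwards [ae_tor fun i => (h.pos i).le] with ξ hξ
  rw [← integral_const_mul]
  refine norm_integral_le_const ?_
  filter_upwards [ae_circ hg.pos.le] with w hw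
  have hζ0 : ζ ≠ 0 := norm_pos_iff.1 (hζ ▸ hr)
  have h4 : oneFactor p q t m ζ * kernel p q t e m ζ ξ w = ((∏ i, ξ i) * ζ * w) ^ m
      * (oneFactor p q t 0 ζ * kernel p q t e 0 ζ ξ w) := by
    rw [kernel_eq e m ζ (h.ne_zero_of_mem hξ) (norm_pos_iff.1 (hw ▸ hg.pos)), ← add_zero m,
      oneFactor_add m 0 hζ0, add_zero, mul_zpow, mul_zpow, mul_zpow]
    ring
  rw [h4, norm_mul, norm_zpow, norm_mul, norm_mul, norm_prod_of_mem hξ, hw, hζ]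
  have h1 := hC ((ζ, ξ), w) ⟨⟨by simpa using hζ, hξ⟩, by simpa using hw⟩
  have h2 : 0 ≤ ∏ i, δ i := Finset.prod_nonneg fun i _ => (h.pos i).le
  have h3 := hg.pos.le
  gcongr

/-- The cancellation between consecutive terms. The difference of the two sides equals, for every
`m`, a difference of integrals over large circles, which tends to 0 as `m` tends to -∞. -/
theorem integral_boundaryTwo {r : ℝ} (hr : 0 < r) (hr1 : r < 1) (hp : 0 < p) (hq : 0 ≤ q)
    (hpq : p + q = 1) (h : ∀ ζ : ℂ, ‖ζ‖ = r → Admissible p q δ ζ) (h1 : Admissible p q δ 1)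
    (e : Fin n → ℤ) (he : ∀ i, 1 ≤ e i) :
    ∫ ζ, ∫ ξ, boundaryTwo p q t e ζ ξ ∂tor δ ∂circ r
      = ((p : ℂ) ^ n)⁻¹ * ∫ ξ, boundaryOne p q t e ξ ∂tor δ := by
  have hr' : ‖(r : ℂ)‖ = r := by rw [Complex.norm_real, Real.norm_of_nonneg hr.le]
  have h0 := h r hr'
  have hδ : ∀ i, 0 ≤ δ i := fun i => (h1.pos i).le
  have hδpos : 0 < ∏ i, δ i := Finset.prod_pos fun i _ => h1.pos i
  have hδle : ∏ i, δ i ≤ 1 := Finset.prod_le_one (fun i _ => hδ i) fun i _ => by linarith [h1.lt i]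
  have hlt : ∀ ζ : ℂ, ‖ζ‖ = r → (∏ i, δ i) * ‖ζ‖ < 1 := fun ζ hζ => by
    rw [hζ]; nlinarith
  -- The large circle encloses all poles and makes ∏ δᵢ · r · R exceed 1. For `q = 0` the last
  -- condition reads `0 < R`.
  obtain ⟨R, hR1, hRP, hRA⟩ : ∃ R : ℝ, 1 < R ∧ ((∏ i, δ i) * r)⁻¹ < R ∧
      ∀ i, (δ i + p) / (q * δ i) < R :=
    ((eventually_gt_atTop 1).and ((eventually_gt_atTop _).and
      (eventually_all.2 fun i => eventually_gt_atTop _))).exists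
  have hRP1 : (∏ i, δ i)⁻¹ < R := by
    refine lt_of_le_of_lt ?_ hRP
    gcongr
    nlinarith
  have hgR : GoodRadius p q δ ‖(r : ℂ)‖ R :=
    h0.goodRadius_big hp hq hpq hR1 (by rwa [hr']) hRA
  have hgr : GoodRadius p q δ ‖(r : ℂ)‖ r := h0.goodRadius_small hp hq hpq hr hr1
  have hgR1 : GoodRadius p q δ ‖(1 : ℂ)‖ R :=
    h1.goodRadius_big hp hq hpq hR1 (by rwa [norm_one, mul_one]) hRA
  have hgr1 : GoodRadius p q δ ‖(1 : ℂ)‖ r := h1.goodRadius_small hp hq hpq hr hr1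
  set L := (∫ ζ, ∫ ξ, boundaryTwo p q t e ζ ξ ∂tor δ ∂circ r)
    - ((p : ℂ) ^ n)⁻¹ * ∫ ξ, boundaryOne p q t e ξ ∂tor δ with hL
  have main : ∀ m : ℤ, L =
      (∫ ζ, oneFactor p q t m ζ * ∫ ξ, ∫ w, kernel p q t e m ζ ξ w ∂circ R ∂tor δ ∂circ r)
        - ∫ ξ, ∫ w, kernel p q t e m 1 ξ w ∂circ R ∂tor δ := by
    intro m
    have hint : ∀ ρ, GoodRadius p q δ ‖(r : ℂ)‖ ρ → Integrable (fun ζ => oneFactor p q t m ζ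
        * ∫ ξ, ∫ w, kernel p q t e m ζ ξ w ∂circ ρ ∂tor δ) (circ r) := fun ρ hρ => by
      have hi : Integrable _ (((circ r).prod (tor δ)).prod (circ ρ)) := integrable_of_compact
        (((isCompact_sphere (0 : ℂ) r).prod (isCompact_torSet δ)).prod (isCompact_sphere (0 : ℂ) ρ))
        (ae_prod_mem (ae_prod_mem (ae_circ_mem hr.le) (ae_tor hδ)) (ae_circ_mem hρ.pos.le))
        (integrable_oneFactor_mul_kernel (t := t) hr hr1 hp hq hpq h0 hρ e m)
      refine hi.integral_prod_left.integral_prod_left.congr (Eventually.of_forall fun ζ => ?_)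
      simp_rw [integral_const_mul]
    have hk1 := hgr1.integrable_kernel (t := t) h1 hp hq hpq e m
    have e1 : (∫ ζ, oneFactor p q t m ζ * ∫ ξ, ∫ w, kernel p q t e m ζ ξ w ∂circ R ∂tor δ ∂circ r)
        = ∫ ζ, ((∫ ξ, kernel p q t e m 1 ξ ζ ∂tor δ) + ∫ ξ, boundaryTwo p q t e ζ ξ ∂tor δ) ∂circ r := by
      -- The integral over the small circle, which is zero, is subtracted so that the residue
      -- formula applies for each ζ.
      rw [← sub_zero (∫ ζ, oneFactor p q t m ζ * _ ∂circ r),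
        ← integral_kernel_small (t := t) hr hr1 hp hq hpq h e m,
        ← integral_sub (hint R hgR) (hint r hgr)]
      refine integral_congr_ae ?_
      filter_upwards [ae_circ hr.le] with ζ hζ
      have h2 := (h ζ hζ).integral_integral_kernel_sub (t := t) hp hq hpq (hlt ζ hζ) e he m hr hr1
        hR1 (by rwa [hζ]) hRA
      rw [← mul_sub, h2, mul_add, ← integral_const_mul, ← integral_const_mul]
      congr 1
      · simp_rw [oneFactor_mul_resOne]
      · refine integral_congr_ae ?_
        filter_upwards [ae_tor hδ] with ξ hξ using oneFactor_mul_resProd (h ζ hζ) e m hξ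
    have hb2 : Integrable (fun ζ => ∫ ξ, boundaryTwo p q t e ζ ξ ∂tor δ) (circ r) := by
      have hi : Integrable (fun x : ℂ × (Fin n → ℂ) => oneFactor p q t 0 x.1
          * resProd p q t e 0 x.1 x.2) ((circ r).prod (tor δ)) := by
        refine integrable_of_compact ((isCompact_sphere (0 : ℂ) r).prod (isCompact_torSet δ))
          (ae_prod_mem (ae_circ_mem hr.le) (ae_tor hδ)) fun x hx =>
          (DifferentiableAt.continuousAt (𝕜 := ℂ) ?_).continuousWithinAt
        have hx1 : ‖x.1‖ = r := by simpa using hx.1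
        have d1 : DifferentiableAt ℂ (fun x : ℂ × (Fin n → ℂ) => oneFactor p q t 0 x.1) x :=
          differentiableAt_oneFactor (by fun_prop) (norm_pos_iff.1 (hx1 ▸ hr))
            (one_sub_ne (hx1 ▸ hr1))
        have d2 := (h x.1 hx1).differentiableAt_resProd (t := t) (e := e) (m := 0) hp hq hpq
          (hlt _ hx1) (ξ := fun x : ℂ × (Fin n → ℂ) => x.2) (ζ' := fun x => x.1) (x := x)
          (by fun_prop) (by fun_prop) hx.2 rfl
        fun_prop
      refine hi.integral_prod_left.congr ?_
      filter_upwards [ae_circ hr.le] with ζ hζ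
      refine integral_congr_ae ?_
      filter_upwards [ae_tor hδ] with ξ hξ using oneFactor_mul_resProd (h ζ hζ) e 0 hξ
    have e2 := integral_kernel_one (t := t) hp hq hpq h1 e he m hr hr1 hR1 hRP1 hRA
    rw [e1, integral_add hk1.integral_prod_right hb2, hL, ← e2]
    have e3 := integral_integral_swap (f := fun ξ w => kernel p q t e m 1 ξ w) hk1
    rw [e3]
    ring
  obtain ⟨C, hC⟩ := exists_norm_integral_kernel_le (t := t) hr hr1 hp hq hpq h0 hgR e
  obtain ⟨C', hC'⟩ := exists_norm_integral_kernel_one_le (t := t) hp hq hpq h1 hgR1 e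
  have a1 : 1 < (∏ i, δ i) * r * R := by
    rw [mul_comm]; exact (inv_lt_iff_one_lt_mul₀ (mul_pos hδpos hr)).1 hRP
  have a2 : 1 < (∏ i, δ i) * R := by
    rw [mul_comm]; exact (inv_lt_iff_one_lt_mul₀ hδpos).1 hRP1
  have hlim := ((tendsto_zpow_neg_natCast a1).mul_const C).add
    ((tendsto_zpow_neg_natCast a2).mul_const C')
  simp only [zero_mul, add_zero] at hlim
  have hle : ‖L‖ ≤ 0 := ge_of_tendsto' hlim fun k => by
    rw [main (-k)]
    exact (norm_sub_le _ _).trans (add_le_add (hC _) (hC' _))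
  exact sub_eq_zero.1 (norm_le_zero_iff.1 hle)

end

/-! ### The terms of the expansion -/

/-- The exponent of `psi`. -/
def energy (p q : ℝ) {j : ℕ} (ξ : Fin j → ℂ) : ℂ := (∑ i, eps p q (ξ i)) + eps p q (∏ i, ξ i)⁻¹

/-- The factors of `psi` that depend neither on the time nor on the positions. -/
def amplitude (p q : ℝ) {j : ℕ} (ξ : Fin j → ℂ) : ℂ :=
  (p : ℂ) ^ (j * (j + 1) / 2) * pairProd p q ξ * extProd p q ξ (∏ l, ξ l)⁻¹
    * (1 / (1 - ∏ l, ξ l)) * (1 / ∏ i, (1 - ξ i))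

theorem psi_eq (p q t : ℝ) {j : ℕ} (ξ : Fin j → ℂ) (z : Fin j → ℤ) :
    psi p q t ξ z = (∏ i, ξ i ^ z i) * amplitude p q ξ * Complex.exp (energy p q ξ * t) := by
  have h1 : ∀ i : Fin j, ∏ k ∈ Finset.Ioi i, (ξ k - ξ i) / (p + q * ξ i * ξ k - ξ i)
      = ∏ k, if i < k then pairFactor p q (ξ i) (ξ k) else 1 := fun i => by
    rw [← Finset.filter_lt_eq_Ioi, Finset.prod_filter]
    rfl
  simp only [psi, h1]
  rw [amplitude, energy, pairProd, extProd]
  simp only [pairFactor]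
  ring

/-- The integrand of the `j`-th term, with respect to the normalized measure. -/
def termIntegrand (p q t : ℝ) (j : ℕ) (y : ℕ → ℤ) (ξ : Fin j → ℂ) : ℂ :=
  (∏ i, ξ i) * psi p q t ξ fun i => y j - y i

/-- The `j`-th term of the expansion, for particles at `y 0, y 1, …`. -/
def term (p q t r : ℝ) (j : ℕ) (y : ℕ → ℤ) : ℂ :=
  ∫ ξ, termIntegrand p q t j y ξ ∂tor fun _ : Fin j => r

section

variable {p q t r : ℝ} {j : ℕ}

theorem PolesOutside.lt_one (h : PolesOutside p q j r) (hj : 1 ≤ j) : r < 1 := by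
  by_contra! hr
  exact (h (fun _ => 1) fun i => ⟨one_ne_zero, by simpa using hr⟩).2.2.2 ⟨0, hj⟩ (sub_self 1)

theorem PolesOutside.differentiableAt_amplitude (h : PolesOutside p q j r) {ξ : Fin j → ℂ}
    (hξ : ∀ i, ξ i ≠ 0 ∧ ‖ξ i‖ ≤ r) : DifferentiableAt ℂ (amplitude p q (j := j)) ξ := by
  obtain ⟨h1, h2, h3, h4⟩ := h ξ hξ
  have d0 : DifferentiableAt ℂ (fun ξ : Fin j → ℂ => ∏ i, ξ i) ξ :=
    differentiableAt_prod fun i _ => differentiableAt_coord i ξ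
  have hP : ∏ i, ξ i ≠ 0 := Finset.prod_ne_zero_iff.2 fun i _ => (hξ i).1
  have d1 := differentiableAt_pairProd (p := p) (q := q) (ξ := fun ξ : Fin j → ℂ => ξ) (x := ξ)
    differentiableAt_id h1
  have d2 := differentiableAt_extProd (p := p) (q := q) (ξ := fun ξ : Fin j → ℂ => ξ) (x := ξ)
    (b := fun ξ => (∏ l, ξ l)⁻¹) differentiableAt_id (by fun_prop (disch := assumption)) h2
  have d3 : DifferentiableAt ℂ (fun ξ : Fin j → ℂ => ∏ i, (1 - ξ i)) ξ :=
    differentiableAt_prod fun i _ => (differentiableAt_const _).sub (differentiableAt_coord i ξ)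
  have h5 : ∏ i, (1 - ξ i) ≠ 0 := Finset.prod_ne_zero_iff.2 fun i _ => h4 i
  unfold amplitude
  fun_prop (disch := assumption)

theorem differentiableAt_energy {ξ : Fin j → ℂ} (hξ : ∀ i, ξ i ≠ 0) :
    DifferentiableAt ℂ (energy p q (j := j)) ξ := by
  have d0 : DifferentiableAt ℂ (fun ξ : Fin j → ℂ => ∏ i, ξ i) ξ :=
    differentiableAt_prod fun i _ => differentiableAt_coord i ξ
  have hP : ∏ i, ξ i ≠ 0 := Finset.prod_ne_zero_iff.2 fun i _ => hξ i
  have d1 := differentiableAt_eps (p := p) (q := q) (x := ξ) (a := fun ξ => (∏ l, ξ l)⁻¹)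
    (by fun_prop (disch := assumption)) (inv_ne_zero hP)
  have d2 : DifferentiableAt ℂ (fun ξ : Fin j → ℂ => ∑ i, eps p q (ξ i)) ξ :=
    DifferentiableAt.fun_sum fun i _ => differentiableAt_eps (differentiableAt_coord i ξ) (hξ i)
  exact d2.add d1

theorem termIntegrand_eq (y : ℕ → ℤ) {ξ : Fin j → ℂ} :
    termIntegrand p q t j y ξ = ((∏ i, ξ i) * (∏ i, ξ i ^ (y j - y i)) * amplitude p q ξ)
      * Complex.exp (energy p q ξ * t) := by
  rw [termIntegrand, psi_eq]; ring

theorem PolesOutside.differentiableAt_coeff (h : PolesOutside p q j r) (y : ℕ → ℤ)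
    {ξ : Fin j → ℂ} (hξ : ∀ i, ξ i ≠ 0 ∧ ‖ξ i‖ ≤ r) :
    DifferentiableAt ℂ (fun ξ : Fin j → ℂ => (∏ i, ξ i) * (∏ i, ξ i ^ (y j - y i))
      * amplitude p q ξ) ξ := by
  have d0 : DifferentiableAt ℂ (fun ξ : Fin j → ℂ => ∏ i, ξ i) ξ :=
    differentiableAt_prod fun i _ => differentiableAt_coord i ξ
  have d1 : DifferentiableAt ℂ (fun ξ : Fin j → ℂ => ∏ i, ξ i ^ (y j - y i)) ξ :=
    differentiableAt_prod fun i _ => (differentiableAt_coord i ξ).zpow (Or.inl (hξ i).1)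
  have d2 := h.differentiableAt_amplitude hξ
  fun_prop

theorem PolesOutside.differentiableAt_termIntegrand (h : PolesOutside p q j r) (y : ℕ → ℤ)
    {ξ : Fin j → ℂ} (hξ : ∀ i, ξ i ≠ 0 ∧ ‖ξ i‖ ≤ r) :
    DifferentiableAt ℂ (termIntegrand p q t j y) ξ := by
  have d2 := h.differentiableAt_coeff y hξ
  have d3 := differentiableAt_energy (p := p) (q := q) fun i => (hξ i).1
  have : termIntegrand p q t j y = fun ξ : Fin j → ℂ => ((∏ i, ξ i) * (∏ i, ξ i ^ (y j - y i))
      * amplitude p q ξ) * Complex.exp (energy p q ξ * t) := funext fun ξ => termIntegrand_eq y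
  rw [this]
  fun_prop

theorem PolesOutside.continuousOn_termIntegrand (h : PolesOutside p q j r) (y : ℕ → ℤ)
    {ρ : Fin j → ℝ} (hρ : ∀ i, 0 < ρ i ∧ ρ i ≤ r) :
    ContinuousOn (termIntegrand p q t j y) (torSet ρ) :=
  continuousOn_torSet (fun _ hξ => h.differentiableAt_termIntegrand y hξ) hρ

theorem PolesOutside.integrable_termIntegrand (h : PolesOutside p q j r) (y : ℕ → ℤ)
    {ρ : Fin j → ℝ} (hρ : ∀ i, 0 < ρ i ∧ ρ i ≤ r) :
    Integrable (termIntegrand p q t j y) (tor ρ) :=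
  integrable_tor (fun i => (hρ i).1.le) (h.continuousOn_termIntegrand y hρ)

theorem PolesOutside.term_eq (h : PolesOutside p q j r) (hr : 0 < r) (y : ℕ → ℤ)
    {ρ : Fin j → ℝ} (hρ : ∀ i, 0 < ρ i ∧ ρ i ≤ r) :
    term p q t r j y = ∫ ξ, termIntegrand p q t j y ξ ∂tor ρ :=
  integral_tor_eq_of_differentiable (fun _ hξ => h.differentiableAt_termIntegrand y hξ) _ _
    (fun _ => ⟨hr, le_rfl⟩) hρ

/-- The variable conjugate to the position of the `k`-th particle in the `j`-th term. -/
def conjVar {j : ℕ} (ξ : Fin j → ℂ) (k : ℕ) : ℂ :=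
  if h : k < j then ξ ⟨k, h⟩ else if k = j then (∏ i, ξ i)⁻¹ else 1

theorem termIntegrand_update (y : ℕ → ℤ) (k : ℕ) (d : ℤ) {ξ : Fin j → ℂ} (hξ : ∀ i, ξ i ≠ 0) :
    termIntegrand p q t j (Function.update y k (y k + d)) ξ
      = termIntegrand p q t j y ξ * (conjVar ξ k ^ d)⁻¹ := by
  have key : ∏ i : Fin j, ξ i ^ (Function.update y k (y k + d) j - Function.update y k (y k + d) i)
      = (∏ i, ξ i ^ (y j - y i)) * (conjVar ξ k ^ d)⁻¹ := by
    rw [conjVar]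
    split_ifs with h1 h2
    · have hjk : j ≠ k := by omega
      rw [← Finset.mul_prod_erase _ _ (Finset.mem_univ (⟨k, h1⟩ : Fin j)),
        ← Finset.mul_prod_erase _ (fun i : Fin j => ξ i ^ (y j - y i))
          (Finset.mem_univ (⟨k, h1⟩ : Fin j))]
      have : ∀ i ∈ Finset.univ.erase (⟨k, h1⟩ : Fin j),
          ξ i ^ (Function.update y k (y k + d) j - Function.update y k (y k + d) i)
          = ξ i ^ (y j - y i) := fun i hi => by
        have : (i : ℕ) ≠ k := fun h => Finset.ne_of_mem_erase hi (Fin.ext h)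
        rw [Function.update_of_ne hjk, Function.update_of_ne this]
      rw [Finset.prod_congr rfl this]
      simp only [Function.update_self, Function.update_of_ne hjk]
      rw [← zpow_neg, show y j - (y k + d) = (y j - y k) + -d by ring, zpow_add₀ (hξ _)]
      ring
    · subst h2
      have : ∀ i : Fin k, Function.update y k (y k + d) i = y i := fun i =>
        Function.update_of_ne i.2.ne _ _
      simp only [Function.update_self, this]
      rw [inv_zpow, inv_inv, ← Finset.prod_zpow, ← Finset.prod_mul_distrib]
      refine Finset.prod_congr rfl fun i _ => ?_
      rw [← zpow_add₀ (hξ i)]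
      congr 1
      ring
    · have hjk : j ≠ k := fun h => h2 h.symm
      have : ∀ i : Fin j, Function.update y k (y k + d) i = y i := fun i =>
        Function.update_of_ne (by have := i.2; omega) _ _
      simp [this, Function.update_of_ne hjk]
  rw [termIntegrand_eq, termIntegrand_eq, key]
  ring

/-- The particles beyond `j` carry the variable 1, and ε(1) = p + q - 1 = 0, so the energy is the
same for every `N > j`. -/
theorem sum_conjVar (hpq : p + q = 1) {N : ℕ} (hN : j < N) {ξ : Fin j → ℂ} :
    ∑ k ∈ Finset.range N, (p * (conjVar ξ k ^ (1 : ℤ))⁻¹ + q * (conjVar ξ k ^ (-1 : ℤ))⁻¹ - 1)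
      = energy p q ξ := by
  have hpq' : (p : ℂ) + q - 1 = 0 := by rw [sub_eq_zero]; exact_mod_cast hpq
  have h1 : ∀ k, p * (conjVar ξ k ^ (1 : ℤ))⁻¹ + q * (conjVar ξ k ^ (-1 : ℤ))⁻¹ - 1
      = eps p q (conjVar ξ k) := fun k => by simp [eps]
  simp_rw [h1]
  rw [← Finset.sum_range_add_sum_Ico _ hN.le, Finset.sum_eq_sum_Ico_succ_bot hN,
    Finset.sum_eq_zero (s := Finset.Ico (j + 1) N), add_zero, energy, Finset.sum_range]
  · congr 1
    · refine Finset.sum_congr rfl fun i _ => ?_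
      rw [conjVar, dif_pos i.2]
    · rw [conjVar, dif_neg (lt_irrefl _), if_pos rfl]
  · intro k hk
    have := Finset.mem_Ico.1 hk
    rw [conjVar, dif_neg (by omega), if_neg (by omega), eps]
    simpa using hpq'

theorem integral_add_sub {X : Type*} [MeasurableSpace X] {μ : Measure X} {f g h : X → ℂ}
    (hf : Integrable f μ) (hg : Integrable g μ) (hh : Integrable h μ) (a b : ℂ) :
    ∫ x, (a * f x + b * g x - h x) ∂μ = a * ∫ x, f x ∂μ + b * ∫ x, g x ∂μ - ∫ x, h x ∂μ := by
  have h1 : Integrable (fun x => a * f x + b * g x) μ := (hf.const_mul a).add (hg.const_mul b)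
  rw [integral_sub h1 hh, integral_add (hf.const_mul a) (hg.const_mul b), integral_const_mul,
    integral_const_mul]

theorem hasDerivAt_integral_exp {n : ℕ} {ρ : Fin n → ℝ} (hρ : ∀ i, 0 ≤ ρ i)
    {a E : (Fin n → ℂ) → ℂ} (ha : ContinuousOn a (torSet ρ)) (hE : ContinuousOn E (torSet ρ))
    (t : ℝ) : HasDerivAt (fun t : ℝ => ∫ ξ, a ξ * Complex.exp (E ξ * t) ∂tor ρ)
      (∫ ξ, a ξ * Complex.exp (E ξ * t) * E ξ ∂tor ρ) t := by
  obtain ⟨A, hA⟩ := (isCompact_torSet ρ).exists_bound_of_continuousOn ha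
  obtain ⟨B, hB⟩ := (isCompact_torSet ρ).exists_bound_of_continuousOn hE
  have hc : ∀ s : ℝ, ContinuousOn (fun ξ => a ξ * Complex.exp (E ξ * s)) (torSet ρ) := fun s => by
    fun_prop
  refine (hasDerivAt_integral_of_dominated_loc_of_deriv_le (s := Metric.ball t 1)
    (F' := fun s ξ => a ξ * Complex.exp (E ξ * (s : ℝ)) * E ξ)
    (bound := fun _ => A * Real.exp (B * (|t| + 1)) * B) (Metric.ball_mem_nhds t one_pos)
    (Eventually.of_forall fun s => (integrable_tor hρ (hc s)).aestronglyMeasurable)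
    (integrable_tor hρ (hc t))
    (integrable_tor hρ ((hc t).mul hE)).aestronglyMeasurable ?_ (integrable_const _) ?_).2
  · filter_upwards [ae_tor hρ] with ξ hξ s hs
    have hs' : |s| ≤ |t| + 1 := by
      have h1 := Metric.mem_ball.1 hs
      rw [Real.dist_eq] at h1
      have h2 := abs_sub_abs_le_abs_sub s t
      linarith
    have h1 := hA ξ hξ
    have h2 := hB ξ hξ
    have hA0 := (norm_nonneg _).trans h1
    have hB0 := (norm_nonneg _).trans h2
    have h3 : ‖Complex.exp (E ξ * s)‖ ≤ Real.exp (B * (|t| + 1)) := by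
      refine (Complex.norm_exp_le_exp_norm _).trans (Real.exp_le_exp.2 ?_)
      rw [norm_mul, Complex.norm_real, Real.norm_eq_abs]
      gcongr
    rw [norm_mul, norm_mul]
    gcongr
  · filter_upwards with ξ s _
    have h1 : HasDerivAt (fun s : ℝ => E ξ * (s : ℂ)) (E ξ) s := by
      simpa using (Complex.ofRealCLM.hasDerivAt (x := s)).const_mul (E ξ)
    rw [mul_assoc]
    exact (h1.cexp).const_mul (a ξ)

/-- The terms of the expansion solve the free evolution equation. -/
theorem PolesOutside.hasDerivAt_term (h : PolesOutside p q j r) (hr : 0 < r) (hpq : p + q = 1)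
    (y : ℕ → ℤ) {N : ℕ} (hN : j < N) (t : ℝ) :
    HasDerivAt (fun t => term p q t r j y)
      (∑ k ∈ Finset.range N, (p * term p q t r j (Function.update y k (y k + 1))
        + q * term p q t r j (Function.update y k (y k + -1)) - term p q t r j y)) t := by
  have hρ : ∀ _ : Fin j, 0 < r ∧ r ≤ r := fun _ => ⟨hr, le_rfl⟩
  have hc := continuousOn_torSet (fun _ hξ => h.differentiableAt_coeff y hξ) hρ
  have hE := continuousOn_torSet (r := r) (fun _ hξ => differentiableAt_energy (p := p) (q := q)
    fun i => (hξ i).1) hρ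
  have key := hasDerivAt_integral_exp (fun _ => hr.le) hc hE t
  simp only [← termIntegrand_eq] at key
  have hi : ∀ y, Integrable (termIntegrand p q t j y) (tor fun _ => r) := fun y =>
    h.integrable_termIntegrand y hρ
  have h1 : ∀ k ∈ Finset.range N, (p * term p q t r j (Function.update y k (y k + 1))
        + q * term p q t r j (Function.update y k (y k + -1)) - term p q t r j y)
      = ∫ ξ, (p * termIntegrand p q t j (Function.update y k (y k + 1)) ξ
        + q * termIntegrand p q t j (Function.update y k (y k + -1)) ξ
        - termIntegrand p q t j y ξ) ∂tor fun _ => r := fun k _ =>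
    (integral_add_sub (hi _) (hi _) (hi _) _ _).symm
  have h2 : ∑ k ∈ Finset.range N, (p * term p q t r j (Function.update y k (y k + 1))
        + q * term p q t r j (Function.update y k (y k + -1)) - term p q t r j y)
      = ∫ ξ, termIntegrand p q t j y ξ * energy p q ξ ∂tor fun _ : Fin j => r := by
    have h3 : ∀ k ∈ Finset.range N, Integrable (fun ξ =>
        p * termIntegrand p q t j (Function.update y k (y k + 1)) ξ
          + q * termIntegrand p q t j (Function.update y k (y k + -1)) ξ
          - termIntegrand p q t j y ξ) (tor fun _ => r) := fun k _ =>
      (((hi _).const_mul _).add ((hi _).const_mul _)).sub (hi _)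
    rw [Finset.sum_congr rfl h1, ← integral_finsetSum _ h3]
    refine integral_congr_ae ?_
    filter_upwards [ae_tor fun _ => hr.le] with ξ hξ
    have hξ0 : ∀ i, ξ i ≠ 0 := fun i => norm_pos_iff.1 (mem_torSet.1 hξ i ▸ hr)
    rw [← sum_conjVar hpq hN, Finset.mul_sum]
    refine Finset.sum_congr rfl fun k _ => ?_
    rw [termIntegrand_update y k 1 hξ0, termIntegrand_update y k (-1) hξ0]
    ring
  rw [h2]
  exact key

end

/-! ### The boundary operator on the terms of the expansion -/

/-- The difference between free evolution and exclusion for neighbouring particles `k`, `k + 1`. -/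
def boundary (p q : ℝ) (k : ℕ) (F : (ℕ → ℤ) → ℂ) (y : ℕ → ℤ) : ℂ :=
  p * F (Function.update y k (y k + 1)) + q * F (Function.update y (k + 1) (y (k + 1) + -1)) - F y

section

variable {p q t r : ℝ} {j : ℕ}

/-- The radii `ρ` are left free because the antisymmetry argument needs equal ones and the residue
calculus needs distinct ones. -/
theorem PolesOutside.boundary_term (h : PolesOutside p q j r) (hr : 0 < r) (k : ℕ) (y : ℕ → ℤ)
    {ρ : Fin j → ℝ} (hρ : ∀ i, 0 < ρ i ∧ ρ i ≤ r) :
    boundary p q k (term p q t r j) y = ∫ ξ, termIntegrand p q t j y ξ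
      * (p * (conjVar ξ k)⁻¹ + q * conjVar ξ (k + 1) - 1) ∂tor ρ := by
  have hi : ∀ y, Integrable (termIntegrand p q t j y) (tor ρ) := fun y =>
    h.integrable_termIntegrand y hρ
  rw [boundary, h.term_eq hr _ hρ, h.term_eq hr _ hρ, h.term_eq hr _ hρ,
    ← integral_add_sub (hi _) (hi _) (hi _)]
  refine integral_congr_ae ?_
  filter_upwards [ae_tor fun i => (hρ i).1.le] with ξ hξ
  have hξ0 : ∀ i, ξ i ≠ 0 := fun i => norm_pos_iff.1 (mem_torSet.1 hξ i ▸ (hρ i).1)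
  rw [termIntegrand_update y k 1 hξ0, termIntegrand_update y (k + 1) (-1) hξ0]
  simp only [zpow_one, zpow_neg, inv_inv]
  ring

theorem PolesOutside.boundary_term_of_gt (h : PolesOutside p q j r) (hr : 0 < r)
    (hpq : p + q = 1) {k : ℕ} (hk : j < k) (y : ℕ → ℤ) :
    boundary p q k (term p q t r j) y = 0 := by
  have hpq' : (p : ℂ) + q - 1 = 0 := by rw [sub_eq_zero]; exact_mod_cast hpq
  rw [h.boundary_term hr k y fun _ => ⟨hr, le_rfl⟩]
  have : ∀ ξ : Fin j → ℂ, p * (conjVar ξ k)⁻¹ + q * conjVar ξ (k + 1) - 1 = 0 := fun ξ => by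
    rw [conjVar, conjVar, dif_neg (by omega), if_neg (by omega), dif_neg (by omega),
      if_neg (by omega)]
    simpa using hpq'
  simp [this]

/-- The boundary factor cancels the denominator p + q ξₐ ξ_b - ξₐ of the pair. What is left is
antisymmetric in ξₐ, ξ_b, because the two particles are adjacent, and integrates to zero over equal
circles. -/
theorem PolesOutside.boundary_term_of_lt (h : PolesOutside p q j r) (hr : 0 < r)
    {k : ℕ} (hk : k + 1 < j) (y : ℕ → ℤ) (hy : y (k + 1) = y k + 1) :
    boundary p q k (term p q t r j) y = 0 := by
  rw [h.boundary_term hr k y fun _ => ⟨hr, le_rfl⟩]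
  set a : Fin j := ⟨k, by omega⟩ with ha
  set b : Fin j := ⟨k + 1, hk⟩ with hb
  set σ := Equiv.swap a b with hσ
  have hab : (a : ℕ) + 1 = b := rfl
  set f : (Fin j → ℂ) → ℂ := fun ξ => termIntegrand p q t j y ξ
      * (p * (conjVar ξ k)⁻¹ + q * conjVar ξ (k + 1) - 1) with hf
  -- One power of ξₐ is moved to the boundary factor; the remaining exponents of ξₐ and ξ_b agree
  -- because `y b = y a + 1`.
  let z : Fin j → ℤ := fun i => if i = a then y j - y a - 1 else y j - y i
  have hz : ∀ i, z (σ i) = z i := by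
    intro i
    have hba : b ≠ a := fun h => by rw [h] at hab; omega
    have hyy : y (b : ℕ) = y (a : ℕ) + 1 := hy
    simp only [z, hσ]
    rcases eq_or_ne i a with rfl | hia
    · rw [Equiv.swap_apply_left, if_neg hba, if_pos rfl, hyy]; ring
    · rcases eq_or_ne i b with rfl | hib
      · rw [Equiv.swap_apply_right, if_pos rfl, if_neg hba, hyy]; ring
      · rw [Equiv.swap_apply_of_ne_of_ne hia hib]
  have hprod : ∀ ξ : Fin j → ℂ, (∀ i, ξ i ≠ 0) →
      ∏ i, ξ i ^ (y j - y i) = ξ a * ∏ i, ξ i ^ z i := fun ξ hξ => by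
    have h1 : ξ a = ∏ i, if i = a then ξ a else 1 := by simp
    rw [h1, ← Finset.prod_mul_distrib]
    refine Finset.prod_congr rfl fun i _ => ?_
    by_cases hi : i = a
    · rw [hi]
      simp only [z, if_true]
      rw [← zpow_one_add₀ (hξ a)]
      congr 1; ring
    · simp [z, hi]
  have hfe : ∀ ξ : Fin j → ℂ, (∀ i, ξ i ≠ 0) → f ξ
      = ((∏ i, ξ i) * (∏ i, ξ i ^ z i) * ((p : ℂ) ^ (j * (j + 1) / 2)
        * extProd p q ξ (∏ l, ξ l)⁻¹ * (1 / (1 - ∏ l, ξ l)) * (1 / ∏ i, (1 - ξ i)))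
        * Complex.exp (energy p q ξ * t))
        * ((p + q * ξ a * ξ b - ξ a) * pairProd p q ξ) := fun ξ hξ => by
    have h1 : conjVar ξ k = ξ a := by rw [conjVar, dif_pos]
    have h2 : conjVar ξ (k + 1) = ξ b := by rw [conjVar, dif_pos]
    simp only [hf]
    rw [h1, h2, termIntegrand_eq, hprod ξ hξ, amplitude]
    have h3 : ξ a * (p * (ξ a)⁻¹ + q * ξ b - 1) = p + q * ξ a * ξ b - ξ a := by
      field_simp [hξ a]
    rw [← h3]
    ring
  have hsymm : ∀ ξ ∈ torSet (fun _ : Fin j => r), f (fun i => ξ (σ i)) = -f ξ := by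
    intro ξ hξ
    rw [mem_torSet] at hξ
    have hξ0 : ∀ i, ξ i ≠ 0 := fun i => norm_pos_iff.1 (hξ i ▸ hr)
    have hden1 := (h ξ fun i => ⟨hξ0 i, (hξ i).le⟩).1 a b (Fin.lt_def.2 (by omega))
    -- `PolesOutside` covers only ordered pairs; the denominator for `(b, a)` comes from the
    -- permuted point.
    have hden2 := (h (fun i => ξ (σ i)) fun i => ⟨hξ0 _, (hξ _).le⟩).1 a b
      (Fin.lt_def.2 (by omega))
    simp only [hσ, Equiv.swap_apply_left, Equiv.swap_apply_right] at hden2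
    have hP : ∏ i, ξ (σ i) = ∏ i, ξ i := Equiv.prod_comp σ ξ
    have hZ : ∏ i, ξ (σ i) ^ z i = ∏ i, ξ i ^ z i := by
      rw [← Equiv.prod_comp σ fun i => ξ i ^ z i]
      simp only [hz]
    have hX : ∀ x, extProd p q (fun i => ξ (σ i)) x = extProd p q ξ x := fun x =>
      Equiv.prod_comp σ fun i => pairFactor p q (ξ i) x
    have hO : ∏ i, (1 - ξ (σ i)) = ∏ i, (1 - ξ i) := Equiv.prod_comp σ fun i => 1 - ξ i
    have hE : energy p q (fun i => ξ (σ i)) = energy p q ξ := by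
      rw [energy, energy, hP, Equiv.sum_comp σ fun i => eps p q (ξ i)]
    have hV := pairProd_swap p q ξ a b hab hden1 hden2
    rw [hfe _ fun i => hξ0 _, hfe ξ hξ0, hP, hZ, hX, hO, hE]
    simp only [hσ, Equiv.swap_apply_left, Equiv.swap_apply_right]
    rw [hV]
    ring
  have h1 := integral_tor_comp_perm r σ f
  have h2 : ∫ ξ, f (fun i => ξ (σ i)) ∂tor (fun _ => r) = -∫ ξ, f ξ ∂tor fun _ => r := by
    rw [← integral_neg]
    refine integral_congr_ae ?_
    filter_upwards [ae_tor fun _ => hr.le] with ξ hξ using hsymm ξ hξ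
  rw [h2] at h1
  exact self_eq_neg.1 h1.symm

/-- The particles j and j + 1 carry (∏ ξᵢ)⁻¹ and 1, so the boundary factor is -p (1 - ∏ ξᵢ) and
cancels the pole at ∏ ξᵢ = 1. -/
theorem termIntegrand_mul_boundaryOne {y : ℕ → ℤ} {ξ : Fin j → ℂ} (h1 : 1 - ∏ i, ξ i ≠ 0)
    (hξ : ∀ i, ξ i ≠ 0) :
    termIntegrand p q t j y ξ * (p * (conjVar ξ j)⁻¹ + q * conjVar ξ (j + 1) - (p + q))
      = -((p : ℂ) ^ (j * (j + 1) / 2 + 1) * boundaryOne p q t (fun i : Fin j => y j - y i) ξ) := by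
  have h2 : conjVar ξ j = (∏ i, ξ i)⁻¹ := by rw [conjVar, dif_neg (lt_irrefl _), if_pos rfl]
  have h3 : conjVar ξ (j + 1) = 1 := by rw [conjVar, dif_neg (by omega), if_neg (by omega)]
  have h4 : ∏ i : Fin j, oneFactor p q t (y j - y i + 1) (ξ i) = (∏ i, ξ i) * (∏ i : Fin j, ξ i ^ (y j - y i))
      * (1 / ∏ i, (1 - ξ i)) * Complex.exp (t * ∑ i, eps p q (ξ i)) := by
    rw [Finset.mul_sum, Complex.exp_sum, one_div, ← Finset.prod_inv_distrib, ← Finset.prod_mul_distrib,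
      ← Finset.prod_mul_distrib, ← Finset.prod_mul_distrib]
    refine Finset.prod_congr rfl fun i _ => ?_
    rw [oneFactor, zpow_add_one₀ (hξ i)]
    ring
  have h5 : Complex.exp (energy p q ξ * t) = Complex.exp (t * ∑ i, eps p q (ξ i))
      * Complex.exp (t * eps p q (∏ i, ξ i)⁻¹) := by
    rw [← Complex.exp_add, energy]; congr 1; ring
  have h6 : 1 / (1 - ∏ i, ξ i) * (p * (∏ i, ξ i) + q * 1 - (p + q)) = -p := by
    field_simp; ring
  rw [termIntegrand_eq, h2, h3, inv_inv, boundaryOne, h4, h5, amplitude]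
  linear_combination ((∏ i, ξ i) * (∏ i : Fin j, ξ i ^ (y j - y i)) * ((p : ℂ) ^ (j * (j + 1) / 2)
    * pairProd p q ξ * extProd p q ξ (∏ l, ξ l)⁻¹ * (1 / ∏ i, (1 - ξ i)))
    * (Complex.exp (t * ∑ i, eps p q (ξ i)) * Complex.exp (t * eps p q (∏ i, ξ i)⁻¹))) * h6

/-- The pair carries ζ and (∏ ηᵢ ζ)⁻¹. The boundary factor cancels the denominator pairing these
two, and 1 / (1 - ∏ ηᵢ ζ) turns into the one-variable denominator of (∏ ηᵢ ζ)⁻¹. -/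
theorem termIntegrand_mul_boundaryTwo {n : ℕ} {y : ℕ → ℤ} (hy : y (n + 1) = y n + 1)
    {η : Fin n → ℂ} {ζ : ℂ} (hη : ∀ i, η i ≠ 0) (hζ : ζ ≠ 0)
    (h1 : 1 - (∏ i, η i) * ζ ≠ 0)
    (hd : (p : ℂ) + q * ζ * ((∏ i, η i) * ζ)⁻¹ - ζ ≠ 0) :
    termIntegrand p q t (n + 1) y ((Fin.last n).insertNth (α := fun _ => ℂ) ζ η)
      * (p * (conjVar ((Fin.last n).insertNth (α := fun _ => ℂ) ζ η) n)⁻¹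
        + q * conjVar ((Fin.last n).insertNth (α := fun _ => ℂ) ζ η) (n + 1) - 1)
      = (p : ℂ) ^ ((n + 1) * (n + 2) / 2) * boundaryTwo p q t (fun i : Fin n => y n - y i) ζ η := by
  set ξ : Fin (n + 1) → ℂ := (Fin.last n).insertNth (α := fun _ => ℂ) ζ η with hξ
  set P := ∏ i, η i with hP
  have hP0 : P ≠ 0 := Finset.prod_ne_zero_iff.2 fun i _ => hη i
  have hPζ : P * ζ ≠ 0 := mul_ne_zero hP0 hζ
  have hprod : ∀ f : ℕ → ℂ → ℂ, ∏ i : Fin (n + 1), f i (ξ i)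
      = (∏ i : Fin n, f i (η i)) * f n ζ := fun f => by
    rw [Fin.prod_univ_succAbove _ (Fin.last n), mul_comm]
    simp [hξ]
  have hsum : ∑ i : Fin (n + 1), eps p q (ξ i) = (∑ i : Fin n, eps p q (η i)) + eps p q ζ := by
    rw [Fin.sum_univ_succAbove _ (Fin.last n), add_comm]
    simp [hξ]
  have e1 : ∏ i : Fin (n + 1), ξ i = P * ζ := hprod fun _ x => x
  have e2 : ∏ i : Fin (n + 1), ξ i ^ (y (n + 1) - y i)
      = (∏ i : Fin n, η i ^ (y n - y i + 1)) * ζ := by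
    rw [hprod fun i x => x ^ (y (n + 1) - y i), hy]
    congr 1
    · exact Finset.prod_congr rfl fun i _ => by congr 1; ring
    · rw [add_sub_cancel_left, zpow_one]
  have e3 : ∏ i : Fin (n + 1), (1 - ξ i) = (∏ i, (1 - η i)) * (1 - ζ) := hprod fun _ x => 1 - x
  have c1 : conjVar ξ n = ζ := by
    rw [conjVar, dif_pos (Nat.lt_succ_self n)]
    have : (⟨n, Nat.lt_succ_self n⟩ : Fin (n + 1)) = Fin.last n := rfl
    rw [this, hξ, Fin.insertNth_apply_same]
  have c2 : conjVar ξ (n + 1) = (P * ζ)⁻¹ := by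
    rw [conjVar, dif_neg (lt_irrefl _), if_pos rfl, e1]
  have h4 : ∏ i : Fin n, oneFactor p q t (y n - y i + 1) (η i) = (∏ i : Fin n, η i ^ (y n - y i + 1))
      * (1 / ∏ i, (1 - η i)) * Complex.exp (t * ∑ i, eps p q (η i)) := by
    rw [Finset.mul_sum, Complex.exp_sum, one_div, ← Finset.prod_inv_distrib,
      ← Finset.prod_mul_distrib, ← Finset.prod_mul_distrib]
    exact Finset.prod_congr rfl fun i _ => by rw [oneFactor]; ring
  have h5 : Complex.exp (energy p q ξ * t) = Complex.exp (t * ∑ i, eps p q (η i))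
      * Complex.exp (t * eps p q ζ) * Complex.exp (t * eps p q (P * ζ)⁻¹) := by
    rw [← Complex.exp_add, ← Complex.exp_add, energy, hsum, e1]; congr 1; ring
  have hw1 : 1 - (P * ζ)⁻¹ ≠ 0 := fun h => h1 (by
    have : (P * ζ)⁻¹ = 1 := (sub_eq_zero.1 h).symm
    rw [inv_eq_one.1 this, sub_self])
  have h6 : P * ζ * ζ * pairFactor p q ζ (P * ζ)⁻¹ * (1 / (1 - P * ζ))
      * (p * ζ⁻¹ + q * (P * ζ)⁻¹ - 1) = -(((P * ζ)⁻¹ - ζ) / (1 - (P * ζ)⁻¹)) := by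
    have h7 : p * ζ⁻¹ + q * (P * ζ)⁻¹ - 1 = (p + q * ζ * (P * ζ)⁻¹ - ζ) / ζ := by field_simp
    have h8 : 1 - (P * ζ)⁻¹ = -(1 - P * ζ) / (P * ζ) := by field_simp; ring
    rw [pairFactor, h7, h8]
    generalize (p : ℂ) + q * ζ * (P * ζ)⁻¹ - ζ = D at hd ⊢
    generalize (P * ζ)⁻¹ - ζ = G
    field_simp
  have h8 : 1 / ((∏ i, (1 - η i)) * (1 - ζ)) = 1 / (∏ i, (1 - η i)) * (1 / (1 - ζ)) := by
    rw [one_div_mul_one_div]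
  rw [termIntegrand_eq, c1, c2, boundaryTwo, h4, h5, amplitude, e1, e2, e3, hξ, extProd_insertNth,
    pairProd_insertNth_last, ← hP, h8]
  simp only [oneFactor, zpow_zero]
  linear_combination ((p : ℂ) ^ ((n + 1) * (n + 2) / 2) * (∏ i : Fin n, η i ^ (y n - y i + 1))
    * pairProd p q η * extProd p q η ζ * extProd p q η (P * ζ)⁻¹ * (1 / ∏ i, (1 - η i))
    * (1 / (1 - ζ)) * (Complex.exp (t * ∑ i, eps p q (η i))
      * Complex.exp (t * eps p q ζ) * Complex.exp (t * eps p q (P * ζ)⁻¹))) * h6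

end

/-! ### The boundary conditions satisfied by the expansion -/

section

variable {p q t r : ℝ} {j n : ℕ}

theorem prod_norm_le_of_mem {ι : Type*} {s : Finset ι} {ξ : ι → ℂ} {a : ℝ} (ha : a ≤ 1)
    (h : ∀ i ∈ s, ‖ξ i‖ ≤ a) {i : ι} (hi : i ∈ s) : ‖∏ l ∈ s, ξ l‖ ≤ a := by
  classical
  rw [norm_prod, ← Finset.mul_prod_erase _ _ hi]
  have h1 : ∏ l ∈ s.erase i, ‖ξ l‖ ≤ 1 := Finset.prod_le_one (fun _ _ => norm_nonneg _)
    fun l hl => (h l (Finset.mem_of_mem_erase hl)).trans ha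
  exact (mul_le_of_le_one_right (norm_nonneg _) h1).trans (h i hi)

theorem exists_small (hp : 0 < p) (hq : 0 ≤ q) (hr : 0 < r) :
    ∃ s : ℝ, 0 < s ∧ s ≤ p / 2 ∧ s ≤ r ∧ s ≤ 1 ∧ (q ≠ 0 → s ≤ q / 4) := by
  rcases eq_or_ne q 0 with h | h
  · exact ⟨min (p / 2) (min r 1), by positivity, by simp, by simp, by simp, fun h' => absurd h h'⟩
  · have hq0 : 0 < q := lt_of_le_of_ne hq h.symm
    exact ⟨min (min (p / 2) (min r 1)) (q / 4), by positivity, by simp, by simp, by simp,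
      fun _ => by simp⟩

/-- |P (x - p)| ≤ 2 s ≤ q / 2 < q, which explains the bound `q / 4`. -/
theorem den_ne_zero_of_small (hp : 0 < p) (hp1 : p ≤ 1) (hq : 0 ≤ q) {s : ℝ}
    (hs : q ≠ 0 → s ≤ q / 4) {P x : ℂ} (hP : ‖P‖ ≤ s) (hx : ‖x‖ ≤ 1) (h : q ≠ 0) :
    (q : ℂ) - P * (x - p) ≠ 0 := by
  have hq0 : 0 < q := lt_of_le_of_ne hq h.symm
  intro h0
  have h1 : ‖(q : ℂ)‖ = ‖P * (x - p)‖ := by rw [sub_eq_zero.1 h0]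
  rw [Complex.norm_real, Real.norm_of_nonneg hq, norm_mul] at h1
  have h2 : ‖x - p‖ ≤ 2 := (norm_sub_le _ _).trans (by
    rw [Complex.norm_real, Real.norm_of_nonneg hp.le]; linarith)
  have h3 : ‖P‖ * ‖x - p‖ ≤ s * 2 := mul_le_mul hP h2 (norm_nonneg _) ((norm_nonneg _).trans hP)
  linarith [hs h]

theorem den_ne_zero_of_small_one (hp : 0 < p) (hq : 0 ≤ q) (hpq : p + q = 1) {s : ℝ}
    (hs1 : s < 1) (hs : q ≠ 0 → s ≤ q / 4) {ξ : Fin n → ℂ} (hξ : ∀ i, ‖ξ i‖ ≤ s) (h : q ≠ 0)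
    (i : Fin n) : (q : ℂ) - (∏ l ∈ Finset.univ.erase i, ξ l) * (ξ i - p) ≠ 0 := by
  rcases (Finset.univ.erase i : Finset (Fin n)).eq_empty_or_nonempty with he | ⟨l, hl⟩
  -- With a single variable the product is empty, hence not small, but q - (ξ - p) = 1 - ξ.
  · rw [he, Finset.prod_empty, one_mul]
    have : (q : ℂ) - (ξ i - p) = 1 - ξ i := by
      have : (p : ℂ) + q = 1 := by exact_mod_cast hpq
      linear_combination this
    rw [this]
    exact one_sub_ne ((hξ i).trans_lt hs1)
  · exact den_ne_zero_of_small hp (by linarith) hq hs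
      (prod_norm_le_of_mem hs1.le (fun i _ => hξ i) hl) ((hξ i).trans hs1.le) h

theorem exists_admissible (hp : 0 < p) (hq : 0 ≤ q) (hpq : p + q = 1) (n : ℕ) (hr : 0 < r) :
    ∃ (δ : Fin n → ℝ) (ρ : ℝ), 0 < ρ ∧ ρ < 1 ∧ ρ ≤ r ∧ (∀ i, 0 < δ i ∧ δ i ≤ r) ∧
      (∀ ζ : ℂ, ‖ζ‖ = ρ → Admissible p q δ ζ) ∧ Admissible p q δ 1 := by
  obtain ⟨s, hs, hsp, hsr, hs1, hsq⟩ := exists_small hp hq hr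
  -- Distinct radii, all at most `s / 2`.
  set δ : Fin n → ℝ := fun i => s / (i + 2) with hδ
  have hpos : ∀ i, 0 < δ i := fun i => by positivity
  have hle : ∀ i, δ i ≤ s / 2 := fun i => by
    simp only [hδ]
    gcongr
    linarith [(Nat.cast_nonneg i : (0 : ℝ) ≤ ((i : ℕ) : ℝ))]
  have hinj : Function.Injective δ := fun i k h => by
    simp only [hδ] at h
    rw [div_eq_div_iff (by positivity) (by positivity)] at h
    exact Fin.ext (by exact_mod_cast (add_right_cancel (mul_left_cancel₀ hs.ne' h)).symm)
  have hprod : ∏ i, δ i ≤ 1 := Finset.prod_le_one (fun i _ => (hpos i).le)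
    fun i _ => by linarith [hle i]
  have hprod0 : 0 ≤ ∏ i, δ i := Finset.prod_nonneg fun i _ => (hpos i).le
  refine ⟨δ, s / 2, by positivity, by linarith, by linarith,
    fun i => ⟨hpos i, by linarith [hle i]⟩, fun ζ hζ => ?_, ?_⟩
  · refine ⟨hpos, fun i => by linarith [hle i], hinj, norm_pos_iff.1 (by rw [hζ]; positivity),
      by linarith, fun h ξ hξ i => ?_, ?_⟩
    · refine den_ne_zero_of_small hp (by linarith) hq hsq ?_
        ((hξ i).trans (by linarith [hle i])) h
      rw [norm_mul, hζ, norm_prod]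
      have : ∏ l ∈ Finset.univ.erase i, ‖ξ l‖ ≤ 1 := Finset.prod_le_one
        (fun _ _ => norm_nonneg _) fun l _ => (hξ l).trans (by linarith [hle l])
      nlinarith
    · exact mul_le_one₀ hprod (norm_nonneg _) (by linarith)
  · refine ⟨hpos, fun i => by linarith [hle i], hinj, one_ne_zero, by simp,
      fun h ξ hξ i => ?_, by simpa using hprod⟩
    rw [mul_one]
    exact den_ne_zero_of_small_one hp hq hpq (s := s / 2) (by linarith)
      (fun h => by linarith [hsq h]) (fun i => (hξ i).trans (hle i)) h i

theorem integral_tor_insertNth' {n : ℕ} (i : Fin (n + 1)) {ρ : ℝ} {δ : Fin n → ℝ} (hρ : 0 ≤ ρ)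
    (hδ : ∀ l, 0 ≤ δ l) {f : (Fin (n + 1) → ℂ) → ℂ}
    (hf : ContinuousOn f (torSet (i.insertNth (α := fun _ => ℝ) ρ δ))) :
    ∫ ξ, f ξ ∂tor (i.insertNth (α := fun _ => ℝ) ρ δ)
      = ∫ z, ∫ η, f (i.insertNth z η) ∂tor δ ∂circ ρ := by
  have hr : ∀ l, 0 ≤ i.insertNth (α := fun _ => ℝ) ρ δ l := fun l => by
    rcases Fin.eq_self_or_eq_succAbove i l with rfl | ⟨l, rfl⟩
    · simpa using hρ
    · simpa using hδ l
  have hp := (measurePreserving_piFinSuccAbove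
    (fun l => circ (i.insertNth (α := fun _ => ℝ) ρ δ l)) i).symm
  have hint := hp.integrable_comp_emb (MeasurableEquiv.measurableEmbedding _) |>.2
    (integrable_tor hr hf)
  have h1 := hp.integral_comp' (g := f)
  rw [tor, ← h1]
  refine (integral_prod _ hint).trans ?_
  simp only [Fin.insertNth_apply_same, Fin.insertNth_apply_succAbove]
  rfl

theorem PolesOutside.boundary_term_succ (h : PolesOutside p q (n + 1) r) (hr : 0 < r)
    (y : ℕ → ℤ) (hy : y (n + 1) = y n + 1) {δ : Fin n → ℝ} {ρ : ℝ}
    (hρ : 0 < ρ ∧ ρ ≤ r) (hδ : ∀ i, 0 < δ i ∧ δ i ≤ r) :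
    boundary p q n (term p q t r (n + 1)) y = (p : ℂ) ^ ((n + 1) * (n + 2) / 2)
      * ∫ ζ, ∫ ξ, boundaryTwo p q t (fun i : Fin n => y n - y i) ζ ξ ∂tor δ ∂circ ρ := by
  have hσ : ∀ i, 0 < (Fin.last n).insertNth (α := fun _ => ℝ) ρ δ i
      ∧ (Fin.last n).insertNth (α := fun _ => ℝ) ρ δ i ≤ r := fun l => by
    rcases Fin.eq_self_or_eq_succAbove (Fin.last n) l with rfl | ⟨l, rfl⟩
    · simpa only [Fin.insertNth_apply_same] using hρ
    · simpa only [Fin.insertNth_apply_succAbove] using hδ l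
  have hcont : ContinuousOn (fun ξ => termIntegrand p q t (n + 1) y ξ
      * (p * (conjVar ξ n)⁻¹ + q * conjVar ξ (n + 1) - 1))
      (torSet ((Fin.last n).insertNth (α := fun _ => ℝ) ρ δ)) := by
    have hc := fun y => h.continuousOn_termIntegrand (t := t) y hσ
    refine ((((hc (Function.update y n (y n + 1))).const_smul (p : ℂ)).add
      ((hc (Function.update y (n + 1) (y (n + 1) + -1))).const_smul (q : ℂ))).sub (hc y)).congr ?_
    intro ξ hξ
    have hξ0 : ∀ i, ξ i ≠ 0 := fun i => norm_pos_iff.1 (mem_torSet.1 hξ i ▸ (hσ i).1)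
    simp only [Pi.add_apply, Pi.sub_apply, Pi.smul_apply, smul_eq_mul]
    rw [termIntegrand_update y n 1 hξ0, termIntegrand_update y (n + 1) (-1) hξ0]
    simp only [zpow_one, zpow_neg, inv_inv]
    ring
  rw [h.boundary_term hr n y hσ, integral_tor_insertNth' _ hρ.1.le (fun l => (hδ l).1.le) hcont,
    ← integral_const_mul]
  refine integral_congr_ae ?_
  filter_upwards [ae_circ hρ.1.le] with ζ hζ
  rw [← integral_const_mul]
  refine integral_congr_ae ?_
  filter_upwards [ae_tor fun i => (hδ i).1.le] with η hη
  rw [mem_torSet] at hη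
  have hζn : ‖ζ‖ = ρ := by simpa using hζ
  have hξ : ∀ i, (Fin.last n).insertNth (α := fun _ => ℂ) ζ η i ≠ 0
      ∧ ‖(Fin.last n).insertNth (α := fun _ => ℂ) ζ η i‖ ≤ r := fun l => by
    rcases Fin.eq_self_or_eq_succAbove (Fin.last n) l with rfl | ⟨l, rfl⟩
    · rw [Fin.insertNth_apply_same, ← norm_pos_iff, hζn]; exact hρ
    · rw [Fin.insertNth_apply_succAbove, ← norm_pos_iff, hη l]; exact hδ l
  have hξ0 := (hξ (Fin.last n)).1
  obtain ⟨-, hb, hc, -⟩ := h _ hξ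
  have hb := hb (Fin.last n)
  have e1 : ∏ i, (Fin.last n).insertNth (α := fun _ => ℂ) ζ η i = (∏ i, η i) * ζ := by
    rw [Fin.prod_univ_succAbove _ (Fin.last n), mul_comm]
    simp only [Fin.insertNth_apply_same, Fin.insertNth_apply_succAbove]
  rw [e1] at hb hc
  rw [Fin.insertNth_apply_same] at hb hξ0
  exact termIntegrand_mul_boundaryTwo hy (fun i => norm_pos_iff.1 (hη i ▸ (hδ i).1)) hξ0 hc hb

theorem PolesOutside.boundary_term_self (h : PolesOutside p q n r) (hr : 0 < r)
    (hpq : p + q = 1) (y : ℕ → ℤ) {δ : Fin n → ℝ} (hδ : ∀ i, 0 < δ i ∧ δ i ≤ r) :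
    boundary p q n (term p q t r n) y = -((p : ℂ) ^ (n * (n + 1) / 2 + 1)
      * ∫ ξ, boundaryOne p q t (fun i : Fin n => y n - y i) ξ ∂tor δ) := by
  have hpq' : (1 : ℂ) = p + q := by exact_mod_cast hpq.symm
  rw [h.boundary_term hr n y hδ, ← integral_const_mul, ← integral_neg]
  refine integral_congr_ae ?_
  filter_upwards [ae_tor fun i => (hδ i).1.le] with η hη
  rw [mem_torSet] at hη
  have hη0 : ∀ i, η i ≠ 0 := fun i => norm_pos_iff.1 (hη i ▸ (hδ i).1)
  have h1 := (h η fun i => ⟨hη0 i, hη i ▸ (hδ i).2⟩).2.2.1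
  rw [← termIntegrand_mul_boundaryOne h1 hη0, hpq']

/-- Only the terms `j = k` and `j = k + 1` contribute, and they cancel by `integral_boundaryTwo`.
The sum starts at `j = 1`, so for `k = 0` nothing cancels the second one, which equals `p`. -/
theorem boundary_sum {N : ℕ} (h : ∀ j, 1 ≤ j → j < N → PolesOutside p q j r) (hr : 0 < r)
    (hp : 0 < p) (hq : 0 ≤ q) (hpq : p + q = 1) {k : ℕ} (hk : k + 1 < N) {y : ℕ → ℤ}
    (hy : y (k + 1) = y k + 1) (hlt : ∀ i < k, y i < y k) :
    boundary p q k (fun y => ∑ j ∈ Finset.Ico 1 N, term p q t r j y) y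
      = if k = 0 then (p : ℂ) else 0 := by
  have hlin : boundary p q k (fun y => ∑ j ∈ Finset.Ico 1 N, term p q t r j y) y
      = ∑ j ∈ Finset.Ico 1 N, boundary p q k (term p q t r j) y := by
    simp only [boundary, Finset.sum_add_distrib, Finset.sum_sub_distrib, Finset.mul_sum]
  obtain ⟨δ, ρ, hρ0, hρ1, hρr, hδ, hA, hA1⟩ := exists_admissible hp hq hpq k hr
  have hsucc : boundary p q k (term p q t r (k + 1)) y = (p : ℂ) ^ (k * (k + 1) / 2 + 1)
      * ∫ ξ, boundaryOne p q t (fun i : Fin k => y k - y i) ξ ∂tor δ := by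
    rw [(h (k + 1) (by omega) hk).boundary_term_succ hr y hy ⟨hρ0, hρr⟩ hδ,
      integral_boundaryTwo hρ0 hρ1 hp hq hpq hA hA1 _ fun i => by have := hlt i i.2; omega,
      ← mul_assoc]
    congr 1
    have hp' : (p : ℂ) ≠ 0 := by exact_mod_cast hp.ne'
    -- The prefactors p^(j(j+1)/2) are made so that the factor p^(-k) of `integral_boundaryTwo` is
    -- absorbed here.
    have : (k + 1) * (k + 2) / 2 = k * (k + 1) / 2 + 1 + k := by
      rw [show (k + 1) * (k + 2) = k * (k + 1) + (1 + k) * 2 by ring,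
        Nat.add_mul_div_right _ _ two_pos]
      ring
    rw [this, pow_add _ _ k, mul_assoc, mul_inv_cancel₀ (pow_ne_zero _ hp'), mul_one]
  have hzero : ∀ j ∈ Finset.Ico 1 N, j ≠ k ∧ j ≠ k + 1 →
      boundary p q k (term p q t r j) y = 0 := by
    intro j hj ⟨h1, h2⟩
    rw [Finset.mem_Ico] at hj
    have hj' := h j hj.1 hj.2
    rcases lt_or_ge j k with hjk | hjk
    · exact hj'.boundary_term_of_gt hr hpq hjk y
    · exact hj'.boundary_term_of_lt hr (by omega) y hy
  rw [hlin]
  rcases Nat.eq_zero_or_pos k with rfl | hk0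
  · rw [if_pos rfl, Finset.sum_eq_single 1 (fun j hj hj1 => hzero j hj
      ⟨by rw [Finset.mem_Ico] at hj; omega, by omega⟩)
      (fun h1 => absurd (Finset.mem_Ico.2 ⟨le_rfl, hk⟩) h1)]
    have := hsucc
    rw [integral_tor_zero _ _ Fin.elim0] at this
    rw [this]
    have he : eps p q 1 = 0 := by
      have : (p : ℂ) + q = 1 := by exact_mod_cast hpq
      rw [eps, inv_one, mul_one, mul_one, this, sub_self]
    simp [boundaryOne, pairProd, extProd, he]
  · rw [if_neg hk0.ne', Finset.sum_eq_add k (k + 1) (by omega) hzero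
      (fun h1 => absurd (Finset.mem_Ico.2 ⟨hk0, by omega⟩) h1)
      (fun h1 => absurd (Finset.mem_Ico.2 ⟨by omega, hk⟩) h1), hsucc,
      (h k hk0 (by omega)).boundary_term_self hr hpq y hδ, neg_add_cancel]

end

/-! ### The terms at time `0`, and a uniform bound -/

section

variable {p q t r : ℝ} {j n : ℕ}

theorem pairFactor_inv_prod {ξ : Fin n → ℂ} (hξ : ∀ i, ξ i ≠ 0) (i : Fin n) :
    pairFactor p q (ξ i) (∏ l, ξ l)⁻¹ = (ξ i)⁻¹ * ((1 - (∏ l, ξ l) * ξ i)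
      / (q - (∏ l ∈ Finset.univ.erase i, ξ l) * (ξ i - p))) := by
  have hQ : ∏ l ∈ Finset.univ.erase i, ξ l ≠ 0 := Finset.prod_ne_zero_iff.2 fun l _ => hξ l
  have hi := hξ i
  rw [pairFactor, ← Finset.mul_prod_erase _ _ (Finset.mem_univ i)]
  generalize ∏ l ∈ Finset.univ.erase i, ξ l = Q at hQ ⊢
  generalize ξ i = x at hi ⊢
  have h1 : (x * Q)⁻¹ - x = (x * Q)⁻¹ * (1 - x * Q * x) := by field_simp
  have h2 : p + q * x * (x * Q)⁻¹ - x = (x * Q)⁻¹ * x * (q - Q * (x - p)) := by field_simp; ring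
  rw [h1, h2, mul_assoc (x * Q)⁻¹, mul_div_mul_left _ _ (inv_ne_zero (mul_ne_zero hi hQ)),
    inv_mul_eq_div, div_div, mul_comm x (_ - _)]

theorem pairFactor_zero_right_inv_prod {ξ : Fin n → ℂ} (hξ : ∀ i, ξ i ≠ 0) (i : Fin n) :
    pairFactor 1 0 (ξ i) (∏ l, ξ l)⁻¹ = (∏ l, ξ l)⁻¹ * ((1 - (∏ l, ξ l) * ξ i) / (1 - ξ i)) := by
  have hP : ∏ l, ξ l ≠ 0 := Finset.prod_ne_zero_iff.2 fun l _ => hξ l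
  rw [pairFactor, ← mul_div_assoc]
  congr 1
  · field_simp
  · simp

/-- The pole of `extProd p q ξ (ξ₁ ⋯ ξₙ)⁻¹` at `ξ₁ ⋯ ξₙ = 0`. -/
theorem exists_extProd_inv_prod (hp : 0 < p) (hq : 0 ≤ q) (hpq : p + q = 1) {s : ℝ} (hs1 : s < 1)
    (hs : q ≠ 0 → s ≤ q / 4) (hn : 1 ≤ n) : ∃ (m : ℕ) (H : (Fin n → ℂ) → ℂ), m ≤ n ∧
      (∀ ξ : Fin n → ℂ, (∀ i, ‖ξ i‖ ≤ s) → DifferentiableAt ℂ H ξ) ∧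
      ∀ ξ : Fin n → ℂ, (∀ i, ξ i ≠ 0) →
        extProd p q ξ (∏ l, ξ l)⁻¹ = ((∏ l, ξ l) ^ m)⁻¹ * H ξ := by
  -- For `q = 0` every factor is singular in the whole product, giving order `n`; for `q ≠ 0` the
  -- factor of index `i` contributes only ξᵢ⁻¹, giving order 1 in total.
  rcases eq_or_ne q 0 with rfl | h
  · obtain rfl : p = 1 := by simpa using hpq
    refine ⟨n, fun ξ => ∏ i, ((1 - (∏ l, ξ l) * ξ i) / (1 - ξ i)), le_rfl, fun ξ hξ => ?_,
      fun ξ hξ => ?_⟩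
    · refine differentiableAt_prod fun i _ => ?_
      have d0 : DifferentiableAt ℂ (fun ξ : Fin n → ℂ => ∏ i, ξ i) ξ :=
        differentiableAt_prod fun i _ => differentiableAt_coord i ξ
      have d1 := differentiableAt_coord i ξ
      have h1 : 1 - ξ i ≠ 0 := one_sub_ne ((hξ i).trans_lt hs1)
      fun_prop (disch := assumption)
    · rw [extProd, Finset.prod_congr rfl fun i _ => pairFactor_zero_right_inv_prod hξ i,
        Finset.prod_mul_distrib]
      simp
  · refine ⟨1, fun ξ => ∏ i, ((1 - (∏ l, ξ l) * ξ i)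
      / (q - (∏ l ∈ Finset.univ.erase i, ξ l) * (ξ i - p))), hn, fun ξ hξ => ?_, fun ξ hξ => ?_⟩
    · refine differentiableAt_prod fun i _ => ?_
      have d0 : DifferentiableAt ℂ (fun ξ : Fin n → ℂ => ∏ i, ξ i) ξ :=
        differentiableAt_prod fun i _ => differentiableAt_coord i ξ
      have d2 : DifferentiableAt ℂ (fun ξ : Fin n → ℂ => ∏ l ∈ Finset.univ.erase i, ξ l) ξ :=
        differentiableAt_prod fun i _ => differentiableAt_coord i ξ
      have d1 := differentiableAt_coord i ξ
      have h1 := den_ne_zero_of_small_one hp hq hpq hs1 hs hξ h i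
      fun_prop (disch := assumption)
    · rw [extProd, Finset.prod_congr rfl fun i _ => pairFactor_inv_prod hξ i,
        Finset.prod_mul_distrib, Finset.prod_inv_distrib, pow_one]

/-- At time 0 there is no essential singularity, and the power `y j - y 0 ≥ j` of the first variable
compensates its pole, whose order is at most `j`. The integrand is thus that variable times a
function holomorphic in it on a small disc. -/
theorem PolesOutside.term_zero (h : PolesOutside p q j r) (hr : 0 < r) (hp : 0 < p) (hq : 0 ≤ q)
    (hpq : p + q = 1) (hj : 1 ≤ j) {y : ℕ → ℤ} (hy : y 0 + j ≤ y j) : term p q 0 r j y = 0 := by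
  obtain ⟨s, hs, hsp, hsr, hs1, hsq⟩ := exists_small hp hq hr
  set σ : ℝ := s / 2 with hσ
  have hσ0 : 0 < σ := by positivity
  have hσ1 : σ < 1 := by linarith
  have hρ : ∀ _ : Fin j, 0 < σ ∧ σ ≤ r := fun _ => ⟨hσ0, by linarith⟩
  obtain ⟨m, H, hm, hH, hX⟩ := exists_extProd_inv_prod hp hq hpq hσ1
    (fun h => by linarith [hsq h]) hj
  rw [h.term_eq hr y hρ]
  obtain ⟨n, rfl⟩ : ∃ n, j = n + 1 := ⟨j - 1, by omega⟩
  rw [integral_tor_insertNth _ (fun _ => hσ0.le) 0 (h.continuousOn_termIntegrand y hρ)]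
  refine integral_eq_zero_of_ae ?_
  filter_upwards [ae_tor (r := fun _ : Fin n => σ) fun _ => hσ0.le] with η hη
  rw [mem_torSet] at hη
  have hη0 : ∀ i, η i ≠ 0 := fun i => norm_pos_iff.1 (hη i ▸ hσ0)
  set P := ∏ i, η i with hP
  have hP0 : P ≠ 0 := Finset.prod_ne_zero_iff.2 fun i _ => hη0 i
  set k : ℕ := (y (n + 1) - y 0 - m).toNat with hk
  have hk' : (k : ℤ) = y (n + 1) - y 0 - m := Int.toNat_of_nonneg (by push_cast at hy; omega)
  set ι : ℂ → Fin (n + 1) → ℂ := fun z => (0 : Fin (n + 1)).insertNth (α := fun _ => ℂ) z η with hι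
  have e1 : ∀ z, ∏ i, ι z i = z * P := fun z => by
    rw [Fin.prod_univ_succAbove _ 0]
    simp only [hι, Fin.insertNth_apply_same, Fin.insertNth_apply_succAbove, hP]
  have e2 : ∀ z, ∏ i, ι z i ^ (y (n + 1) - y i)
      = z ^ (y (n + 1) - y 0) * ∏ i : Fin n, η i ^ (y (n + 1) - y (i + 1)) := fun z => by
    rw [Fin.prod_univ_succAbove _ 0]
    simp only [hι, Fin.insertNth_apply_same, Fin.insertNth_apply_succAbove]
    simp only [Fin.val_zero, Fin.succAbove_zero, Fin.val_succ]
  have hle : ∀ z, ‖z‖ ≤ σ → ∀ i, ‖ι z i‖ ≤ σ := fun z hz l => by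
    rcases Fin.eq_self_or_eq_succAbove 0 l with rfl | ⟨l, rfl⟩
    · simpa only [hι, Fin.insertNth_apply_same] using hz
    · simpa only [hι, Fin.insertNth_apply_succAbove] using (hη l).le
  set G : ℂ → ℂ := fun z => z ^ k * (P * (∏ i : Fin n, η i ^ (y (n + 1) - y (i + 1))) * (P ^ m)⁻¹
    * (p : ℂ) ^ ((n + 1) * (n + 1 + 1) / 2)) * (pairProd p q (ι z) * H (ι z) * (1 / (1 - z * P))
    * (1 / ∏ i, (1 - ι z i))) with hG
  have hGd : ∀ z, ‖z‖ ≤ σ → DifferentiableAt ℂ G z := fun z hz => by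
    have dι : DifferentiableAt ℂ ι z := differentiable_insertNth 0 η z
    have d1 := differentiableAt_pairProd (p := p) (q := q) dι fun i k _ =>
      den_ne hp hq hpq ((hle z hz i).trans_lt (by linarith)) ((hle z hz k).trans hσ1.le)
    have d2 : DifferentiableAt ℂ (fun z => H (ι z)) z := (hH _ (hle z hz)).comp z dι
    have d3 : DifferentiableAt ℂ (fun z => ∏ i, (1 - ι z i)) z := differentiableAt_prod fun i _ =>
      (differentiableAt_const _).sub (differentiableAt_pi.1 dι i)
    have h3 : ∏ i, (1 - ι z i) ≠ 0 := Finset.prod_ne_zero_iff.2 fun i _ =>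
      one_sub_ne ((hle z hz i).trans_lt hσ1)
    have h4 : 1 - z * P ≠ 0 := by
      rw [← e1]
      exact one_sub_ne ((prod_norm_le_of_mem hσ1.le (fun i _ => hle z hz i)
        (Finset.mem_univ 0)).trans_lt hσ1)
    have d4 : DifferentiableAt ℂ (fun z : ℂ => 1 - z * P) z := by fun_prop
    simp only [hG, one_div]
    exact ((differentiableAt_id.fun_pow k).mul_const _).fun_mul
      (((d1.fun_mul d2).fun_mul (d4.fun_inv h4)).fun_mul (d3.fun_inv h3))
  rw [Pi.zero_apply, ← integral_circ_mul_eq_zero hσ0.le hGd]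
  refine integral_congr_ae ?_
  filter_upwards [ae_circ hσ0.le] with z hz
  have hz0 : z ≠ 0 := norm_pos_iff.1 ((by simpa using hz : ‖z‖ = σ) ▸ hσ0)
  have hι0 : ∀ i, ι z i ≠ 0 := fun l => by
    rcases Fin.eq_self_or_eq_succAbove 0 l with rfl | ⟨l, rfl⟩
    · simpa only [hι, Fin.insertNth_apply_same] using hz0
    · simpa only [hι, Fin.insertNth_apply_succAbove] using hη0 l
  have hzk : z ^ (y (n + 1) - y 0) * (z ^ m)⁻¹ = z ^ k := by
    rw [← zpow_natCast z k, hk', zpow_sub₀ hz0 _ (m : ℤ), zpow_natCast, div_eq_mul_inv]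
  change termIntegrand p q 0 (n + 1) y (ι z) = z * G z
  rw [termIntegrand_eq, amplitude, hX _ hι0, e1, e2, mul_pow, mul_inv]
  simp only [hG, ← hzk, Complex.ofReal_zero, mul_zero, Complex.exp_zero]
  ring

/-- For `r < 1` and ordered positions the monomials have modulus at most 1; all other factors do not
depend on `y`. -/
theorem PolesOutside.exists_norm_term_le (h : PolesOutside p q j r) (hr : 0 < r) (hr1 : r < 1)
    (T : ℝ) : ∃ C : ℝ, ∀ (t : ℝ) (y : ℕ → ℤ), |t| ≤ T → (∀ i < j, y i ≤ y j) →
      ‖term p q t r j y‖ ≤ C := by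
  have hρ : ∀ _ : Fin j, 0 < r ∧ r ≤ r := fun _ => ⟨hr, le_rfl⟩
  obtain ⟨A, hA⟩ := (isCompact_torSet fun _ : Fin j => r).exists_bound_of_continuousOn
    (continuousOn_torSet (fun _ hξ => h.differentiableAt_amplitude hξ) hρ)
  obtain ⟨E, hE⟩ := (isCompact_torSet fun _ : Fin j => r).exists_bound_of_continuousOn
    (continuousOn_torSet (r := r) (fun _ hξ => differentiableAt_energy (p := p) (q := q)
      fun i => (hξ i).1) hρ)
  refine ⟨A * Real.exp (E * T), fun t y ht hy => norm_integral_le_const ?_⟩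
  filter_upwards [ae_tor (r := fun _ : Fin j => r) fun _ => hr.le] with ξ hξ
  have hA' := hA ξ hξ
  have hE' := hE ξ hξ
  rw [mem_torSet] at hξ
  have h1 : ‖∏ i, ξ i‖ ≤ 1 := by
    rw [norm_prod]
    exact Finset.prod_le_one (fun _ _ => norm_nonneg _) fun i _ => (hξ i).le.trans hr1.le
  have h2 : ‖∏ i, ξ i ^ (y j - y i)‖ ≤ 1 := by
    rw [norm_prod]
    refine Finset.prod_le_one (fun _ _ => norm_nonneg _) fun i _ => ?_
    rw [norm_zpow, hξ i]
    exact zpow_le_one₀ hr hr1.le (sub_nonneg.2 (hy i i.2))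
  have h3 : ‖Complex.exp (energy p q ξ * t)‖ ≤ Real.exp (E * T) := by
    refine (Complex.norm_exp_le_exp_norm _).trans (Real.exp_le_exp.2 ?_)
    rw [norm_mul, Complex.norm_real]
    exact mul_le_mul hE' ht (norm_nonneg _) ((norm_nonneg _).trans hE')
  rw [termIntegrand_eq, norm_mul, norm_mul, norm_mul]
  have h4 : ‖∏ i, ξ i‖ * ‖∏ i, ξ i ^ (y j - y i)‖ ≤ 1 := mul_le_one₀ h1 (norm_nonneg _) h2
  have h5 : ‖∏ i, ξ i‖ * ‖∏ i, ξ i ^ (y j - y i)‖ * ‖amplitude p q ξ‖ ≤ A :=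
    (mul_le_of_le_one_left (norm_nonneg _) h4).trans hA'
  exact mul_le_mul h5 h3 (norm_nonneg _) ((norm_nonneg _).trans hA')

end

/-! ### The generator and free evolution -/

section

variable {N : ℕ}

/-- The positions of the particles, extended by `0`. -/
def positions (x : Fin N → ℤ) (k : ℕ) : ℤ := if h : k < N then x ⟨k, h⟩ else 0

@[simp] theorem positions_coe (x : Fin N → ℤ) (i : Fin N) : positions x i = x i := dif_pos i.2

theorem positions_update (x : Fin N → ℤ) (i : Fin N) (a : ℤ) :
    positions (Function.update x i a) = Function.update (positions x) i a := by
  ext k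
  by_cases hk : k < N
  · obtain ⟨k, rfl⟩ : ∃ l : Fin N, (l : ℕ) = k := ⟨⟨k, hk⟩, rfl⟩
    rw [positions_coe]
    rcases eq_or_ne k i with rfl | h
    · simp
    · rw [Function.update_of_ne h, Function.update_of_ne (Fin.val_ne_of_ne h), positions_coe]
  · rw [Function.update_of_ne (by have := i.2; omega), positions, positions, dif_neg hk, dif_neg hk]

theorem positions_lt (x : Config N) {k l : ℕ} (hkl : k < l) (hl : l < N) :
    positions x.1 k < positions x.1 l := by
  rw [positions, positions, dif_pos (hkl.trans hl), dif_pos hl]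
  exact x.2 (by simpa using hkl)

theorem strictMono_update_add_one (x : Config N) (i : Fin N) :
    StrictMono (Function.update x.1 i (x.1 i + 1))
      ↔ ¬((i : ℕ) + 1 < N ∧ positions x.1 (i + 1) = positions x.1 i + 1) := by
  constructor
  · rintro h ⟨h1, h2⟩
    have h3 : i < ⟨i + 1, h1⟩ := Fin.lt_def.2 (Nat.lt_succ_self _)
    have h4 := h h3
    rw [Function.update_self, Function.update_of_ne h3.ne'] at h4
    rw [positions_coe, positions, dif_pos h1] at h2
    omega
  · intro h a b hab
    have hx := x.2 hab
    rcases eq_or_ne a i with rfl | ha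
    · rw [Function.update_self, Function.update_of_ne hab.ne']
      have h1 : (a : ℕ) + 1 < N := by have := b.2; have := Fin.lt_def.1 hab; omega
      have h2 : positions x.1 (a + 1) ≠ positions x.1 a + 1 := fun h' => h ⟨h1, h'⟩
      have h3 : positions x.1 a < positions x.1 (a + 1) := positions_lt x (Nat.lt_succ_self _) h1
      have h4 : positions x.1 (a + 1) ≤ positions x.1 b := by
        rcases (Nat.succ_le_of_lt (Fin.lt_def.1 hab)).eq_or_lt with h5 | h5
        · rw [← h5]
        · exact (positions_lt x h5 b.2).le
      rw [positions_coe] at h2 h3 h4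
      omega
    · rw [Function.update_of_ne ha]
      rcases eq_or_ne b i with rfl | hb
      · rw [Function.update_self]; omega
      · rwa [Function.update_of_ne hb]

theorem strictMono_update_sub_one (x : Config N) (i : Fin N) :
    StrictMono (Function.update x.1 i (x.1 i + -1))
      ↔ ¬(1 ≤ (i : ℕ) ∧ positions x.1 i = positions x.1 (i - 1) + 1) := by
  constructor
  · rintro h ⟨h1, h2⟩
    have h0 : (i : ℕ) - 1 < N := by have := i.2; omega
    have h3 : ⟨i - 1, h0⟩ < i := Fin.lt_def.2 (by simp; omega)
    have h4 := h h3
    rw [Function.update_self, Function.update_of_ne h3.ne] at h4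
    rw [positions_coe, positions, dif_pos h0] at h2
    omega
  · intro h a b hab
    have hx := x.2 hab
    rcases eq_or_ne b i with rfl | hb
    · rw [Function.update_self, Function.update_of_ne hab.ne]
      have hab' := Fin.lt_def.1 hab
      have h1 : 1 ≤ (b : ℕ) := by omega
      have h2 : positions x.1 b ≠ positions x.1 (b - 1) + 1 := fun h' => h ⟨h1, h'⟩
      have h3 : positions x.1 (b - 1) < positions x.1 b := positions_lt x (by omega) b.2
      have h4 : positions x.1 a ≤ positions x.1 (b - 1) := by
        rcases (Nat.le_sub_one_of_lt hab').eq_or_lt with h5 | h5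
        · rw [← h5]
        · exact (positions_lt x h5 (by omega)).le
      rw [positions_coe] at h2 h3 h4
      omega
    · rw [Function.update_of_ne hb]
      rcases eq_or_ne a i with rfl | ha
      · rw [Function.update_self]; omega
      · rwa [Function.update_of_ne ha]

theorem attempt_one (x : Config N) (i : Fin N) : positions (attempt x i 1).1
    = if (i : ℕ) + 1 < N ∧ positions x.1 (i + 1) = positions x.1 i + 1 then positions x.1
      else Function.update (positions x.1) i (positions x.1 i + 1) := by
  rw [attempt]
  have := strictMono_update_add_one x i
  split_ifs with h1 h2 h2
  · exact absurd h2 (this.1 h1)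
  · rw [positions_coe, ← positions_update]
  · rfl
  · exact absurd (this.2 h2) h1

theorem attempt_neg_one (x : Config N) (i : Fin N) : positions (attempt x i (-1)).1
    = if 1 ≤ (i : ℕ) ∧ positions x.1 i = positions x.1 (i - 1) + 1 then positions x.1
      else Function.update (positions x.1) i (positions x.1 i + -1) := by
  rw [attempt]
  have := strictMono_update_sub_one x i
  split_ifs with h1 h2 h2
  · exact absurd h2 (this.1 h1)
  · rw [positions_coe, ← positions_update]
  · rfl
  · exact absurd (this.2 h2) h1

/-- Free evolution of the particles is the sum of the ASEP evolution and the boundary operators of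
the pairs of adjacent particles. -/
theorem sum_free_eq {p q : ℝ} (hpq : p + q = 1) (F : (ℕ → ℤ) → ℂ) (x : Config N) :
    ∑ k ∈ Finset.range N, (p * F (Function.update (positions x.1) k (positions x.1 k + 1))
        + q * F (Function.update (positions x.1) k (positions x.1 k + -1)) - F (positions x.1))
      = (∑ i : Fin N, (p * (F (positions (attempt x i 1).1) - F (positions x.1))
          + q * (F (positions (attempt x i (-1)).1) - F (positions x.1))))
        + ∑ k ∈ Finset.range (N - 1), if positions x.1 (k + 1) = positions x.1 k + 1 then
            boundary p q k F (positions x.1) else 0 := by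
  set y := positions x.1 with hy
  have hpq' : (p : ℂ) + q = 1 := by exact_mod_cast hpq
  -- `R` and `L` are the contributions of the suppressed jumps to the right and to the left.
  let R : ℕ → ℂ := fun k => if k + 1 < N ∧ y (k + 1) = y k + 1 then
    p * (F (Function.update y k (y k + 1)) - F y) else 0
  let L : ℕ → ℂ := fun k => if 1 ≤ k ∧ y k = y (k - 1) + 1 then
    q * (F (Function.update y k (y k + -1)) - F y) else 0
  have h1 : ∀ i : Fin N, p * F (Function.update y i (y i + 1))
      + q * F (Function.update y i (y i + -1)) - F y
      = (p * (F (positions (attempt x i 1).1) - F y)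
          + q * (F (positions (attempt x i (-1)).1) - F y)) + R i + L i := fun i => by
    rw [attempt_one, attempt_neg_one, ← hy]
    simp only [R, L]
    split_ifs <;> linear_combination (F y) * hpq'
  rw [Finset.sum_range]
  simp only [h1, Finset.sum_add_distrib]
  rw [add_assoc]
  congr 1
  rw [← Finset.sum_range R, ← Finset.sum_range L]
  rcases Nat.eq_zero_or_pos N with rfl | hN
  · simp
  · obtain ⟨M, rfl⟩ : ∃ M, N = M + 1 := ⟨N - 1, by omega⟩
    -- The right jump of `k` and the left jump of `k + 1` are blocked together, so `L` is shifted by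
    -- one; `R` vanishes at the last particle and `L` at the first.
    rw [Finset.sum_range_succ, Finset.sum_range_succ' L]
    have h2 : R M = 0 := if_neg (by omega)
    have h3 : L 0 = 0 := if_neg (by omega)
    rw [h2, h3, add_zero, add_zero, ← Finset.sum_add_distrib, Nat.add_sub_cancel]
    refine Finset.sum_congr rfl fun k hk => ?_
    rw [Finset.mem_range] at hk
    simp only [R, L, Nat.add_sub_cancel, boundary]
    by_cases h4 : y (k + 1) = y k + 1
    · rw [if_pos ⟨by omega, h4⟩, if_pos ⟨by omega, h4⟩, if_pos h4]
      linear_combination -(F y) * hpq'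
    · rw [if_neg fun h => h4 h.2, if_neg fun h => h4 h.2, if_neg h4, add_zero]

/-- Uniqueness of the bounded solution of the backward equation. -/
theorem eq_zero_of_backward {p q : ℝ} (hp : 0 ≤ p) (hq : 0 ≤ q) (hpq : p + q = 1)
    {w : ℝ → Config N → ℂ} {B T : ℝ}
    (hw : ∀ x t, HasDerivAt (fun t => w t x) (∑ i : Fin N, (p * (w t (attempt x i 1) - w t x)
      + q * (w t (attempt x i (-1)) - w t x))) t)
    (h0 : ∀ x, w 0 x = 0) (hB : ∀ x, ∀ t ∈ Icc 0 T, ‖w t x‖ ≤ B) :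
    ∀ x, ∀ t ∈ Icc 0 T, w t x = 0 := by
  set K : ℝ := 2 * N with hK
  -- Picard iteration: the right-hand side is at most 2N times the current bound, uniformly in the
  -- configuration, and each integration in time improves the bound by one order.
  have hbound : ∀ n : ℕ, ∀ x, ∀ t ∈ Icc 0 T, ‖w t x‖ ≤ B * ((K * t) ^ n / n.factorial) := by
    intro n
    induction n with
    | zero => simpa using hB
    | succ n ih =>
      intro x
      have hd : ∀ t : ℝ, HasDerivAt (fun t => B * ((K * t) ^ (n + 1) / (n + 1).factorial))
          (K * (B * ((K * t) ^ n / n.factorial))) t := fun t => by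
        have h1 := ((((hasDerivAt_id t).const_mul K).pow (n + 1)).div_const
          ((n + 1).factorial : ℝ)).const_mul B
        refine h1.congr_deriv ?_
        rw [Nat.factorial_succ]
        push_cast
        simp only [id]
        field_simp
      refine image_norm_le_of_norm_deriv_right_le_deriv_boundary (f := fun t => w t x)
        (fun t _ => (hw x t).continuousAt.continuousWithinAt)
        (fun t _ => (hw x t).hasDerivWithinAt) (by simp [h0]) hd ?_
      intro t ht
      set b := B * ((K * t) ^ n / n.factorial) with hb
      have ht' := Ico_subset_Icc_self ht
      have hd2 : ∀ z, ‖w t z - w t x‖ ≤ 2 * b := fun z =>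
        (norm_sub_le _ _).trans (by linarith [ih z t ht', ih x t ht'])
      have hi : ∀ i ∈ (Finset.univ : Finset (Fin N)), ‖(p : ℂ) * (w t (attempt x i 1) - w t x)
          + q * (w t (attempt x i (-1)) - w t x)‖ ≤ 2 * b := fun i _ => by
        refine (norm_add_le _ _).trans ?_
        rw [norm_mul, norm_mul, Complex.norm_real, Complex.norm_real, Real.norm_of_nonneg hp,
          Real.norm_of_nonneg hq]
        have h1 := mul_le_mul_of_nonneg_left (hd2 (attempt x i 1)) hp
        have h2 := mul_le_mul_of_nonneg_left (hd2 (attempt x i (-1))) hq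
        have h3 : p * (2 * b) + q * (2 * b) = 2 * b := by rw [← add_mul, hpq, one_mul]
        linarith
      refine (norm_sum_le_of_le _ hi).trans (le_of_eq ?_)
      rw [Finset.sum_const, Finset.card_univ, Fintype.card_fin, nsmul_eq_mul, hK]
      ring
  intro x t ht
  have hlim := (FloorSemiring.tendsto_pow_div_factorial_atTop (K * t)).const_mul B
  rw [mul_zero] at hlim
  exact norm_le_zero_iff.1 (ge_of_tendsto' hlim fun n => hbound n x t ht)

end

/-! ### The transition semigroup -/

section

variable {E : Type*} [NormedAddCommGroup E] [NormedSpace ℝ E] {A : E →L[ℝ] E}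

/-- The semigroup `exp (t A)`, at a real time. -/
def expGroup (A : E →L[ℝ] E) (t : ℝ) : E →L[ℝ] E :=
  NormedSpace.exp (t • A)

theorem expGroup_zero (f : E) : expGroup A 0 f = f := by
  rw [expGroup, zero_smul, NormedSpace.exp_zero]; rfl

variable [CompleteSpace E]

theorem hasDerivAt_expGroup (f : E) (t : ℝ) :
    HasDerivAt (fun s => expGroup A s f) (expGroup A t (A f)) t := by
  have := (hasDerivAt_exp_smul_const (𝕂 := ℝ) A t).clm_apply (hasDerivAt_const t f)
  simpa [expGroup] using this

theorem hasDerivAt_expGroup' (f : E) (t : ℝ) :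
    HasDerivAt (fun s => expGroup A s f) (A (expGroup A t f)) t := by
  have := (hasDerivAt_exp_smul_const' (𝕂 := ℝ) A t).clm_apply (hasDerivAt_const t f)
  simpa [expGroup] using this

theorem continuous_expGroup (f : E) : Continuous fun s => expGroup A s f :=
  continuous_iff_continuousAt.2 fun t => (hasDerivAt_expGroup f t).continuousAt

/-- With the operator acting first, this gives Dynkin's formula; `expGroup_eq_add_apply_integral`,
with the operator outside, gives the backward equation of `blockedTime`. -/
theorem expGroup_eq_add_integral (f : E) (t : ℝ) :
    expGroup A t f = f + ∫ s in (0 : ℝ)..t, expGroup A s (A f) := by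
  rw [intervalIntegral.integral_eq_sub_of_hasDerivAt (fun s _ => hasDerivAt_expGroup f s)
    ((continuous_expGroup _).intervalIntegrable _ _), expGroup_zero]
  abel

theorem expGroup_eq_add_apply_integral (f : E) (t : ℝ) :
    expGroup A t f = f + A (∫ s in (0 : ℝ)..t, expGroup A s f) := by
  rw [← ContinuousLinearMap.intervalIntegral_comp_comm _
    ((continuous_expGroup f).intervalIntegrable _ _),
    intervalIntegral.integral_eq_sub_of_hasDerivAt (fun s _ => hasDerivAt_expGroup' f s)
    ((A.continuous.comp (continuous_expGroup _)).intervalIntegrable _ _), expGroup_zero]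
  abel

end

/-! ### The blocked time and its identification with the contour integrals. -/

section

variable {N : ℕ} {p q : ℝ}

/-- The rate at which the left-most particle attempts jumps that are suppressed. -/
def blockedRate (N : ℕ) (p : ℝ) : Config N →ᵇ ℝ :=
  BoundedContinuousFunction.ofNormedAddCommGroupDiscrete
    (fun x => if 1 < N ∧ positions x.1 1 = positions x.1 0 + 1 then p else 0) |p| fun x => by
      split_ifs <;> simp

theorem blockedRate_apply (N : ℕ) (p : ℝ) (x : Config N) : blockedRate N p x
    = if 1 < N ∧ positions x.1 1 = positions x.1 0 + 1 then p else 0 := rfl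

/-- The expected time up to `t` that the left-most particle is blocked, weighted by the rate. -/
def blockedTime (N : ℕ) (p q t : ℝ) : Config N →ᵇ ℝ :=
  ∫ s in (0 : ℝ)..t, expGroup (generator N p q) s (blockedRate N p)

/-- The derivative is e^{tL} b, which equals b + L ∫₀ᵗ e^{sL} b ds. -/
theorem hasDerivAt_blockedTime (x : Config N) (t : ℝ) :
    HasDerivAt (fun t => ((blockedTime N p q t x : ℝ) : ℂ))
      ((∑ i : Fin N, (p * (((blockedTime N p q t (attempt x i 1) : ℝ) : ℂ) - blockedTime N p q t x)
        + q * (((blockedTime N p q t (attempt x i (-1)) : ℝ) : ℂ) - blockedTime N p q t x)))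
        + (blockedRate N p x : ℝ)) t := by
  have h1 : HasDerivAt (blockedTime N p q) _ t := intervalIntegral.integral_hasDerivAt_right
    ((continuous_expGroup (A := generator N p q) (blockedRate N p)).intervalIntegrable 0 t)
    ((continuous_expGroup _).stronglyMeasurableAtFilter _ _) (continuous_expGroup _).continuousAt
  rw [expGroup_eq_add_apply_integral, ← blockedTime] at h1
  have h2 := ((BoundedContinuousFunction.evalCLM ℝ x).hasFDerivAt.comp_hasDerivAt t h1).ofReal_comp
  refine h2.congr_deriv ?_
  rw [add_comm]
  simp [generator_apply]

/-- Both sides solve the backward equation with source `blockedRate`, vanish at time 0 and are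
uniformly bounded on `[0, t]`; their difference is zero by `eq_zero_of_backward`. -/
theorem sum_term_eq {r : ℝ} (h : ∀ j, 1 ≤ j → j < N → PolesOutside p q j r) (hr : 0 < r)
    (hp : 0 < p) (hq : 0 ≤ q) (hpq : p + q = 1) (x : Config N) {t : ℝ} (ht : 0 ≤ t) :
    ∑ j ∈ Finset.Ico 1 N, term p q t r j (positions x.1)
      = (blockedTime N p q t x : ℝ) := by
  set g : ℝ → (ℕ → ℤ) → ℂ := fun t y => ∑ j ∈ Finset.Ico 1 N, term p q t r j y with hg
  have hterm : ∀ j ∈ Finset.Ico 1 N, ∃ C : ℝ, ∀ (s : ℝ) (y : ℕ → ℤ), |s| ≤ t →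
      (∀ i < j, y i ≤ y j) → ‖term p q s r j y‖ ≤ C := fun j hj => by
    rw [Finset.mem_Ico] at hj
    have hj' := h j hj.1 hj.2
    exact hj'.exists_norm_term_le hr (hj'.lt_one hj.1) t
  choose! C hC using hterm
  have hgB : ∀ z : Config N, ∀ s ∈ Icc 0 t, ‖g s (positions z.1)‖ ≤ ∑ j ∈ Finset.Ico 1 N, C j :=
    fun z s hs => norm_sum_le_of_le _ fun j hj => hC j hj s _ (by rw [abs_of_nonneg hs.1]; exact hs.2)
      fun i hi => (positions_lt z hi (Finset.mem_Ico.1 hj).2).le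
  have hHc : Continuous (blockedTime N p q) :=
    intervalIntegral.continuous_primitive
      (fun a b => (continuous_expGroup (blockedRate N p)).intervalIntegrable a b) 0
  obtain ⟨D, hD⟩ := isCompact_Icc.exists_bound_of_continuousOn (hHc.continuousOn (s := Icc 0 t))
  have hHB : ∀ z : Config N, ∀ s ∈ Icc 0 t, ‖((blockedTime N p q s z : ℝ) : ℂ)‖ ≤ D := fun z s hs => by
    rw [Complex.norm_real]
    exact (BoundedContinuousFunction.norm_coe_le_norm _ z).trans (hD s hs)
  have hg0 : ∀ z : Config N, g 0 (positions z.1) = 0 := fun z =>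
    Finset.sum_eq_zero fun j hj => by
      rw [Finset.mem_Ico] at hj
      refine (h j hj.1 hj.2).term_zero hr hp hq hpq hj.1 ?_
      -- Strictly increasing integers grow by at least 1 at each step, which is the hypothesis of
      -- `term_zero`.
      have : ∀ k : ℕ, k < N → positions z.1 0 + k ≤ positions z.1 k := fun k => by
        induction k with
        | zero => simp
        | succ k ih =>
          intro hk
          have := positions_lt z (lt_add_one k) hk
          have := ih (by omega)
          push_cast
          omega
      exact this j hj.2
  have hgd : ∀ (z : Config N) (t : ℝ), HasDerivAt (fun t => g t (positions z.1))
      ((∑ i : Fin N, (p * (g t (positions (attempt z i 1).1) - g t (positions z.1))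
        + q * (g t (positions (attempt z i (-1)).1) - g t (positions z.1))))
        + (blockedRate N p z : ℝ)) t := fun z t => by
    have h1 : HasDerivAt (fun t => g t (positions z.1)) _ t :=
      HasDerivAt.fun_sum fun j hj => (h j (Finset.mem_Ico.1 hj).1
        (Finset.mem_Ico.1 hj).2).hasDerivAt_term hr hpq (positions z.1) (Finset.mem_Ico.1 hj).2 t
    refine h1.congr_deriv ?_
    have h2 : ∀ k ∈ Finset.range (N - 1), (if positions z.1 (k + 1) = positions z.1 k + 1 then
        boundary p q k (g t) (positions z.1) else 0)
        = if k = 0 then ((blockedRate N p z : ℝ) : ℂ) else 0 := fun k hk => by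
      rw [Finset.mem_range] at hk
      rw [blockedRate_apply]
      by_cases h3 : positions z.1 (k + 1) = positions z.1 k + 1
      · rw [if_pos h3, boundary_sum h hr hp hq hpq (by omega) h3
          fun i hi => positions_lt z hi (by omega)]
        rcases eq_or_ne k 0 with rfl | hk0
        · rw [if_pos rfl, if_pos rfl, if_pos ⟨by omega, h3⟩]
        · rw [if_neg hk0, if_neg hk0]
      · rw [if_neg h3]
        rcases eq_or_ne k 0 with rfl | hk0
        · rw [if_pos rfl, if_neg fun h => h3 h.2, Complex.ofReal_zero]
        · rw [if_neg hk0]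
    have h4 : (∑ k ∈ Finset.range (N - 1), if positions z.1 (k + 1) = positions z.1 k + 1 then
        boundary p q k (g t) (positions z.1) else 0) = ((blockedRate N p z : ℝ) : ℂ) := by
      rw [Finset.sum_congr rfl h2, Finset.sum_ite_eq' (Finset.range (N - 1))]
      split_ifs with h5
      · rfl
      · rw [Finset.mem_range] at h5
        rw [blockedRate_apply, if_neg fun h => by omega, Complex.ofReal_zero]
    rw [← h4, ← sum_free_eq hpq (g t) z, Finset.sum_comm]
    refine Finset.sum_congr rfl fun k _ => ?_
    simp only [hg, Finset.sum_add_distrib, Finset.sum_sub_distrib, Finset.mul_sum]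
  have key := eq_zero_of_backward (w := fun t z => g t (positions z.1) - (blockedTime N p q t z : ℝ)) hp.le hq hpq
    (fun z t => ((hgd z t).sub (hasDerivAt_blockedTime z t)).congr_deriv (by
      rw [add_sub_add_right_eq_sub, ← Finset.sum_sub_distrib]
      exact Finset.sum_congr rfl fun i _ => by ring))
    (fun z => by simp [hg0, blockedTime]) (fun z s hs => (norm_sub_le _ _).trans
      (add_le_add (hgB z s hs) (hHB z s hs))) x t ⟨ht, le_rfl⟩
  exact sub_eq_zero.1 key

/-! ### Expectations -/

variable {Ω : Type*} {m : MeasurableSpace Ω} {μ : Measure Ω}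
  {ℱ : Filtration ℝ≥0 m} {X : ℝ≥0 → Ω → Config N} {Y : Config N}

theorem measurable_config {E : Type*} [MeasurableSpace E] (f : Config N → E) : Measurable f :=
  measurable_of_countable f

theorem IsASEP.measurable_comp {E : Type*} [MeasurableSpace E] (h : IsASEP p q Y μ ℱ X)
    (f : Config N → E) (t : ℝ≥0) : Measurable fun ω => f (X t ω) :=
  (measurable_config f).comp ((h.adapted t).mono (ℱ.le t) le_rfl)

variable [IsProbabilityMeasure μ]

theorem IsASEP.integrable_comp (h : IsASEP p q Y μ ℱ X) (f : Config N →ᵇ ℝ) (t : ℝ≥0) :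
    Integrable (fun ω => f (X t ω)) μ :=
  Integrable.of_bound (h.measurable_comp f t).aestronglyMeasurable ‖f‖
    (Eventually.of_forall fun _ => f.norm_coe_le_norm _)

/-- The Markov property at time 0, where the configuration is almost surely `Y`. -/
theorem IsASEP.integral_comp (h : IsASEP p q Y μ ℱ X) (f : Config N →ᵇ ℝ) (t : ℝ≥0) :
    ∫ ω, f (X t ω) ∂μ = expGroup (generator N p q) t f Y := by
  have h1 := h.markov 0 t f
  rw [zero_add] at h1
  rw [← integral_condExp (ℱ.le 0), integral_congr_ae h1]
  have h2 : (fun ω => semigroup N p q t f (X 0 ω)) =ᵐ[μ] fun _ => expGroup (generator N p q) t f Y := by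
    filter_upwards [h.initial] with ω hω
    rw [hω]; rfl
  rw [integral_congr_ae h2]
  simp

/-- Contractivity of the semigroup at `Y` is read off from the process: the value is an expectation
of `f`. -/
theorem IsASEP.abs_expGroup_le (h : IsASEP p q Y μ ℱ X) (f : Config N →ᵇ ℝ) {C : ℝ}
    (hf : ∀ x, |f x| ≤ C) {s : ℝ} (hs : 0 ≤ s) : |expGroup (generator N p q) s f Y| ≤ C := by
  lift s to ℝ≥0 using hs
  rw [← h.integral_comp f s, ← Real.norm_eq_abs]
  simpa using norm_integral_le_of_norm_le_const (μ := μ) (f := fun ω => f (X s ω)) (C := C)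
    (Eventually.of_forall fun ω => hf (X s ω))

end

/-! ### The expected position of the left-most particle -/

section

variable {N : ℕ} {p q : ℝ}

theorem integral_apply {F : ℝ → Config N →ᵇ ℝ} (hF : Continuous F) (a b : ℝ) (x : Config N) :
    (∫ s in a..b, F s) x = ∫ s in a..b, F s x :=
  ((BoundedContinuousFunction.evalCLM ℝ x : (Config N →ᵇ ℝ) →L[ℝ] ℝ).intervalIntegral_comp_comm
    (hF.intervalIntegrable a b)).symm

variable [NeZero N]

theorem positions_zero (x : Fin N → ℤ) : positions x 0 = x 0 := by
  rw [← positions_coe x 0, Fin.val_zero]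

theorem attempt_apply_zero_of_ne (x : Config N) {i : Fin N} (hi : i ≠ 0) (d : ℤ) :
    (attempt x i d).1 0 = x.1 0 := by
  rw [attempt]
  split_ifs
  · exact Function.update_of_ne hi.symm _ _
  · rfl

theorem attempt_zero_one (x : Config N) : (attempt x 0 1).1 0
    = if 1 < N ∧ positions x.1 1 = positions x.1 0 + 1 then x.1 0 else x.1 0 + 1 := by
  have h0 : ((0 : Fin N) : ℕ) = 0 := Fin.val_zero _
  rw [← positions_zero (attempt x 0 1).1, attempt_one, ← positions_zero x.1]
  by_cases h : 1 < N ∧ positions x.1 1 = positions x.1 0 + 1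
  · rw [if_pos (by rwa [h0, zero_add]), if_pos h]
  · rw [if_neg (by rwa [h0, zero_add]), if_neg h, h0, Function.update_self]

theorem attempt_zero_neg_one (x : Config N) : (attempt x 0 (-1)).1 0 = x.1 0 + -1 := by
  rw [← positions_zero (attempt x 0 (-1)).1, attempt_neg_one, if_neg (by simp), Fin.val_zero, Function.update_self,
    positions_zero]

/-- A bounded function of the position of the left-most particle. -/
def leftFun (N : ℕ) [NeZero N] (φ : ℤ → ℝ) {M : ℝ} (hφ : ∀ k, |φ k| ≤ M) : Config N →ᵇ ℝ :=
  BoundedContinuousFunction.ofNormedAddCommGroupDiscrete (fun x => φ (x.1 0)) M fun _ => hφ _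

theorem leftFun_apply {φ : ℤ → ℝ} {M : ℝ} (hφ : ∀ k, |φ k| ≤ M) (x : Config N) :
    leftFun N φ hφ x = φ (x.1 0) := rfl

/-- Only jumps of the left-most particle matter, and its jumps to the left are never suppressed. -/
theorem generator_leftFun {φ : ℤ → ℝ} {M : ℝ} (hφ : ∀ k, |φ k| ≤ M) (x : Config N) :
    generator N p q (leftFun N φ hφ) x
      = (p - blockedRate N p x) * (φ (x.1 0 + 1) - φ (x.1 0))
        + q * (φ (x.1 0 + -1) - φ (x.1 0)) := by
  rw [generator_apply, Finset.sum_eq_single 0 (fun i _ hi => by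
    simp [leftFun_apply, attempt_apply_zero_of_ne x hi]) (by simp)]
  simp only [leftFun_apply, attempt_zero_one, attempt_zero_neg_one, blockedRate_apply]
  split_ifs <;> ring

theorem abs_generator_leftFun_le (hp : 0 ≤ p) (hq : 0 ≤ q) (hpq : p + q = 1) {φ : ℤ → ℝ} {M : ℝ}
    (hφ : ∀ k, |φ k| ≤ M) (hL : ∀ k, |φ (k + 1) - φ k| ≤ 1) (x : Config N) :
    |generator N p q (leftFun N φ hφ) x| ≤ 1 := by
  rw [generator_leftFun, blockedRate_apply]
  have h1 := abs_le.1 (hL (x.1 0))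
  have h2 := abs_le.1 (hL (x.1 0 + -1))
  rw [neg_add_cancel_right] at h2
  rw [abs_le]
  split_ifs <;> constructor <;> nlinarith

variable {Ω : Type*} {m : MeasurableSpace Ω} {μ : Measure Ω} [IsProbabilityMeasure μ]
  {ℱ : Filtration ℝ≥0 m} {X : ℝ≥0 → Ω → Config N} {Y : Config N}

theorem IsASEP.integral_leftFun (h : IsASEP p q Y μ ℱ X) {φ : ℤ → ℝ} {M : ℝ}
    (hφ : ∀ k, |φ k| ≤ M) (t : ℝ≥0) : ∫ ω, φ ((X t ω).1 0) ∂μ = φ (Y.1 0)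
      + ∫ s in (0 : ℝ)..t, expGroup (generator N p q) s (generator N p q (leftFun N φ hφ)) Y := by
  have h1 := h.integral_comp (leftFun N φ hφ) t
  simp only [leftFun_apply] at h1
  rw [h1, expGroup_eq_add_integral, BoundedContinuousFunction.add_apply, leftFun_apply,
    integral_apply (continuous_expGroup _)]

theorem IsASEP.integral_leftFun_le (h : IsASEP p q Y μ ℱ X) (hp : 0 ≤ p) (hq : 0 ≤ q)
    (hpq : p + q = 1) {φ : ℤ → ℝ} {M : ℝ} (hφ : ∀ k, |φ k| ≤ M)
    (hL : ∀ k, |φ (k + 1) - φ k| ≤ 1) (t : ℝ≥0) :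
    ∫ ω, φ ((X t ω).1 0) ∂μ ≤ φ (Y.1 0) + t := by
  rw [h.integral_leftFun hφ]
  have h1 := intervalIntegral.norm_integral_le_of_norm_le_const (a := 0) (b := (t : ℝ)) (C := 1)
    (f := fun s => expGroup (generator N p q) s (generator N p q (leftFun N φ hφ)) Y)
    fun s hs => h.abs_expGroup_le _ (abs_generator_leftFun_le hp hq hpq hφ hL)
      (by rw [uIoc_of_le t.coe_nonneg] at hs; exact hs.1.le)
  rw [one_mul, sub_zero, abs_of_nonneg t.coe_nonneg, Real.norm_eq_abs] at h1
  linarith [(abs_le.1 h1).2]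

/-- The truncation of an integer to `[-M, M]`. -/
def trunc (M : ℕ) (k : ℤ) : ℝ := ((max (-(M : ℤ)) (min M k) : ℤ) : ℝ)

theorem abs_trunc_le (M : ℕ) (k : ℤ) : |trunc M k| ≤ M := by
  rw [trunc, ← Int.cast_abs]
  have : |max (-(M : ℤ)) (min M k)| ≤ M := by rw [abs_le]; omega
  exact_mod_cast this

theorem abs_trunc_sub_le (M : ℕ) (k : ℤ) : |trunc M (k + 1) - trunc M k| ≤ 1 := by
  rw [trunc, trunc, ← Int.cast_sub, ← Int.cast_abs]
  have : |max (-(M : ℤ)) (min M (k + 1)) - max (-(M : ℤ)) (min M k)| ≤ 1 := by rw [abs_le]; omega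
  exact_mod_cast this

theorem trunc_eq {M : ℕ} {k : ℤ} (h : |k| ≤ M) : trunc M k = k := by
  rw [abs_le] at h
  rw [trunc, min_eq_right h.2, max_eq_right h.1]

theorem eventually_trunc_eq (k : ℤ) : ∀ᶠ M : ℕ in atTop, trunc M k = k := by
  filter_upwards [eventually_ge_atTop k.natAbs] with M hM
  exact trunc_eq (by rw [abs_le]; omega)

theorem abs_trunc_le_abs (M : ℕ) (k : ℤ) : |trunc M k| ≤ |(k : ℝ)| := by
  rw [trunc, ← Int.cast_abs, ← Int.cast_abs]
  have : |max (-(M : ℤ)) (min M k)| ≤ |k| := by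
    rcases abs_cases k with h | h <;> rw [abs_le] <;> omega
  exact_mod_cast this

/-- The absolute values of the truncations change by at most 1 per jump, so their expectations are
at most |y₁| + t for every truncation level; Fatou's lemma concludes. -/
theorem IsASEP.integrable_left (h : IsASEP p q Y μ ℱ X) (hp : 0 ≤ p) (hq : 0 ≤ q)
    (hpq : p + q = 1) (t : ℝ≥0) : Integrable (fun ω => (((X t ω).1 0 : ℤ) : ℝ)) μ := by
  have hmeas : ∀ φ : ℤ → ℝ, Measurable fun ω => φ ((X t ω).1 0) := fun φ =>
    h.measurable_comp (fun x => φ (x.1 0)) t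
  refine ⟨(hmeas fun k => (k : ℝ)).aestronglyMeasurable, ?_⟩
  have hbound : ∀ M : ℕ, ∫⁻ ω, ‖trunc M ((X t ω).1 0)‖ₑ ∂μ
      ≤ ENNReal.ofReal (|(Y.1 0 : ℝ)| + t) := fun M => by
    have hφ : ∀ k, |(|trunc M k|)| ≤ M := fun k => by rw [abs_abs]; exact abs_trunc_le M k
    have h1 := h.integral_leftFun_le hp hq hpq hφ
      (fun k => (abs_abs_sub_abs_le _ _).trans (abs_trunc_sub_le M k)) t
    have hint : Integrable (fun ω => trunc M ((X t ω).1 0)) μ :=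
      h.integrable_comp (leftFun N (trunc M) (abs_trunc_le M)) t
    rw [← ofReal_integral_norm_eq_lintegral_enorm hint]
    exact ENNReal.ofReal_le_ofReal (h1.trans (by linarith [abs_trunc_le_abs M (Y.1 0)]))
  have hlim : ∀ ω, liminf (fun M : ℕ => ‖trunc M ((X t ω).1 0)‖ₑ) atTop
      = ‖(((X t ω).1 0 : ℤ) : ℝ)‖ₑ := fun ω => by
    refine Tendsto.liminf_eq (tendsto_const_nhds.congr' ?_)
    filter_upwards [eventually_trunc_eq ((X t ω).1 0)] with M hM
    rw [hM]
  have h2 := lintegral_liminf_le (μ := μ) (u := atTop) (f := fun (M : ℕ) ω => ‖trunc M ((X t ω).1 0)‖ₑ)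
    fun M => (hmeas (trunc M)).enorm
  simp only [hlim] at h2
  refine (h2.trans (liminf_le_of_frequently_le'
    (Eventually.of_forall hbound).frequently)).trans_lt
    ENNReal.ofReal_lt_top

theorem tendsto_generator_trunc (x : Config N) :
    Tendsto (fun M => generator N p q (leftFun N (trunc M) (abs_trunc_le M)) x) atTop
      (𝓝 (p - q - blockedRate N p x)) := by
  refine tendsto_const_nhds.congr' ?_
  filter_upwards [eventually_trunc_eq (x.1 0), eventually_trunc_eq (x.1 0 + 1),
    eventually_trunc_eq (x.1 0 + -1)] with M h1 h2 h3
  rw [generator_leftFun, h1, h2, h3]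
  push_cast
  ring

theorem IsASEP.tendsto_expGroup_trunc (h : IsASEP p q Y μ ℱ X) (hp : 0 ≤ p) (hq : 0 ≤ q)
    (hpq : p + q = 1) {s : ℝ} (hs : 0 ≤ s) :
    Tendsto (fun M => expGroup (generator N p q) s
        (generator N p q (leftFun N (trunc M) (abs_trunc_le M))) Y) atTop
      (𝓝 (p - q - expGroup (generator N p q) s (blockedRate N p) Y)) := by
  lift s to ℝ≥0 using hs
  have h0 : ∀ f, expGroup (generator N p q) s f Y = ∫ ω, f (X s ω) ∂μ := fun f =>
    (h.integral_comp f s).symm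
  have h1 : p - q - ∫ ω, blockedRate N p (X s ω) ∂μ
      = ∫ ω, (p - q - blockedRate N p (X s ω)) ∂μ := by
    rw [integral_sub (integrable_const _) (h.integrable_comp _ _)]; simp
  simp only [h0]
  rw [h1]
  exact tendsto_integral_of_dominated_convergence (fun _ => 1)
    (fun M => (h.integrable_comp _ _).aestronglyMeasurable) (integrable_const _)
    (fun M => Eventually.of_forall fun ω => abs_generator_leftFun_le hp hq hpq _
      (abs_trunc_sub_le M) _)
    (Eventually.of_forall fun ω => tendsto_generator_trunc _)

/-- Dynkin's formula for the truncated position. The generator applied to it is bounded by 1 and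
converges pointwise to p - q - `blockedRate`, so dominated convergence applies on both sides. -/
theorem IsASEP.integral_left (h : IsASEP p q Y μ ℱ X) (hp : 0 ≤ p) (hq : 0 ≤ q)
    (hpq : p + q = 1) (t : ℝ≥0) : ∫ ω, (((X t ω).1 0 : ℤ) : ℝ) ∂μ
      = (p - q) * t + Y.1 0 - blockedTime N p q t Y := by
  have hmeas : ∀ φ : ℤ → ℝ, Measurable fun ω => φ ((X t ω).1 0) := fun φ =>
    h.measurable_comp (fun x => φ (x.1 0)) t
  have h1 : Tendsto (fun M : ℕ => ∫ ω, trunc M ((X t ω).1 0) ∂μ) atTop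
      (𝓝 (∫ ω, (((X t ω).1 0 : ℤ) : ℝ) ∂μ)) :=
    tendsto_integral_of_dominated_convergence (fun ω => |(((X t ω).1 0 : ℤ) : ℝ)|)
      (fun M => (hmeas (trunc M)).aestronglyMeasurable) (h.integrable_left hp hq hpq t).abs
      (fun M => Eventually.of_forall fun ω => abs_trunc_le_abs M _)
      (Eventually.of_forall fun ω => tendsto_const_nhds.congr'
        ((eventually_trunc_eq ((X t ω).1 0)).mono fun M hM => hM.symm))
  have hc : ∀ f, Continuous fun s => expGroup (generator N p q) s f Y := fun f =>
    (BoundedContinuousFunction.evalCLM ℝ Y).continuous.comp (continuous_expGroup f)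
  have h2 : Tendsto (fun M : ℕ => ∫ s in (0 : ℝ)..t, expGroup (generator N p q) s
      (generator N p q (leftFun N (trunc M) (abs_trunc_le M))) Y) atTop
      (𝓝 (∫ s in (0 : ℝ)..t, (p - q - expGroup (generator N p q) s (blockedRate N p) Y))) := by
    refine intervalIntegral.tendsto_integral_filter_of_dominated_convergence (fun _ => 1)
      (Eventually.of_forall fun M => (hc _).aestronglyMeasurable)
      (Eventually.of_forall fun M => Eventually.of_forall fun s hs => ?_)
      intervalIntegrable_const (Eventually.of_forall fun s hs => ?_)
    · rw [uIoc_of_le t.coe_nonneg] at hs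
      exact h.abs_expGroup_le _ (abs_generator_leftFun_le hp hq hpq _ (abs_trunc_sub_le M)) hs.1.le
    · rw [uIoc_of_le t.coe_nonneg] at hs
      exact h.tendsto_expGroup_trunc hp hq hpq hs.1.le
  have h3 : Tendsto (fun M : ℕ => trunc M (Y.1 0)) atTop (𝓝 (Y.1 0 : ℝ)) :=
    tendsto_const_nhds.congr' ((eventually_trunc_eq (Y.1 0)).mono fun M hM => hM.symm)
  have h4 : ∫ s in (0 : ℝ)..t, expGroup (generator N p q) s (blockedRate N p) Y
      = blockedTime N p q t Y := (integral_apply (continuous_expGroup _) 0 t Y).symm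
  have h5 := h3.add h2
  simp only [← h.integral_leftFun] at h5
  rw [tendsto_nhds_unique h1 h5, intervalIntegral.integral_sub intervalIntegrable_const
    ((hc _).intervalIntegrable _ _), h4, intervalIntegral.integral_const, sub_zero, smul_eq_mul]
  ring

end

/-! ### Bessel functions as integrals over circles -/

theorem continuousOn_sphere_of_ne_zero {r : ℝ} (hr : 0 < r) {f : ℂ → ℂ}
    (hf : ∀ w : ℂ, w ≠ 0 → ‖w‖ = r → ContinuousAt f w) : ContinuousOn f (Metric.sphere 0 r) :=
  fun w hw => by
    have hw' : ‖w‖ = r := by simpa using hw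
    exact (hf w (norm_pos_iff.1 (hw' ▸ hr)) hw').continuousWithinAt

theorem integral_circ_eq {r : ℝ} (hr : 0 < r) {f : ℂ → ℂ}
    (hf : ContinuousOn f (Metric.sphere 0 r)) :
    ∫ w, f w ∂circ r = (2 * Real.pi)⁻¹ * ∫ θ in (0 : ℝ)..2 * Real.pi, f (circleMap 0 r θ) := by
  have h1 : ∫ w, f w ∂circ r = ∫ w, w * (w⁻¹ * f w) ∂circ r := by
    refine integral_congr_ae ?_
    filter_upwards [ae_circ hr.le] with w hw
    rw [mul_inv_cancel_left₀ (norm_pos_iff.1 (hw ▸ hr))]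
  rw [h1, integral_circ r (by
    rw [abs_of_pos hr]
    exact (continuousOn_sphere_of_ne_zero hr fun w hw _ => continuousAt_inv₀ hw).mul hf),
    circleIntegral]
  have h2 : ∀ θ, deriv (circleMap 0 r) θ • ((circleMap 0 r θ)⁻¹ * f (circleMap 0 r θ))
      = Complex.I * f (circleMap 0 r θ) := fun θ => by
    have h3 : circleMap 0 r θ ≠ 0 := circleMap_ne_center hr.ne'
    rw [deriv_circleMap, smul_eq_mul]
    field_simp
  simp only [h2]
  rw [intervalIntegral.integral_const_mul, ← mul_assoc]
  congr 1
  have hpi : (Real.pi : ℂ) ≠ 0 := by simp [Real.pi_ne_zero]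
  push_cast
  field_simp

/-- In the angle, inversion is θ ↦ -θ, and the integrand is periodic. -/
theorem integral_circ_inv {r : ℝ} (hr : 0 < r) {f : ℂ → ℂ}
    (hf : ContinuousOn f (Metric.sphere 0 r⁻¹)) :
    ∫ w, f w⁻¹ ∂circ r = ∫ w, f w ∂circ r⁻¹ := by
  have h1 : ContinuousOn (fun w => f w⁻¹) (Metric.sphere 0 r) :=
    hf.comp (continuousOn_sphere_of_ne_zero hr fun w hw _ => continuousAt_inv₀ hw)
      fun w hw => by simpa using hw
  rw [integral_circ_eq hr h1, integral_circ_eq (inv_pos.2 hr) hf]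
  congr 1
  have h2 : ∀ θ : ℝ, (circleMap 0 r θ)⁻¹ = circleMap 0 r⁻¹ (-θ) := fun θ => by
    simp [circleMap, Complex.exp_neg]
    ring
  simp only [h2]
  rw [intervalIntegral.integral_comp_neg fun θ => f (circleMap 0 r⁻¹ θ)]
  have h3 := ((periodic_circleMap 0 r⁻¹).comp f).intervalIntegral_add_eq (-(2 * Real.pi)) 0
  simpa using h3

theorem integral_circ_zpow {r : ℝ} (hr : 0 < r) (k : ℤ) :
    ∫ w, w ^ k ∂circ r = if k = 0 then 1 else 0 := by
  split_ifs with h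
  · simp [h]
  · have h1 : ∫ w, w ^ k ∂circ r = ∫ w, w * w ^ (k - 1) ∂circ r := by
      refine integral_congr_ae ?_
      filter_upwards [ae_circ hr.le] with w hw
      rw [← zpow_one_add₀ (norm_pos_iff.1 (hw ▸ hr)), add_sub_cancel]
    rw [h1, integral_circ r (by
      rw [abs_of_pos hr]
      exact continuousOn_sphere_of_ne_zero hr fun w hw _ => continuousAt_zpow₀ _ _ (Or.inl hw))]
    have h2 := circleIntegral.integral_sub_zpow_of_ne (n := k - 1) (by omega) 0 0 r
    simp only [sub_zero] at h2
    rw [h2, mul_zero]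

theorem hasSum_integral_exp {r : ℝ} (hr : 0 ≤ r) {c g : ℂ → ℂ}
    (hc : ContinuousOn c (Metric.sphere 0 r)) (hg : ContinuousOn g (Metric.sphere 0 r)) :
    HasSum (fun k : ℕ => ∫ w, c w ^ k / k.factorial * g w ∂circ r)
      (∫ w, Complex.exp (c w) * g w ∂circ r) := by
  obtain ⟨C, hC⟩ := (isCompact_sphere (0 : ℂ) r).exists_bound_of_continuousOn hc
  obtain ⟨G, hG⟩ := (isCompact_sphere (0 : ℂ) r).exists_bound_of_continuousOn hg
  have h := hasSum_integral_of_summable_integral_norm (μ := circ r)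
    (F := fun (k : ℕ) w => c w ^ k / k.factorial * g w)
    (fun k => integrable_circ hr (((hc.pow k).div_const _).mul hg))
    (Summable.of_nonneg_of_le (fun k => integral_nonneg fun _ => norm_nonneg _) (fun k => ?_)
      ((Real.summable_pow_div_factorial C).mul_right G))
  · have h1 : ∀ w, ∑' k : ℕ, c w ^ k / k.factorial * g w = Complex.exp (c w) * g w := fun w => by
      rw [tsum_mul_right, Complex.exp_eq_exp_ℂ, NormedSpace.exp_eq_tsum_div]
    simpa only [h1] using h
  · have h2 : ∀ᵐ w ∂circ r, ‖‖c w ^ k / k.factorial * g w‖‖ ≤ C ^ k / k.factorial * G := by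
      filter_upwards [ae_circ hr] with w hw
      have hw' : w ∈ Metric.sphere (0 : ℂ) r := by simpa using hw
      rw [norm_norm, norm_mul, norm_div, norm_pow, Complex.norm_natCast]
      have := hC w hw'
      have := hG w hw'
      have := (norm_nonneg _).trans (hC w hw')
      gcongr
    have h3 := norm_integral_le_of_norm_le_const h2
    rw [probReal_univ, mul_one] at h3
    exact (Real.le_norm_self _).trans h3

/-- The generating function of the Bessel functions. -/
def besselGen (t : ℝ) (w : ℂ) : ℂ := Complex.exp (t * (w + w⁻¹))

theorem continuousAt_besselGen {t : ℝ} {w : ℂ} (hw : w ≠ 0) : ContinuousAt (besselGen t) w := by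
  unfold besselGen
  fun_prop (disch := assumption)

theorem integral_pow_mul_exp_inv {r : ℝ} (hr : 0 < r) (t : ℝ) (n : ℕ) :
    ∫ w, Complex.exp (t * w⁻¹) * w ^ n ∂circ r = t ^ n / n.factorial := by
  have h := hasSum_integral_exp hr.le (c := fun w => t * w⁻¹) (g := fun w => w ^ n)
    (continuousOn_sphere_of_ne_zero hr fun w hw _ => by fun_prop (disch := assumption))
    (by fun_prop)
  refine h.unique ?_
  have h1 : ∀ k : ℕ, ∫ w, (t * w⁻¹) ^ k / k.factorial * w ^ n ∂circ r
      = if k = n then (t : ℂ) ^ n / n.factorial else 0 := fun k => by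
    have h2 : ∫ w, (t * w⁻¹) ^ k / k.factorial * w ^ n ∂circ r
        = ∫ w, (t : ℂ) ^ k / k.factorial * w ^ ((n : ℤ) - k) ∂circ r := by
      refine integral_congr_ae ?_
      filter_upwards [ae_circ hr.le] with w hw
      rw [zpow_sub₀ (norm_pos_iff.1 (hw ▸ hr)), zpow_natCast, zpow_natCast, mul_pow, inv_pow]
      ring
    rw [h2, integral_const_mul, integral_circ_zpow hr]
    rcases eq_or_ne k n with rfl | hk
    · simp
    · rw [if_neg hk, if_neg (by omega), mul_zero]
  simp only [h1]
  exact hasSum_ite_eq n _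

/-- Expanding exp(t w) and extracting a coefficient of exp(t / w) for each power reproduces the
defining series termwise. -/
theorem integral_pow_mul_besselGen {r : ℝ} (hr : 0 < r) (t : ℝ) (n : ℕ) :
    ∫ w, w ^ n * besselGen t w ∂circ r = (besselI n (2 * t) : ℝ) := by
  have h := hasSum_integral_exp hr.le (c := fun w => t * w)
    (g := fun w => Complex.exp (t * w⁻¹) * w ^ n) (by fun_prop)
    (continuousOn_sphere_of_ne_zero hr fun w hw _ => by fun_prop (disch := assumption))
  have h1 : ∀ k : ℕ, ∫ w, (t * w) ^ k / k.factorial * (Complex.exp (t * w⁻¹) * w ^ n) ∂circ r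
      = (((2 * t / 2) ^ (2 * k + n) / ((k.factorial : ℝ) * ((k + n).factorial : ℝ)) : ℝ) : ℂ) :=
    fun k => by
      have h2 : ∀ w : ℂ, (t * w) ^ k / k.factorial * (Complex.exp (t * w⁻¹) * w ^ n)
          = t ^ k / k.factorial * (Complex.exp (t * w⁻¹) * w ^ (k + n)) := fun w => by ring
      simp only [h2]
      rw [integral_const_mul, integral_pow_mul_exp_inv hr, mul_div_cancel_left₀ t two_ne_zero]
      push_cast
      rw [div_mul_div_comm, ← pow_add]
      congr 2
      ring
  simp only [h1] at h
  rw [besselI, Complex.ofReal_tsum, h.tsum_eq]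
  congr 1
  ext w
  rw [besselGen, mul_add, Complex.exp_add]
  ring

/-! ### The first term in closed form -/

section

variable {r : ℝ}

theorem ne_zero_and_one_sub_ne (hr : 0 < r) (hr1 : r < 1) {w : ℂ} (hw : ‖w‖ = r) :
    w ≠ 0 ∧ 1 - w ≠ 0 :=
  ⟨norm_pos_iff.1 (hw ▸ hr), one_sub_ne (hw ▸ hr1)⟩

/-- The integrals to which the first term is reduced. -/
def besselTail (r t : ℝ) (n : ℕ) : ℂ := ∫ w, w ^ n / (1 - w) * besselGen t w ∂circ r

theorem integrable_pow_mul_besselGen (hr : 0 < r) (t : ℝ) (n : ℕ) :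
    Integrable (fun w => w ^ n * besselGen t w) (circ r) :=
  integrable_circ hr.le (continuousOn_sphere_of_ne_zero hr fun _ hw _ =>
    (continuousAt_pow _ _).mul (continuousAt_besselGen hw))

theorem integrable_besselTail (hr : 0 < r) (hr1 : r < 1) (t : ℝ) (n : ℕ) :
    Integrable (fun w => w ^ n / (1 - w) * besselGen t w) (circ r) :=
  integrable_circ hr.le (continuousOn_sphere_of_ne_zero hr fun w hw hwr =>
    ((continuousAt_pow _ _).div (by fun_prop) (ne_zero_and_one_sub_ne hr hr1 hwr).2).mul
      (continuousAt_besselGen hw))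

theorem besselTail_succ (hr : 0 < r) (hr1 : r < 1) (t : ℝ) (n : ℕ) :
    besselTail r t (n + 1) = besselTail r t n - (besselI n (2 * t) : ℝ) := by
  rw [besselTail, besselTail, ← integral_pow_mul_besselGen hr, ← integral_sub
    (integrable_besselTail hr hr1 t n) (integrable_pow_mul_besselGen hr t n)]
  refine integral_congr_ae ?_
  filter_upwards [ae_circ hr.le] with w hw
  have := (ne_zero_and_one_sub_ne hr hr1 hw).2
  field_simp
  ring

theorem besselGen_inv (t : ℝ) (w : ℂ) : besselGen t w⁻¹ = besselGen t w := by
  rw [besselGen, besselGen, inv_inv, add_comm]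

theorem differentiableAt_besselGen {t : ℝ} {w : ℂ} (hw : w ≠ 0) :
    DifferentiableAt ℂ (besselGen t) w := by
  unfold besselGen
  fun_prop (disch := assumption)

/-- The generating function is invariant under w ↦ w⁻¹, which exchanges the circles of radii r and 1
/ r. Crossing the pole at 1 gives `besselTail r t 1 + besselTail r t 0 = exp (2 * t)`, and the
recurrence gives the difference of the two. -/
theorem two_mul_besselTail_one (hr : 0 < r) (hr1 : r < 1) (t : ℝ) :
    2 * besselTail r t 1 = Complex.exp (2 * t) - (besselI 0 (2 * t) : ℝ) := by
  set f : ℂ → ℂ := fun w => (w - 1)⁻¹ * besselGen t w with hf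
  have hri : 1 < r⁻¹ := (one_lt_inv₀ hr).2 hr1
  have hd : ∀ w : ℂ, w ≠ 0 → w ≠ 1 → DifferentiableAt ℂ f w := fun w h0 h1 =>
    ((differentiableAt_id.sub_const (1 : ℂ)).fun_inv (sub_ne_zero.2 h1)).fun_mul
      (differentiableAt_besselGen h0)
  have h1 := integral_circ_sub hr (hr1.trans hri).le {(1 : ℂ)} id (injOn_id _)
    (fun _ => Complex.exp (2 * t)) f (fun w hw _ hw1 =>
      hd w (norm_pos_iff.1 (hr.trans_le hw)) (hw1 1 (Finset.mem_singleton_self _)))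
    (by simpa using ⟨hr1, hri⟩) (by
      simp only [Finset.mem_singleton, forall_eq, id]
      have h3 : Tendsto (besselGen t) (𝓝[≠] 1) (𝓝 (besselGen t 1)) :=
        (continuousAt_besselGen one_ne_zero).tendsto.mono_left nhdsWithin_le_nhds
      have h4 : besselGen t 1 = 1 * Complex.exp (2 * t) := by
        rw [besselGen, inv_one, one_mul]; congr 1; ring
      rw [← h4]
      refine h3.congr' ?_
      filter_upwards [self_mem_nhdsWithin] with w hw
      rw [hf, mul_inv_cancel_left₀ (sub_ne_zero.2 hw)])
  rw [Finset.sum_singleton] at h1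
  have h5 : ∫ w, f w ∂circ r⁻¹ = besselTail r t 1 := by
    rw [← integral_circ_inv hr (continuousOn_sphere_of_ne_zero (inv_pos.2 hr) fun w hw hwr =>
      (hd w hw fun h => by rw [h, norm_one] at hwr; exact hri.ne hwr).continuousAt)]
    refine integral_congr_ae ?_
    filter_upwards [ae_circ hr.le] with w hw
    obtain ⟨h6, h7⟩ := ne_zero_and_one_sub_ne hr hr1 hw
    simp only [hf]
    rw [besselGen_inv]
    congr 1
    have : w⁻¹ - 1 = (1 - w) / w := by field_simp
    rw [this, inv_div, pow_one]
  have h6 : ∫ w, f w ∂circ r = -besselTail r t 0 := by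
    rw [besselTail, ← integral_neg]
    congr 1
    ext w
    simp only [hf]
    rw [← neg_sub 1 w, inv_neg, pow_zero, one_div, neg_mul]
  rw [h5, h6] at h1
  have h7 := besselTail_succ hr hr1 t 0
  rw [zero_add] at h7
  linear_combination h1 + h7

theorem besselTail_eq (hr : 0 < r) (hr1 : r < 1) (t : ℝ) (n : ℕ) :
    besselTail r t (n + 1) = Complex.exp (2 * t) / 2 - (besselI 0 (2 * t) : ℝ) / 2
      - ∑ k ∈ Finset.Icc 1 n, (besselI k (2 * t) : ℝ) := by
  induction n with
  | zero =>
    simp only [zero_add, zero_lt_one, Finset.Icc_eq_empty_of_lt, Finset.sum_empty,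
      Complex.ofReal_zero]
    linear_combination (two_mul_besselTail_one hr hr1 t) / 2
  | succ n ih =>
    rw [besselTail_succ hr hr1, ih, Finset.sum_Icc_succ_top (by omega)]
    push_cast
    ring

/-- Integration by parts removes the double pole at 1: the derivative `F'` of w^(n+1) / (1 - w)
times the generating function has zero integral over the circle. -/
theorem integral_firstTerm (hr : 0 < r) (hr1 : r < 1) (t : ℝ) (n : ℕ) :
    ∫ w, w ^ (n + 1) * (1 + w) / (1 - w) ^ 2 * besselGen t w ∂circ r
      = 2 * t * ((besselI n (2 * t) : ℝ) + (besselI (n + 1) (2 * t) : ℝ))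
        - (2 * n + 1) * besselTail r t (n + 1) := by
  set F' : ℂ → ℂ := fun w => ((n + 1) * w ^ n / (1 - w) + w ^ (n + 1) / (1 - w) ^ 2
    + w ^ (n + 1) / (1 - w) * (t * (1 - (w ^ 2)⁻¹))) * besselGen t w with hF'
  have hd : ∀ w : ℂ, w ≠ 0 → 1 - w ≠ 0 →
      HasDerivAt (fun w => w ^ (n + 1) / (1 - w) * besselGen t w) (F' w) w := fun w h0 h1 => by
    have d1 := (hasDerivAt_pow (n + 1) w).fun_div ((hasDerivAt_id w).const_sub 1) h1
    have d2 := (((hasDerivAt_id w).add (hasDerivAt_inv h0)).const_mul (t : ℂ)).cexp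
    refine (d1.mul d2).congr_deriv ?_
    simp only [hF', besselGen, id, Pi.add_apply]
    push_cast
    field_simp
    ring
  have hc : ContinuousOn F' (Metric.sphere 0 |r|) := by
    rw [abs_of_pos hr]
    refine continuousOn_sphere_of_ne_zero hr fun w h0 hw => ?_
    have h1 := (ne_zero_and_one_sub_ne hr hr1 hw).2
    have h2 := continuousAt_besselGen (t := t) h0
    have h3 : (1 - w) ^ 2 ≠ 0 := pow_ne_zero 2 h1
    have h4 : w ^ 2 ≠ 0 := pow_ne_zero 2 h0
    fun_prop (disch := assumption)
  have h0 : ∫ w, w * F' w ∂circ r = 0 := by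
    refine (integral_circ r hc).trans (mul_eq_zero_of_right _
      (circleIntegral.integral_eq_zero_of_hasDerivWithinAt'
        (f := fun w => w ^ (n + 1) / (1 - w) * besselGen t w) fun w hw => ?_))
    have hw' : ‖w‖ = r := by simpa [abs_of_pos hr] using hw
    obtain ⟨h1, h2⟩ := ne_zero_and_one_sub_ne hr hr1 hw'
    exact (hd w h1 h2).hasDerivWithinAt
  have hi : Integrable (fun w => w * F' w) (circ r) :=
    integrable_circ hr.le (continuousOn_id.mul (by rwa [abs_of_pos hr] at hc))
  have h1 : ∫ w, w ^ (n + 1) * (1 + w) / (1 - w) ^ 2 * besselGen t w ∂circ r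
      = ∫ w, (2 * (w * F' w) + 2 * t * (w ^ n * besselGen t w + w ^ (n + 1) * besselGen t w)
        - (2 * n + 1) * (w ^ (n + 1) / (1 - w) * besselGen t w)) ∂circ r := by
    refine integral_congr_ae ?_
    filter_upwards [ae_circ hr.le] with w hw
    obtain ⟨h1, h2⟩ := ne_zero_and_one_sub_ne hr hr1 hw
    simp only [hF']
    field_simp
    ring
  have i1 := integrable_pow_mul_besselGen hr t n
  have i2 := integrable_pow_mul_besselGen hr t (n + 1)
  have i3 : Integrable (fun w => 2 * t * (w ^ n * besselGen t w + w ^ (n + 1) * besselGen t w))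
      (circ r) := (i1.add i2).const_mul _
  have i4 : Integrable (fun w => 2 * (w * F' w)
      + 2 * t * (w ^ n * besselGen t w + w ^ (n + 1) * besselGen t w)) (circ r) :=
    (hi.const_mul 2).add i3
  rw [h1, integral_sub i4 ((integrable_besselTail hr hr1 t (n + 1)).const_mul _),
    integral_add (hi.const_mul 2) i3, integral_const_mul,
    integral_const_mul, integral_const_mul, h0, integral_add i1 i2,
    integral_pow_mul_besselGen hr, integral_pow_mul_besselGen hr, ← besselTail]
  ring

end

/-! ### The main theorem -/

section

variable {p q t r : ℝ} {j : ℕ}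

theorem exists_polesOutside (hp : 0 < p) (hq : 0 ≤ q) (hpq : p + q = 1) :
    ∃ r₀ : ℝ, 0 < r₀ ∧ ∀ r : ℝ, 0 < r → r < r₀ → ∀ j : ℕ, 1 ≤ j → PolesOutside p q j r := by
  obtain ⟨s, hs, hsp, -, hs1, hsq⟩ := exists_small hp hq one_pos
  refine ⟨s, hs, fun r _ hrs j hj ξ hξ => ?_⟩
  have hr1 : r < 1 := hrs.trans_le hs1
  have hξ0 : ∀ i, ξ i ≠ 0 := fun i => (hξ i).1
  have hle : ∀ i, ‖ξ i‖ ≤ r := fun i => (hξ i).2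
  have h1 : ∀ i, 1 - ξ i ≠ 0 := fun i => one_sub_ne ((hle i).trans_lt hr1)
  refine ⟨fun i k _ => den_ne hp hq hpq ((hle i).trans_lt (hrs.trans_le hsp))
    ((hle k).trans hr1.le), fun i => ?_, one_sub_ne ((prod_norm_le_of_mem hr1.le
    (fun i _ => hle i) (Finset.mem_univ ⟨0, hj⟩)).trans_lt hr1), h1⟩
  rcases eq_or_ne q 0 with rfl | h
  · obtain rfl : p = 1 := by simpa using hpq
    simpa using h1 i
  · have h2 := den_ne_zero_of_small_one hp hq hpq hr1 (fun h => hrs.le.trans (hsq h)) hle h i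
    -- (empty)
    have hQ : ∏ l ∈ Finset.univ.erase i, ξ l ≠ 0 := Finset.prod_ne_zero_iff.2 fun l _ => hξ0 l
    have h3 : (p : ℂ) + q * ξ i * (∏ l, ξ l)⁻¹ - ξ i = (∏ l ∈ Finset.univ.erase i, ξ l)⁻¹
        * (q - (∏ l ∈ Finset.univ.erase i, ξ l) * (ξ i - p)) := by
      have hi := hξ0 i
      rw [← Finset.mul_prod_erase _ _ (Finset.mem_univ i)]
      field_simp
      ring
    rw [h3]
    exact mul_ne_zero (inv_ne_zero hQ) h2

theorem PolesOutside.circlesIntegral_psi (h : PolesOutside p q j r) (hr : 0 < r) (y : ℕ → ℤ) :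
    circlesIntegral r (fun ξ : Fin j → ℂ => psi p q t ξ fun i => y j - y i) = term p q t r j y := by
  have hc : ContinuousOn (fun ξ : Fin j → ℂ => psi p q t ξ fun i => y j - y i)
      (torSet fun _ => r) := by
    have hρ : ∀ _ : Fin j, 0 < r ∧ r ≤ r := fun _ => ⟨hr, le_rfl⟩
    have h0 : ∀ ξ ∈ torSet fun _ : Fin j => r, ∏ i, ξ i ≠ 0 := fun ξ hξ =>
      Finset.prod_ne_zero_iff.2 fun i _ => norm_pos_iff.1 (mem_torSet.1 hξ i ▸ hr)
    refine ((ContinuousOn.inv₀ (f := fun ξ : Fin j → ℂ => ∏ i, ξ i) (by fun_prop) h0).mul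
      (h.continuousOn_termIntegrand (t := t) y hρ)).congr fun ξ hξ => ?_
    rw [Pi.mul_apply, Pi.inv_apply, termIntegrand, inv_mul_cancel_left₀ (h0 ξ hξ)]
  rw [circlesIntegral_eq hr.le hc]
  rfl

/-- With one variable w w⁻¹ = 1, so the factor with w⁻¹ has denominator 1 - w and reduces to (1 + w)
/ w, while the two energies add up to w + w⁻¹ - 2. -/
theorem PolesOutside.term_one (h : PolesOutside p q 1 r) (hr : 0 < r) (hpq : p + q = 1) {n : ℕ}
    {y : ℕ → ℤ} (hy : y 1 - y 0 = n + 1) : term p q t r 1 y = p * Complex.exp (-2 * t)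
      * ∫ w, w ^ (n + 1) * (1 + w) / (1 - w) ^ 2 * besselGen t w ∂circ r := by
  have hr1 := h.lt_one le_rfl
  have hpq' : (p : ℂ) + q = 1 := by exact_mod_cast hpq
  rw [term, integral_tor_insertNth _ (fun _ => hr.le) 0
    (h.continuousOn_termIntegrand y fun _ => ⟨hr, le_rfl⟩), integral_tor_zero _ _ Fin.elim0,
    ← integral_const_mul]
  refine integral_congr_ae ?_
  filter_upwards [ae_circ hr.le] with w hw
  obtain ⟨h0, h1⟩ := ne_zero_and_one_sub_ne hr hr1 hw
  set ξ : Fin 1 → ℂ := (0 : Fin 1).insertNth (α := fun _ => ℂ) w Fin.elim0 with hξ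
  have hξ0 : ξ 0 = w := Fin.insertNth_apply_same _ _ _
  have h2 : Complex.exp ((eps p q w + eps p q w⁻¹) * t)
      = Complex.exp (-2 * t) * besselGen t w := by
    rw [besselGen, ← Complex.exp_add, eps, eps, inv_inv]
    congr 1
    linear_combination (w + w⁻¹) * t * hpq'
  have h3 : (w⁻¹ - w) / (p + q * w * w⁻¹ - w) = (1 + w) / w := by
    rw [mul_assoc, mul_inv_cancel₀ h0, mul_one, hpq']
    field_simp
    ring
  have h4 : w ^ ((n : ℤ) + 1) = w ^ (n + 1) := by rw [← zpow_natCast]; push_cast; rfl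
  rw [termIntegrand, psi]
  simp only [Fin.prod_univ_one, Fin.sum_univ_one, hξ0, Fin.val_zero, hy, h2, h3, h4]
  have h5 : Finset.Ioi (0 : Fin 1) = ∅ := rfl
  rw [h5, Finset.prod_empty]
  norm_num
  field_simp

end

end ASEP

end

theorem mainTheorem10 (p q : ℝ) (hp : 0 < p) (hq : 0 ≤ q) (hpq : p + q = 1) :
    -- all sufficiently small circles are admissible
    (∃ r₀ : ℝ, 0 < r₀ ∧ ∀ r : ℝ, 0 < r → r < r₀ →
      ∀ j : ℕ, 1 ≤ j → ASEP.PolesOutside p q j r) ∧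
    -- the expected position of the left-most particle
    (∀ (N : ℕ) [NeZero N] (Y : ASEP.Config N)
      (Ω : Type*) (m : MeasurableSpace Ω) (μ : MeasureTheory.Measure Ω)
      [MeasureTheory.IsProbabilityMeasure μ] (ℱ : MeasureTheory.Filtration NNReal m)
      (X : NNReal → Ω → ASEP.Config N), ASEP.IsASEP p q Y μ ℱ X →
      ∀ (t : NNReal) (r : ℝ), 0 < r →
        (∀ j : ℕ, 1 ≤ j → j ≤ N - 1 → ASEP.PolesOutside p q j r) →
        MeasureTheory.Integrable (fun ω => (((X t ω).1 0 : ℤ) : ℝ)) μ ∧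
        ((∫ ω, (((X t ω).1 0 : ℤ) : ℝ) ∂μ : ℝ) : ℂ)
          = ((p : ℂ) - q) * ((t : ℝ) : ℂ) + (Y.1 0 : ℂ)
            - ∑ j ∈ Finset.Ioi (0 : Fin N),
                ASEP.circlesIntegral (j := (j : ℕ)) r (fun ξ =>
                  ASEP.psi p q t ξ (fun i => Y.1 j - Y.1 (Fin.castLE j.isLt.le i)))) ∧
    -- the term `j = 1` in closed form
    (∀ (z : ℕ), 1 ≤ z → ∀ (t : NNReal) (r : ℝ), 0 < r → ASEP.PolesOutside p q 1 r →
      ASEP.circlesIntegral (j := 1) r (fun ξ => ASEP.psi p q t ξ (fun _ => (z : ℤ)))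
        = ((2 * p * t * Real.exp (-2 * t)
              * (ASEP.besselI (z - 1) (2 * t) + ASEP.besselI z (2 * t))
            + (2 * z - 1) * p
              * (1 / 2 * Real.exp (-2 * t) * ASEP.besselI 0 (2 * t) - 1 / 2
                + Real.exp (-2 * t) * ∑ k ∈ Finset.Icc 1 (z - 1), ASEP.besselI k (2 * t)) : ℝ)
            : ℂ)) := by 
  refine ⟨ASEP.exists_polesOutside hp hq hpq, ?_, ?_⟩
  · intro N _ Y Ω m μ _ ℱ X hX t r hr hP
    have hP' : ∀ j, 1 ≤ j → j < N → ASEP.PolesOutside p q j r := fun j h1 h2 => hP j h1 (by omega)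
    refine ⟨hX.integrable_left hp.le hq hpq t, ?_⟩
    have hsum : ∑ j ∈ Finset.Ioi (0 : Fin N), ASEP.circlesIntegral (j := (j : ℕ)) r (fun ξ =>
        ASEP.psi p q t ξ (fun i => Y.1 j - Y.1 (Fin.castLE j.isLt.le i)))
        = ∑ j ∈ Finset.Ico 1 N, ASEP.term p q t r j (ASEP.positions Y.1) := by
      have h1 : Finset.Ico 1 N = (Finset.Ioi (0 : Fin N)).map Fin.valEmbedding := by
        rw [Fin.map_valEmbedding_Ioi]
        ext k
        simp [Nat.succ_le_iff]
      rw [h1, Finset.sum_map]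
      refine Finset.sum_congr rfl fun j hj => ?_
      have hj0 : 1 ≤ (j : ℕ) := by
        have := Fin.lt_def.1 (Finset.mem_Ioi.1 hj)
        rw [Fin.val_zero] at this
        exact this
      rw [Fin.valEmbedding_apply, ← (hP' j hj0 j.2).circlesIntegral_psi hr]
      congr 1
      ext ξ
      congr 1
      ext i
      rw [ASEP.positions_coe, ← ASEP.positions_coe Y.1 (Fin.castLE _ i), Fin.val_castLE]
    rw [hsum, ASEP.sum_term_eq hP' hr hp hq hpq Y t.coe_nonneg, hX.integral_left hp.le hq hpq]
    push_cast
    ring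
  · intro z hz t r hr hP
    obtain ⟨n, rfl⟩ : ∃ n, z = n + 1 := ⟨z - 1, by omega⟩
    -- Positions chosen so that `y 1 - y 0 = z`.
    have h1 := hP.circlesIntegral_psi (t := t) hr fun i => if i = 0 then 0 else ((n + 1 : ℕ) : ℤ)
    rw [hP.term_one (n := n) hr hpq (by simp), ASEP.integral_firstTerm hr (hP.lt_one le_rfl),
      ASEP.besselTail_eq hr (hP.lt_one le_rfl)] at h1
    simp only [one_ne_zero, if_false, Fin.val_eq_zero, if_true, sub_zero] at h1
    rw [h1, Nat.add_sub_cancel]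
    have h2 : Complex.exp (-2 * t) * Complex.exp (2 * t) = 1 := by
      rw [← Complex.exp_add]; simp
    push_cast
    linear_combination (-(p : ℂ) * (2 * n + 1) / 2) * h2
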